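/- **Cubic norm structures.** Let $J$ be a finite-dimensional real vector space with a cubic norm structure: a cubic polynomial map $N:J\to\mathbb R$, a quadratic polynomial map $\#:J\to J$, an element $1_J$ and a nondegenerate symmetric bilinear trace pairing $(\,,)$ such that, with $x\times y=(x+y)^\#-x^\#-y^\#$ and $(\,,\,,)$ the symmetric trilinear form with $(x,x,x)=6N(x)$: $N(1_J)=1$, $1_J^\#=1_J$, $1_J\times x=(1_J,x)1_J-x$; $(x^\#)^\#=N(x)x$; $(x,y)=\frac14(1_J,1_J,x)(1_J,1_J,y)-(1_J,x,y)$; $N(x+y)=N(x)+(x^\#,y)+(x,y^\#)+N(y)$. Assume the trace pairing is positive definite. Identify $J^\vee$ with $J$ by the pairing, write $\mathrm{tr}(x)=(1_J,x)$, and write $i$ also for $i1_J$. All structures are extended $\mathbb C$-linearly to $J_{\mathbb C}=J\otimes\mathbb C$. **The space $W_J$.** $W_J=\mathbb R\oplus J\oplus J^\vee\oplus\mathbb R$, with $\langle(a,b,c,d),(a',b',c',d')\rangle=ad'-(b,c')+(c,b')-da'$ and $q(a,b,c,d)=(ad-(b,c))^2+4aN(c)+4dN(b)-4(b^\#,c^\#)$.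 The symmetric four-linear form is normalized by $(v,v,v,v)=2q(v)$, and $t$ is given by $\langle w,t(x,y,z)\rangle=(w,x,y,z)$. $H_J^1$ is the group of linear automorphisms of $W_J$ preserving $\langle\,,\rangle$ and $q$, and $\mathfrak h(J)^0\subseteq\mathrm{End}(W_J)$ is the Lie algebra of endomorphisms preserving them infinitesimally. It contains $\Phi_{w,w'}(x)=6t(w,w',x)+\langle w',x\rangle w+\langle w,x\rangle w'$ and $$n_L(x)(a,b,c,d)=(0,ax,b\times x,(c,x)),\qquad n_L^\vee(\gamma)(a,b,c,d)=((b,\gamma),\gamma\times c,d\gamma,0).$$ Let $\mathfrak m(J)$ be the algebra of endomorphisms $\phi$ of $J$ with $(\phi x,y,z)+(x,\phi y,z)+(x,y,\phi z)=t(\phi)(x,y,z)$ for a scalar $t(\phi)$, let $\mathfrak m(J)^0=\{t(\phi)=0\}$, and let $\tilde\phi$ be determined by $(\phi x,y)+(x,\tilde\phi y)=0$. For $\phi\in\mathfrak m(J)$ set $$M(\phi)(a,b,c,d)=\bigl(-\tfrac{t(\phi)}2a,\,-\tfrac{t(\phi)}2b+\phi(b),\,\tfrac{t(\phi)}2c+\tilde\phi(c),\,\tfrac{t(\phi)}2d\bigr)\in\mathfrak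 h(J)^0 .$$ For $\gamma,x\in J$ the map $\Phi_{\gamma,x}(z)=-\gamma\times(x\times z)+(\gamma,z)x+(\gamma,x)z$ lies in $\mathfrak m(J)$, with $t(\Phi_{\gamma,x})=2(\gamma,x)$. The group $H_J^1$ contains $n_G(x)=\exp n_L(x)$, $n_G^\vee(\gamma)=\exp n_L^\vee(\gamma)$, $\eta(\lambda)(a,b,c,d)=(\lambda^3a,\lambda b,\lambda^{-1}c,\lambda^{-3}d)$ and $J_2(a,b,c,d)=(d,-c,b,-a)$. **The Lie algebra $\mathfrak g(J)$.** $\mathfrak g(J)=\mathfrak g(J)_0\oplus\mathfrak g(J)_1$ with $\mathfrak g(J)_0=\mathfrak{sl}_2\oplus\mathfrak h(J)^0$ and $\mathfrak g(J)_1=V_2\otimes W_J$, where $V_2$ has standard basis $e,f$ with $\langle e,f\rangle=1$. The bracket is $$[\phi+v\otimes w,\phi'+v'\otimes w']=[\phi,\phi']+\tfrac12\langle w,w'\rangle\,v\cdot v'+\tfrac12\langle v,v'\rangle\Phi_{w,w'}+\phi(v'\otimes w')-\phi'(v\otimes w),$$ where $v\cdot v'\in\mathfrak{sl}_2$ acts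 by $x\mapsto\langle v',x\rangle v+\langle v,x\rangle v'$. A pair $(A,g)\in\mathrm{SL}_2\times H_J^1$ acts by $A\boxtimes g$: conjugation by $A$ on $\mathfrak{sl}_2$ and by $g$ on $\mathfrak h(J)^0$, and $v\otimes w\mapsto Av\otimes gw$. Let $\Theta=\left(\begin{smallmatrix}0&1\\-1&0\end{smallmatrix}\right)\boxtimes J_2$, and let $\mathfrak k=\mathfrak k_0\otimes\mathbb C$ and $\mathfrak p=\mathfrak p_0\otimes\mathbb C$, where $\mathfrak k_0,\mathfrak p_0$ are the $+1$- and $-1$-eigenspaces of $\Theta$ on $\mathfrak g(J)$. The bar denotes complex conjugation on $\mathfrak g(J)\otimes\mathbb C$ with respect to $\mathfrak g(J)$. The $\mathbb Z/3$-model is $\mathfrak{sl}_3\oplus\mathfrak m(J)^0\oplus V_3\otimes J\oplus V_3^\vee\otimes J^\vee$ (standard basis $v_1,v_2,v_3$ of $V_3$, dual basis $\delta_1,\delta_2,\delta_3$), identified with $\mathfrak g(J)$ by $E_{13}\mapsto\left(\begin{smallmatrix}0&1\\0&0\end{smallmatrix}\right)$, $E_{31}\mapsto\left(\begin{smallmatrix}0&0\\1&0\end{smallmatrix}\right)$,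 $E_{11}-E_{33}\mapsto\left(\begin{smallmatrix}1&0\\0&-1\end{smallmatrix}\right)$, $E_{11}-2E_{22}+E_{33}\mapsto-2M(\mathrm{Id}_J)$, $$aE_{12}+v_1\otimes b+\delta_3\otimes c+dE_{23}\mapsto e\otimes(a,b,c,d),\qquad aE_{32}+v_3\otimes b-\delta_1\otimes c-dE_{21}\mapsto f\otimes(a,b,c,d),$$ $$\delta_2\otimes\gamma+\phi+v_2\otimes X\mapsto n_L^\vee(\gamma)+M(\phi)+n_L(-X)\qquad(\phi\in\mathfrak m(J)^0).$$ $\mathrm{SL}_3$ acts on the $\mathbb Z/3$-model by conjugation on $\mathfrak{sl}_3$, trivially on $\mathfrak m(J)^0$, and through the standard and dual representations on $V_3$ and $V_3^\vee$. **The Cayley transform.** Put $C_2=\frac1{\sqrt2}\left(\begin{smallmatrix}i&-1\\1&-i\end{smallmatrix}\right)\in\mathrm{SL}_2(\mathbb C)$, $C_h=n_G(-i)\,n_G^\vee(-\tfrac i2)\,\eta(2^{-1/2})\in H_J^1(\mathbb C)$, $w_{23}=\left(\begin{smallmatrix}-1&0&0\\0&0&-1\\0&-1&0\end{smallmatrix}\right)\in\mathrm{SL}_3$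 and $\mathcal C=(C_2\boxtimes C_h)\circ w_{23}$, a linear automorphism of $\mathfrak g(J)\otimes\mathbb C$. For $Z\in J_{\mathbb C}$ and $X\in J$ let $r_0(Z)=(1,-Z,Z^\#,-N(Z))$, and $$V(X)=\tfrac12(\mathrm{tr}X,\,-i\,\mathrm{tr}X+2iX,\,\mathrm{tr}X-2X,\,-i\,\mathrm{tr}X),\qquad V(X)^*=\tfrac12(\mathrm{tr}X,\,i\,\mathrm{tr}X-2iX,\,\mathrm{tr}X-2X,\,i\,\mathrm{tr}X),$$ where in the two middle slots $\mathrm{tr}X$ means $\mathrm{tr}(X)1_J$. For $X,Z\in J$ define $e_\ell=\frac14(ie+f)\otimes r_0(i)$, $f_\ell=\frac14(ie-f)\otimes r_0(-i)$, $n_E(X)=\frac12(ie+f)\otimes V(X)^*$, $n_F(X)=\frac12(ie-f)\otimes V(X)$, $h_3=\frac12\left(\begin{smallmatrix}-1&i\\i&1\end{smallmatrix}\right)$, $h_1(X)=\frac12(ie+f)\otimes V(X)$, $h_{-1}(Z)=\frac i2(n_L(Z)+n_L^\vee(Z))+\frac12M(\Phi_{1_J,Z})$ and $h_{-3}=\frac14(ie-f)\otimes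 r_0(i)$. **Theorem.** $\mathcal C$ is an automorphism of the Lie algebra $\mathfrak g(J)\otimes\mathbb C$, one has $\mathcal C(\mathfrak g(J)_0\otimes\mathbb C)=\mathfrak k$ and $\mathcal C(\mathfrak g(J)_1\otimes\mathbb C)=\mathfrak p$, and for all $X,Y,Z\in J$: 1. $\mathcal C^{-1}(h_3)=-ie\otimes(1,0,0,0)$; 2. $\mathcal C^{-1}(h_1(X))=-ie\otimes(0,X,0,0)$; 3. $\mathcal C^{-1}(h_{-1}(Z))=-ie\otimes(0,0,Z,0)$; 4. $\mathcal C^{-1}(h_{-3})=-ie\otimes(0,0,0,1)$; 5. $\mathcal C^{-1}(n_E(X))=n_L^\vee(X)$; 6. $\mathcal C^{-1}(n_F(Y))=n_L(Y)$; 7. $\mathcal C^{-1}(e_\ell)=\left(\begin{smallmatrix}0&1\\0&0\end{smallmatrix}\right)$; 8. $\mathcal C^{-1}(f_\ell)=\left(\begin{smallmatrix}0&0\\1&0\end{smallmatrix}\right)$; 9. $\mathcal C^{-1}(\overline{h_3})=-if\otimes(0,0,0,1)$; 10. $\mathcal C^{-1}(\overline{h_1(X)})=if\otimes(0,0,X,0)$;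 11. $\mathcal C^{-1}(\overline{h_{-1}(Z)})=-if\otimes(0,Z,0,0)$; 12. $\mathcal C^{-1}(\overline{h_{-3}})=if\otimes(1,0,0,0)$. -/

import Mathlib

set_option linter.unusedSimpArgs false
set_option linter.unusedSectionVars false

open scoped TensorProduct

attribute [local instance] LieRing.ofAssociativeRing LieAlgebra.ofAssociativeAlgebra

noncomputable section

namespace CubicLie

/-- A cubic norm structure on a vector space `J` over a field `K` of characteristic zero: a cubic
polynomial map `norm`, a quadratic polynomial map `sharp`, a base point `one` and a nondegenerate
symmetric bilinear trace pairing `pairing`. The maps `cross` and `tri` are the linearizations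
`x × y = (x + y)^# - x^# - y^#` and the symmetric trilinear form with `(x, x, x) = 6 N(x)`; both are
determined by `sharp` and `norm`, and their (bi/tri)linearity says that `sharp` and `norm` are
polynomial maps of degrees two and three. -/
structure CubicNormStructure (K J : Type*) [Field K] [AddCommGroup J] [Module K J] where
  norm : J → K
  sharp : J → J
  one : J
  pairing : J →ₗ[K] J →ₗ[K] K
  cross : J →ₗ[K] J →ₗ[K] J
  tri : J →ₗ[K] J →ₗ[K] J →ₗ[K] K
  sharp_smul : ∀ (a : K) (x : J), sharp (a • x) = a ^ 2 • sharp x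
  cross_eq : ∀ x y, cross x y = sharp (x + y) - sharp x - sharp y
  tri_swap_left : ∀ x y z, tri x y z = tri y x z
  tri_swap_right : ∀ x y z, tri x y z = tri x z y
  tri_self : ∀ x, tri x x x = 6 * norm x
  pairing_symm : ∀ x y, pairing x y = pairing y x
  pairing_nondeg : ∀ x, (∀ y, pairing x y = 0) → x = 0
  norm_one : norm one = 1
  sharp_one : sharp one = one
  one_cross : ∀ x, cross one x = pairing one x • one - x
  sharp_sharp : ∀ x, sharp (sharp x) = norm x • x
  pairing_eq : ∀ x y,
    pairing x y = (1 / 4) * (tri one one x * tri one one y) - tri one x y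
  norm_add : ∀ x y,
    norm (x + y) = norm x + pairing (sharp x) y + pairing x (sharp y) + norm y

/-- The space `W_J = K ⊕ J ⊕ J^∨ ⊕ K`, with `J^∨` identified with `J` by the trace pairing. -/
abbrev Freud (K J : Type*) : Type _ := K × J × J × K

namespace CubicNormStructure

section General

variable {K J : Type*} [Field K] [AddCommGroup J] [Module K J]
variable (S : CubicNormStructure K J)

theorem cross_comm (x y : J) : S.cross x y = S.cross y x := by
  rw [S.cross_eq, S.cross_eq, add_comm]; abel

theorem ext_pairing {x y : J} (h : ∀ z, S.pairing x z = S.pairing y z) : x = y := by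
  rw [← sub_eq_zero]
  exact S.pairing_nondeg _ fun z => by simp [h]

variable [CharZero K]

theorem sharp_eq (x : J) : S.sharp x = (1 / 2 : K) • S.cross x x := by
  rw [S.cross_eq, ← two_smul K x, S.sharp_smul]
  module

theorem norm_eq (x : J) : S.norm x = (1 / 6) * S.tri x x x := by
  rw [S.tri_self]; ring

theorem sharp_pairing (x y : J) : S.pairing (S.sharp x) y = (1 / 2) * S.tri x x y := by
  have h1 := S.norm_add x y
  have h2 := S.norm_add x ((2 : K) • y)
  have h3 := S.norm_add x ((-1 : K) • y)
  simp only [norm_eq, S.sharp_smul, map_add, map_smul, LinearMap.add_apply, LinearMap.smul_apply,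
    smul_eq_mul] at h1 h2 h3
  have e1 := S.tri_swap_left x y x
  have e2 := S.tri_swap_right x x y
  have e3 := S.tri_swap_left x y y
  have e4 := S.tri_swap_right y x y
  have e5 := S.tri_swap_right x y x
  have e6 := S.tri_swap_left y x x
  have e7 := S.tri_swap_left y y x
  have e8 := S.tri_swap_right y y x
  have e9 := S.tri_swap_right y x x
  simp only [← e1, e2, ← e3] at *
  grind

theorem tri_eq (x y z : J) : S.tri x y z = S.pairing (S.cross x y) z := by
  have h1 := S.sharp_pairing (x + y) z
  have h2 := S.sharp_pairing x z
  have h3 := S.sharp_pairing y z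
  have e := S.tri_swap_left x y z
  rw [S.cross_eq]
  simp only [map_add, map_sub, LinearMap.add_apply, LinearMap.sub_apply] at *
  linear_combination h2 + h3 - h1 + (1 / 2) * e

theorem sharp_add (x y : J) : S.sharp (x + y) = S.sharp x + S.cross x y + S.sharp y := by
  rw [S.cross_eq]; abel

theorem cross_self (x : J) : S.cross x x = (2 : K) • S.sharp x := by
  rw [S.sharp_eq]; module

theorem tri_cycle (x y z : J) : S.tri x y z = S.tri y z x := by
  rw [S.tri_swap_left, S.tri_swap_right]

theorem pairing_cross (x y z : J) : S.pairing x (S.cross y z) = S.tri x y z := by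
  rw [S.pairing_symm, ← S.tri_eq, S.tri_cycle, S.tri_cycle]

/-- The full linearization of `(x^#)^# = N(x) x`. -/
theorem adjoint_identity (x y z w : J) :
    S.cross (S.cross x y) (S.cross z w) + S.cross (S.cross x z) (S.cross y w)
      + S.cross (S.cross x w) (S.cross y z)
    = S.tri x y z • w + S.tri x y w • z + S.tri x z w • y + S.tri y z w • x := by
  have key : ∀ x : J, S.cross (S.cross x x) (S.cross x x) = ((4 / 3 : K) * S.tri x x x) • x := by
    intro x
    have h := S.sharp_sharp x
    rw [S.sharp_eq (S.sharp x), S.sharp_eq x, S.norm_eq] at h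
    simp only [map_smul, LinearMap.smul_apply] at h
    linear_combination (norm := module) (8 : K) • h
  -- two rounds of linearization: first in one variable, with values in all bidegrees
  have key2 : ∀ x y : J, S.cross (S.cross x x) (S.cross x y)
      = ((1 / 3 : K) * S.tri x x x) • y + S.tri x x y • x := by
    intro x y
    have h1 := key (x + y)
    have h2 := key (x + (-1 : K) • y)
    have h3 := key (x + (2 : K) • y)
    have h4 := key (x + (-2 : K) • y)
    have e1 := S.cross_comm y x
    have e2 := S.tri_swap_right x y x
    have e3 : S.tri y x x = S.tri x x y := by rw [S.tri_cycle, S.tri_cycle, ← S.tri_cycle x x y, ← S.tri_cycle]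
    have e4 := S.tri_swap_right y y x
    have e5 := S.tri_swap_left y x y
    have e6 := S.tri_swap_right x y y
    have c1 := S.cross_comm (S.cross x y) (S.cross x x)
    have c2 := S.cross_comm (S.cross y y) (S.cross x x)
    have c3 := S.cross_comm (S.cross y y) (S.cross x y)
    simp only [map_add, map_smul, LinearMap.add_apply, LinearMap.smul_apply, e1, e2, e3, e4, e5,
      c1, c2, c3, smul_add, smul_smul, smul_eq_mul] at h1 h2 h3 h4
    linear_combination (norm := module) (1 / 6 : K) • h1 - (1 / 6 : K) • h2 - (1 / 48 : K) • h3
      + (1 / 48 : K) • h4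
  have key3 : ∀ x y z : J, (2 : K) • S.cross (S.cross x z) (S.cross x y)
      + S.cross (S.cross x x) (S.cross z y)
      = S.tri x x z • y + (2 * S.tri x z y) • x + S.tri x x y • z := by
    intro x y z
    have h1 := key2 (x + z) y
    have h2 := key2 (x + (-1 : K) • z) y
    have h3 := key2 (x + (2 : K) • z) y
    have h4 := key2 (x + (-2 : K) • z) y
    have e1 := S.cross_comm z x
    have e2 := S.tri_swap_left z x x
    have e3 := S.tri_swap_right x z x
    have e4 := S.tri_swap_left z x z
    have e5 := S.tri_swap_right z z x
    have e6 := S.tri_swap_left z x y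
    simp only [map_add, map_smul, LinearMap.add_apply, LinearMap.smul_apply, e1, e2, e3, e4, e5,
      e6, smul_add, smul_smul, smul_eq_mul] at h1 h2 h3 h4
    linear_combination (norm := module) (2 / 3 : K) • h1 - (2 / 3 : K) • h2 - (1 / 12 : K) • h3
      + (1 / 12 : K) • h4
  have h1 := key3 (x + w) y z
  have h2 := key3 x y z
  have h3 := key3 w y z
  have e1 := S.cross_comm w x
  have e2 := S.cross_comm z y
  have e3 := S.cross_comm (S.cross z w) (S.cross x y)
  have e4 := S.cross_comm w z
  have e5 := S.tri_swap_left w x y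
  have e6 := S.tri_swap_left w x z
  have e7 : S.tri w z y = S.tri y z w := by
    rw [S.tri_cycle, S.tri_swap_left, S.tri_cycle, S.tri_cycle, S.tri_swap_left, S.tri_cycle]
  have e8 := S.tri_swap_right x z y
  have e9 := S.tri_swap_right x w y
  have e10 := S.tri_swap_right x w z
  have e11 := S.cross_comm w y
  simp only [map_add, LinearMap.add_apply, e1, e2, e3, e4, e5, e6, e7, e8, e9, e10, e11] at h1 h2 h3 ⊢
  linear_combination (norm := module) (1 / 2 : K) • h1 - (1 / 2 : K) • h2 - (1 / 2 : K) • h3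

theorem sharp_cross_cross (x y : J) :
    S.cross (S.sharp x) (S.cross x y) = S.norm x • y + S.pairing (S.sharp x) y • x := by
  have h := S.adjoint_identity x x x y
  rw [S.sharp_eq, S.norm_eq]
  simp only [map_smul, LinearMap.smul_apply, S.cross_comm (S.cross x y), ← S.tri_eq,
    smul_eq_mul] at h ⊢
  linear_combination (norm := module) (1 / 6 : K) • h

theorem cross_sharp_cross (x y : J) :
    S.cross x (S.cross (S.sharp x) y) = S.norm x • y + S.pairing x y • S.sharp x := by
  apply S.ext_pairing
  intro z
  have h := congrArg (fun w => S.pairing w y) (S.sharp_cross_cross x z)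
  simp only [map_add, map_smul, LinearMap.add_apply, LinearMap.smul_apply, smul_eq_mul] at h ⊢
  rw [← S.tri_eq, S.tri_swap_right, S.tri_eq, S.pairing_cross, S.tri_swap_left, S.tri_eq, h,
    S.pairing_symm z y]
  ring

theorem norm_sharp (x : J) : S.norm (S.sharp x) = S.norm x ^ 2 := by
  have h := S.sharp_cross_cross x x
  have h2 : S.pairing (S.sharp (S.sharp x)) (S.sharp x) = 3 * S.norm x ^ 2 := by
    rw [S.sharp_sharp, map_smul, LinearMap.smul_apply, S.pairing_symm, S.sharp_pairing, S.tri_self,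
      smul_eq_mul]
    ring
  rw [S.sharp_pairing, S.tri_self] at h2
  linear_combination (1 / 3) * h2

theorem pairing_sharp_self (x : J) : S.pairing (S.sharp x) x = 3 * S.norm x := by
  rw [S.sharp_pairing, S.tri_self]; ring

/-! ### The Freudenthal space -/

/-- The symplectic form on `W_J`. -/
def omega (v w : Freud K J) : K :=
  v.1 * w.2.2.2 - S.pairing v.2.1 w.2.2.1 + S.pairing v.2.2.1 w.2.1 - v.2.2.2 * w.1

/-- The quartic form on `W_J`. -/
def quartic (v : Freud K J) : K :=
  (v.1 * v.2.2.2 - S.pairing v.2.1 v.2.2.1) ^ 2 + 4 * v.1 * S.norm v.2.2.1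
    + 4 * v.2.2.2 * S.norm v.2.1 - 4 * S.pairing (S.sharp v.2.1) (S.sharp v.2.2.1)

/-- An auxiliary trilinear map, whose symmetrization is the trilinear map `triple`. -/
def preTriple (x y z : Freud K J) : Freud K J :=
  ( -(x.1 * y.1 * z.2.2.2) + x.1 * S.pairing y.2.1 z.2.2.1
      - (1 / 3) * S.tri x.2.1 y.2.1 z.2.1,
    -S.cross x.2.2.1 (S.cross y.2.1 z.2.1) + x.1 • S.cross y.2.2.1 z.2.2.1
      - (x.1 * y.2.2.2) • z.2.1 + S.pairing x.2.1 y.2.2.1 • z.2.1,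
    S.cross x.2.1 (S.cross y.2.2.1 z.2.2.1) - x.2.2.2 • S.cross y.2.1 z.2.1
      + (x.1 * y.2.2.2) • z.2.2.1 - S.pairing x.2.1 y.2.2.1 • z.2.2.1,
    x.1 * y.2.2.2 * z.2.2.2 - x.2.2.2 * S.pairing y.2.1 z.2.2.1
      + (1 / 3) * S.tri x.2.2.1 y.2.2.1 z.2.2.1 )

/-- The symmetric trilinear map `t` on `W_J`. It is characterized by the fact that
`four w x y z = ⟨w, t(x, y, z)⟩` is the symmetric four-linear form with `four v v v v = 2 q(v)`,
see `four_self`, `four_swap` and `triple_add` below. -/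
def triple (x y z : Freud K J) : Freud K J :=
  (1 / 6 : K) • (S.preTriple x y z + S.preTriple x z y + S.preTriple y x z + S.preTriple y z x
    + S.preTriple z x y + S.preTriple z y x)

/-- The symmetric four-linear form on `W_J`. -/
def four (w x y z : Freud K J) : K := S.omega w (S.triple x y z)

theorem omega_add_left (v v' w : Freud K J) : S.omega (v + v') w = S.omega v w + S.omega v' w := by
  simp only [omega, Prod.fst_add, Prod.snd_add, map_add, LinearMap.add_apply]; ring

theorem omega_add_right (v w w' : Freud K J) : S.omega v (w + w') = S.omega v w + S.omega v w' := by
  simp only [omega, Prod.fst_add, Prod.snd_add, map_add]; ring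

theorem omega_smul_left (a : K) (v w : Freud K J) : S.omega (a • v) w = a * S.omega v w := by
  simp only [omega, Prod.smul_fst, Prod.smul_snd, map_smul, LinearMap.smul_apply, smul_eq_mul]; ring

theorem omega_smul_right (a : K) (v w : Freud K J) : S.omega v (a • w) = a * S.omega v w := by
  simp only [omega, Prod.smul_fst, Prod.smul_snd, map_smul, smul_eq_mul]; ring

theorem omega_swap (v w : Freud K J) : S.omega v w = -S.omega w v := by
  simp only [omega, S.pairing_symm v.2.1, S.pairing_symm v.2.2.1]; ring

theorem preTriple_add_left (x x' y z : Freud K J) :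
    S.preTriple (x + x') y z = S.preTriple x y z + S.preTriple x' y z := by
  ext <;> simp only [preTriple, Prod.fst_add, Prod.snd_add, map_add, LinearMap.add_apply] <;>
    first | ring1 | module

theorem preTriple_add_mid (x y y' z : Freud K J) :
    S.preTriple x (y + y') z = S.preTriple x y z + S.preTriple x y' z := by
  ext <;> simp only [preTriple, Prod.fst_add, Prod.snd_add, map_add, LinearMap.add_apply] <;>
    first | ring1 | module

theorem preTriple_add_right (x y z z' : Freud K J) :
    S.preTriple x y (z + z') = S.preTriple x y z + S.preTriple x y z' := by
  ext <;> simp only [preTriple, Prod.fst_add, Prod.snd_add, map_add, LinearMap.add_apply] <;>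
    first | ring1 | module

theorem preTriple_smul_left (a : K) (x y z : Freud K J) :
    S.preTriple (a • x) y z = a • S.preTriple x y z := by
  ext <;> simp only [preTriple, Prod.smul_fst, Prod.smul_snd, map_smul, LinearMap.smul_apply,
    smul_eq_mul] <;> first | ring1 | module

theorem preTriple_smul_mid (a : K) (x y z : Freud K J) :
    S.preTriple x (a • y) z = a • S.preTriple x y z := by
  ext <;> simp only [preTriple, Prod.smul_fst, Prod.smul_snd, map_smul, LinearMap.smul_apply,
    smul_eq_mul] <;> first | ring1 | module

theorem preTriple_smul_right (a : K) (x y z : Freud K J) :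
    S.preTriple x y (a • z) = a • S.preTriple x y z := by
  ext <;> simp only [preTriple, Prod.smul_fst, Prod.smul_snd, map_smul, LinearMap.smul_apply,
    smul_eq_mul] <;> first | ring1 | module

theorem triple_add (x y z z' : Freud K J) :
    S.triple x y (z + z') = S.triple x y z + S.triple x y z' := by
  simp only [triple, preTriple_add_left, preTriple_add_mid, preTriple_add_right]; module

theorem triple_smul (a : K) (x y z : Freud K J) :
    S.triple x y (a • z) = a • S.triple x y z := by
  simp only [triple, preTriple_smul_left, preTriple_smul_mid, preTriple_smul_right]; module

theorem triple_swap_left (x y z : Freud K J) : S.triple x y z = S.triple y x z := by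
  simp only [triple]; module

theorem triple_swap_right (x y z : Freud K J) : S.triple x y z = S.triple x z y := by
  simp only [triple]; module

theorem triple_self (v : Freud K J) : S.triple v v v = S.preTriple v v v := by
  simp only [triple]; module

theorem pairing_cross_cross (x y z w : J) :
    S.pairing x (S.cross y (S.cross z w)) = S.pairing (S.cross x y) (S.cross z w) := by
  rw [S.pairing_cross, S.tri_eq]

theorem four_self (v : Freud K J) : S.four v v v v = 2 * S.quartic v := by
  obtain ⟨a, b, c, d⟩ := v
  have h := S.pairing_symm (S.cross c c) (S.cross b b)
  simp only [four, triple_self, omega, preTriple, quartic, S.sharp_eq, S.norm_eq, map_add, map_sub,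
    map_neg, map_smul, LinearMap.smul_apply, smul_eq_mul, S.pairing_cross_cross,
    S.pairing_cross c c c, S.pairing_cross b b b, S.pairing_symm c b, h]
  ring

theorem four_swap (w x y z : Freud K J) : S.four w x y z = S.four x w y z := by
  obtain ⟨Q, hQ⟩ : ∃ Q : J → J → J → J → K,
    ∀ x y z w, S.pairing (S.cross x y) (S.cross z w) = Q x y z w := ⟨_, fun _ _ _ _ => rfl⟩
  have q1 : ∀ x y z w, Q x y z w = Q y x z w := fun x y z w => by
    rw [← hQ, S.cross_comm, hQ]
  have q2 : ∀ x y z w, Q x y z w = Q x y w z := fun x y z w => by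
    rw [← hQ, S.cross_comm z, hQ]
  have q3 : ∀ x y z w, Q x y z w = Q z w x y := fun x y z w => by
    rw [← hQ, S.pairing_symm, hQ]
  obtain ⟨a, b, c, d⟩ := w
  obtain ⟨a', b', c', d'⟩ := x
  obtain ⟨a₂, b₂, c₂, d₂⟩ := y
  obtain ⟨a₃, b₃, c₃, d₃⟩ := z
  simp only [four, triple, omega, preTriple, Prod.smul_fst, Prod.smul_snd, Prod.fst_add,
    Prod.snd_add, map_add, map_sub, map_neg, map_smul, smul_eq_mul, S.pairing_cross_cross, hQ]
  simp only [S.pairing_cross, S.tri_swap_left, S.tri_swap_right, q1, q2, q3, S.pairing_symm]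
  ring

theorem four_add (w x y z z' : Freud K J) :
    S.four w x y (z + z') = S.four w x y z + S.four w x y z' := by
  simp only [four, triple_add, omega_add_right]

theorem four_smul (a : K) (w x y z : Freud K J) :
    S.four w x y (a • z) = a * S.four w x y z := by
  simp only [four, triple_smul, omega_smul_right]

theorem four_swap_mid (w x y z : Freud K J) : S.four w x y z = S.four w y x z := by
  simp only [four, S.triple_swap_left x y]

theorem four_swap_right (w x y z : Freud K J) : S.four w x y z = S.four w x z y := by
  simp only [four, S.triple_swap_right x y]

theorem four_add₁ (w w' x y z : Freud K J) :
    S.four (w + w') x y z = S.four w x y z + S.four w' x y z := by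
  simp only [four, omega_add_left]

theorem four_add₂ (w x x' y z : Freud K J) :
    S.four w (x + x') y z = S.four w x y z + S.four w x' y z := by
  simp only [S.four_swap w, four_add₁]

theorem four_add₃ (w x y y' z : Freud K J) :
    S.four w x (y + y') z = S.four w x y z + S.four w x y' z := by
  simp only [S.four_swap_right w x _ z, four_add]

theorem four_smul₁ (a : K) (w x y z : Freud K J) :
    S.four (a • w) x y z = a * S.four w x y z := by
  simp only [four, omega_smul_left]

theorem four_smul₂ (a : K) (w x y z : Freud K J) :
    S.four w (a • x) y z = a * S.four w x y z := by
  simp only [S.four_swap w, four_smul₁]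

theorem four_smul₃ (a : K) (w x y z : Freud K J) :
    S.four w x (a • y) z = a * S.four w x y z := by
  simp only [S.four_swap_right w x _ z, four_smul]

theorem four_cube_swap (v w : Freud K J) :
    S.four v w v v = S.four w v v v ∧ S.four v v w v = S.four w v v v ∧
    S.four v v v w = S.four w v v v := by
  have h1 := S.four_swap v w v v
  have h2 := S.four_swap_mid v v w v
  have h3 := S.four_swap_right v v v w
  exact ⟨h1, h2.trans h1, h3.trans (h2.trans h1)⟩

theorem quartic_eq (v : Freud K J) : S.quartic v = (1 / 2) * S.four v v v v := by
  rw [S.four_self]; ring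

/-- The linear coefficient of `s ↦ q(v + s w)`. -/
theorem four_eq_quartic (v w : Freud K J) :
    S.four w v v v = (1 / 24) * (8 * S.quartic (v + w) - 8 * S.quartic (v + (-1 : K) • w)
      - S.quartic (v + (2 : K) • w) + S.quartic (v + (-2 : K) • w)) := by
  obtain ⟨h1, h2, h3⟩ := S.four_cube_swap v w
  obtain ⟨h4, h5, h6⟩ := S.four_cube_swap w v
  simp only [quartic_eq, four_add, four_add₁, four_add₂, four_add₃, four_smul, four_smul₁,
    four_smul₂, four_smul₃, h1, h2, h3, h4, h5, h6]
  ring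

/-- A vanishing fifth difference, the quartic form being of degree four. -/
theorem quartic_difference (v w : Freud K J) :
    S.quartic v = 5 * S.quartic (v + w) - 10 * S.quartic (v + (2 : K) • w)
      + 10 * S.quartic (v + (3 : K) • w) - 5 * S.quartic (v + (4 : K) • w)
      + S.quartic (v + (5 : K) • w) := by
  simp only [quartic_eq, four_add, four_add₁, four_add₂, four_add₃, four_smul, four_smul₁,
    four_smul₂, four_smul₃]
  ring

theorem four_deriv {φ : Module.End K (Freud K J)} (h : ∀ v, S.four (φ v) v v v = 0)
    (u v : Freud K J) : S.four (φ u) v v v + 3 * S.four (φ v) u v v = 0 := by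
  have h1 := h (v + u)
  have h2 := h (v + (-1 : K) • u)
  have h3 := h (v + (2 : K) • u)
  have h4 := h (v + (-2 : K) • u)
  have a1 := S.four_swap_mid (φ v) v u v
  have a2 := S.four_swap_right (φ v) v v u
  simp only [map_add, map_smul, four_add, four_add₁, four_add₂, four_add₃, four_smul, four_smul₁,
    four_smul₂, four_smul₃, a2, a1] at h1 h2 h3 h4
  have b1 := S.four_swap_mid (φ v) u v u
  have b2 := S.four_swap_right (φ v) v u u
  linear_combination (2 / 3) * h1 - (2 / 3) * h2 - (1 / 12) * h3 + (1 / 12) * h4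

/-- The Lie algebra `h(J)⁰`: the endomorphisms of `W_J` that infinitesimally preserve the symplectic
form and the quartic form (whose derivative at `v` in the direction `w` is `2 four w v v v`). -/
def hJ : LieSubalgebra K (Module.End K (Freud K J)) where
  carrier := {φ | (∀ v w, S.omega (φ v) w + S.omega v (φ w) = 0) ∧ ∀ v, S.four (φ v) v v v = 0}
  add_mem' := by
    rintro φ ψ ⟨h1, h2⟩ ⟨h3, h4⟩
    refine ⟨fun v w => ?_, fun v => ?_⟩
    · simp only [LinearMap.add_apply, omega_add_left, omega_add_right]
      linear_combination h1 v w + h3 v w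
    · simp only [LinearMap.add_apply, four_add₁, h2, h4, add_zero]
  zero_mem' := by
    refine ⟨fun v w => ?_, fun v => ?_⟩
    · simp [omega]
    · simp [four, omega]
  smul_mem' := by
    rintro a φ ⟨h1, h2⟩
    refine ⟨fun v w => ?_, fun v => ?_⟩
    · simp only [LinearMap.smul_apply, omega_smul_left, omega_smul_right]
      linear_combination a * h1 v w
    · simp only [LinearMap.smul_apply, four_smul₁, h2, mul_zero]
  lie_mem' := by
    rintro φ ψ ⟨h1, h2⟩ ⟨h3, h4⟩
    refine ⟨fun v w => ?_, fun v => ?_⟩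
    · simp only [LieRing.of_associative_ring_bracket, LinearMap.sub_apply, Module.End.mul_apply,
        sub_eq_add_neg (φ _), sub_eq_add_neg (φ (ψ _)), ← neg_one_smul K (ψ (φ _)),
        omega_add_left, omega_add_right, omega_smul_left, omega_smul_right]
      linear_combination h1 (ψ v) w - h3 (φ v) w - h1 v (ψ w) + h3 v (φ w) + 2 * h1 v (ψ w)
        - 2 * h3 v (φ w)
    · have e1 := S.four_deriv h2 (ψ v) v
      have e2 := S.four_deriv h4 (φ v) v
      have e3 := S.four_swap (φ v) (ψ v) v v
      simp only [LieRing.of_associative_ring_bracket, LinearMap.sub_apply, Module.End.mul_apply,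
        sub_eq_add_neg (φ _), ← neg_one_smul K (ψ (φ _)), four_add₁, four_smul₁]
      linear_combination e1 - e2 - 3 * e3

theorem mem_hJ {φ : Module.End K (Freud K J)} : φ ∈ S.hJ ↔
    (∀ v w, S.omega (φ v) w + S.omega v (φ w) = 0) ∧ ∀ v, S.four (φ v) v v v = 0 := Iff.rfl

/-- The group `H_J¹` of linear automorphisms of `W_J` that preserve the symplectic and the quartic
form. -/
def HJ1 : Subgroup (Freud K J ≃ₗ[K] Freud K J) where
  carrier := {g | (∀ v w, S.omega (g v) (g w) = S.omega v w) ∧ ∀ v, S.quartic (g v) = S.quartic v}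
  mul_mem' := by
    rintro g h ⟨h1, h2⟩ ⟨h3, h4⟩
    exact ⟨fun v w => (h1 _ _).trans (h3 _ _), fun v => (h2 _).trans (h4 _)⟩
  one_mem' := ⟨fun _ _ => rfl, fun _ => rfl⟩
  inv_mem' := by
    rintro g ⟨h1, h2⟩
    refine ⟨fun v w => ?_, fun v => ?_⟩
    · rw [← h1 (g⁻¹ v)]
      exact congrArg₂ S.omega (g.apply_symm_apply v) (g.apply_symm_apply w)
    · rw [← h2 (g⁻¹ v)]
      exact congrArg S.quartic (g.apply_symm_apply v)

theorem mem_HJ1 {g : Freud K J ≃ₗ[K] Freud K J} : g ∈ S.HJ1 ↔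
    (∀ v w, S.omega (g v) (g w) = S.omega v w) ∧ ∀ v, S.quartic (g v) = S.quartic v := Iff.rfl

theorem four_HJ1 {g : Freud K J ≃ₗ[K] Freud K J} (hg : g ∈ S.HJ1) (v w : Freud K J) :
    S.four (g w) (g v) (g v) (g v) = S.four w v v v := by
  simp only [four_eq_quartic, ← map_smul, ← map_add, hg.2]

theorem conj_mem_hJ {g : Freud K J ≃ₗ[K] Freud K J} (hg : g ∈ S.HJ1)
    {φ : Module.End K (Freud K J)} (hφ : φ ∈ S.hJ) : g.conj φ ∈ S.hJ := by
  refine ⟨fun v w => ?_, fun v => ?_⟩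
  · obtain ⟨v, rfl⟩ := g.surjective v
    obtain ⟨w, rfl⟩ := g.surjective w
    simp only [LinearEquiv.conj_apply_apply, LinearEquiv.symm_apply_apply, hg.1]
    exact hφ.1 v w
  · obtain ⟨v, rfl⟩ := g.surjective v
    simp only [LinearEquiv.conj_apply_apply, LinearEquiv.symm_apply_apply, S.four_HJ1 hg]
    exact hφ.2 v

instance : AddCommGroup S.hJ := inferInstance

instance : Module K S.hJ := inferInstance

instance : AddCommMonoid S.hJ := inferInstance

instance : SMul K S.hJ := inferInstance

/-! ### Elements of `H_J¹` -/

/-- The underlying linear map of `n_G(x)`. -/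
def nGLin (x : J) : Freud K J →ₗ[K] Freud K J where
  toFun v := (v.1, v.2.1 + v.1 • x, v.2.2.1 + S.cross v.2.1 x + v.1 • S.sharp x,
    v.2.2.2 + S.pairing v.2.2.1 x + S.pairing v.2.1 (S.sharp x) + v.1 * S.norm x)
  map_add' v w := by
    ext <;> simp only [Prod.fst_add, Prod.snd_add, map_add, LinearMap.add_apply] <;>
      first | ring1 | module
  map_smul' a v := by
    ext <;> simp only [Prod.smul_fst, Prod.smul_snd, map_smul, LinearMap.smul_apply, smul_eq_mul,
      RingHom.id_apply] <;> first | ring1 | module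

/-- The underlying linear map of `n_G^∨(y)`. -/
def nGDualLin (y : J) : Freud K J →ₗ[K] Freud K J where
  toFun v := (v.1 + S.pairing v.2.1 y + S.pairing v.2.2.1 (S.sharp y) + v.2.2.2 * S.norm y,
    v.2.1 + S.cross v.2.2.1 y + v.2.2.2 • S.sharp y, v.2.2.1 + v.2.2.2 • y, v.2.2.2)
  map_add' v w := by
    ext <;> simp only [Prod.fst_add, Prod.snd_add, map_add, LinearMap.add_apply] <;>
      first | ring1 | module
  map_smul' a v := by
    ext <;> simp only [Prod.smul_fst, Prod.smul_snd, map_smul, LinearMap.smul_apply, smul_eq_mul,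
      RingHom.id_apply] <;> first | ring1 | module

theorem nGLin_apply (x : J) (a : K) (b c : J) (d : K) : S.nGLin x (a, b, c, d) =
    (a, b + a • x, c + S.cross b x + a • S.sharp x,
      d + S.pairing c x + S.pairing b (S.sharp x) + a * S.norm x) := rfl

theorem nGDualLin_apply (y : J) (a : K) (b c : J) (d : K) : S.nGDualLin y (a, b, c, d) =
    (a + S.pairing b y + S.pairing c (S.sharp y) + d * S.norm y,
      b + S.cross c y + d • S.sharp y, c + d • y, d) := rfl

theorem nGLin_add (x y : J) (v : Freud K J) : S.nGLin x (S.nGLin y v) = S.nGLin (x + y) v := by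
  obtain ⟨a, b, c, d⟩ := v
  have h1 := S.cross_comm x y
  have h2 : S.pairing (S.cross b y) x = S.pairing b (S.cross x y) := by
    rw [S.pairing_cross, S.tri_swap_right, S.tri_eq]
  have h3 := S.pairing_symm y (S.sharp x)
  have h4 := S.pairing_symm x (S.sharp y)
  ext <;> simp only [nGLin_apply, map_add, map_smul, LinearMap.add_apply, LinearMap.smul_apply,
    smul_eq_mul, S.sharp_add, S.norm_add, h1, h2, h3, h4] <;> first | ring1 | module

theorem nGLin_zero (v : Freud K J) : S.nGLin 0 v = v := by
  obtain ⟨a, b, c, d⟩ := v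
  simp [nGLin_apply, S.sharp_eq, S.norm_eq]

/-- The unipotent element `n_G(x)`, as a linear automorphism of `W_J`. -/
def nGEquiv (x : J) : Freud K J ≃ₗ[K] Freud K J :=
  { S.nGLin x with
    invFun := S.nGLin (-x)
    left_inv := fun v => by
      have h := S.nGLin_add (-x) x v
      rw [neg_add_cancel, nGLin_zero] at h
      exact h
    right_inv := fun v => by
      have h := S.nGLin_add x (-x) v
      rw [add_neg_cancel, nGLin_zero] at h
      exact h }

theorem omega_nGLin (x : J) (v w : Freud K J) :
    S.omega (S.nGLin x v) (S.nGLin x w) = S.omega v w := by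
  obtain ⟨a, b, c, d⟩ := v
  obtain ⟨a', b', c', d'⟩ := w
  have h1 : ∀ b, S.pairing x (S.cross b x) = 2 * S.pairing b (S.sharp x) := fun b => by
    rw [S.pairing_symm b, S.sharp_pairing, S.pairing_cross, S.tri_swap_right]; ring
  have h2 : S.pairing x (S.sharp x) = 3 * S.norm x := by
    rw [S.pairing_symm, S.pairing_sharp_self]
  have h3 : S.pairing b (S.cross b' x) = S.pairing b' (S.cross b x) := by
    rw [S.pairing_cross, S.pairing_cross, S.tri_swap_left]
  simp only [omega, nGLin_apply, map_add, map_smul, LinearMap.add_apply,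
      LinearMap.smul_apply, smul_eq_mul, S.pairing_symm (S.cross b x), S.pairing_symm (S.sharp x),
      h1, h2, h3, S.pairing_symm c, S.pairing_symm c' x]
  ring

theorem quartic_nGLin (x : J) (v : Freud K J) : S.quartic (S.nGLin x v) = S.quartic v := by
  have key : ∀ (a : K) (y c : J) (d : K),
      S.quartic (S.nGLin y (a, 0, c, d)) = S.quartic (a, 0, c, d) := by
    intro a y c d
    have e1 : S.pairing (S.sharp (S.sharp y)) c = S.norm y * S.pairing c y := by
      rw [S.sharp_sharp, map_smul, LinearMap.smul_apply, S.pairing_symm, smul_eq_mul]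
    have e2 : S.pairing (S.sharp y) (S.cross c (S.sharp y)) = 2 * (S.norm y * S.pairing c y) := by
      rw [← e1, S.sharp_pairing (S.sharp y), S.pairing_cross, S.tri_swap_right]; ring
    have e3 : S.pairing (S.sharp y) y = 3 * S.norm y := S.pairing_sharp_self y
    have e4 : S.pairing y (S.sharp y) = 3 * S.norm y := by rw [S.pairing_symm, e3]
    have e5 := S.norm_sharp y
    have e6 := S.pairing_symm y c
    have e7 := S.pairing_symm (S.sharp c) (S.sharp y)
    have e8 : S.pairing c (S.sharp (S.sharp y)) = S.norm y * S.pairing c y := by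
      rw [S.pairing_symm, e1]
    have s0 : S.sharp (0 : J) = 0 := by rw [S.sharp_eq]; simp
    have n0 : S.norm (0 : J) = 0 := by rw [S.norm_eq]; simp
    have nsm : ∀ (a : K) (x : J), S.norm (a • x) = a ^ 3 * S.norm x := fun a x => by
      simp only [S.norm_eq, map_smul, LinearMap.smul_apply, smul_eq_mul]; ring
    simp only [nGLin_apply, quartic, map_zero, LinearMap.zero_apply, zero_add, add_zero, s0, n0,
      S.norm_add, S.sharp_add, S.sharp_smul, nsm, map_add, map_smul, LinearMap.add_apply,
      LinearMap.smul_apply, smul_eq_mul, e2, e3, e4, e5, e6, e7, e8, S.sharp_sharp]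
    ring
  have key2 : ∀ v : Freud K J, v.1 ≠ 0 → S.quartic (S.nGLin x v) = S.quartic v := by
    rintro ⟨a, b, c, d⟩ ha
    have hu : ∃ c' d', S.nGLin (-(a⁻¹ • b)) (a, b, c, d) = (a, 0, c', d') := by
      refine ⟨(S.nGLin (-(a⁻¹ • b)) (a, b, c, d)).2.2.1,
        (S.nGLin (-(a⁻¹ • b)) (a, b, c, d)).2.2.2, ?_⟩
      refine Prod.ext rfl (Prod.ext ?_ rfl)
      change b + a • (-(a⁻¹ • b)) = 0
      rw [smul_neg, smul_smul, mul_inv_cancel₀ ha, one_smul, add_neg_cancel]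
    obtain ⟨c', d', hu⟩ := hu
    have hv : (a, b, c, d) = S.nGLin (a⁻¹ • b) (a, 0, c', d') := by
      rw [← hu, nGLin_add, add_neg_cancel, nGLin_zero]
    rw [hv, nGLin_add, key, key]
  by_cases h : v.1 = 0
  · have h1 : ∀ s : K, s ≠ 0 →
        S.quartic (S.nGLin x v + s • S.nGLin x (1, 0, 0, 0)) = S.quartic (v + s • (1, 0, 0, 0)) := by
      intro s hs
      rw [← map_smul, ← map_add]
      apply key2
      simpa [h] using hs
    rw [S.quartic_difference (S.nGLin x v) (S.nGLin x (1, 0, 0, 0)),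
      S.quartic_difference v (1, 0, 0, 0), h1 2 (by norm_num), h1 3 (by norm_num),
      h1 4 (by norm_num), h1 5 (by norm_num)]
    have := h1 1 one_ne_zero
    rw [one_smul, one_smul] at this
    rw [this]
  · exact key2 v h

/-- The element `n_G(x)` of `H_J¹`. -/
def nG (x : J) : S.HJ1 := ⟨S.nGEquiv x, S.omega_nGLin x, S.quartic_nGLin x⟩

/-- The element `J₂` of `H_J¹`, acting on `W_J` by `(a, b, c, d) ↦ (d, -c, b, -a)`. -/
def J2W : S.HJ1 :=
  ⟨{ toFun := fun v => (v.2.2.2, -v.2.2.1, v.2.1, -v.1)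
     map_add' := fun v w => by
       ext <;> simp only [Prod.fst_add, Prod.snd_add] <;> first | ring1 | module
     map_smul' := fun a v => by
       ext <;> simp
     invFun := fun v => (-v.2.2.2, v.2.2.1, -v.2.1, v.1)
     left_inv := fun v => by simp
     right_inv := fun v => by simp },
   fun v w => by
     have h1 := S.pairing_symm v.2.1 w.2.2.1
     have h2 := S.pairing_symm v.2.2.1 w.2.1
     simp only [omega, LinearEquiv.coe_mk, LinearMap.coe_mk, AddHom.coe_mk, map_neg,
       LinearMap.neg_apply, S.pairing_symm w.2.2.1, S.pairing_symm w.2.1]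
     ring,
   fun v => by
     have h1 := S.pairing_symm v.2.1 v.2.2.1
     have h2 := S.pairing_symm (S.sharp v.2.1) (S.sharp v.2.2.1)
     have h3 : S.sharp (-v.2.2.1) = S.sharp v.2.2.1 := by simp [S.sharp_eq]
     have h4 : S.norm (-v.2.2.1) = -S.norm v.2.2.1 := by simp [S.norm_eq]
     simp only [quartic, LinearEquiv.coe_mk, LinearMap.coe_mk, AddHom.coe_mk, map_neg,
       LinearMap.neg_apply, h1, h2, h3, h4]
     ring⟩

theorem J2W_apply (a : K) (b c : J) (d : K) :
    (S.J2W : Freud K J ≃ₗ[K] Freud K J) (a, b, c, d) = (d, -c, b, -a) := rfl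

theorem nGDualLin_eq (y : J) (v : Freud K J) :
    (S.J2W * S.nG (-y) * S.J2W⁻¹ : S.HJ1).1 v = S.nGDualLin y v := by
  obtain ⟨v, rfl⟩ := S.J2W.1.surjective v
  obtain ⟨a, b, c, d⟩ := v
  have h3 : S.sharp (-y) = S.sharp y := by simp [S.sharp_eq]
  have h4 : S.norm (-y) = -S.norm y := by simp [S.norm_eq]
  change S.J2W.1 (S.nGLin (-y) (S.J2W.1.symm (S.J2W.1 (a, b, c, d)))) = _
  rw [LinearEquiv.symm_apply_apply]
  simp only [J2W_apply, nGLin_apply, nGDualLin_apply, h3, h4, map_neg, LinearMap.neg_apply]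
  ext <;> first | ring1 | module

/-- The element `n_G^∨(y)` of `H_J¹`. -/
def nGDual (y : J) : S.HJ1 :=
  ⟨LinearEquiv.ofBijective (S.nGDualLin y) (by
      have h : (S.nGDualLin y : Freud K J → Freud K J) = (S.J2W * S.nG (-y) * S.J2W⁻¹ : S.HJ1).1 :=
        funext fun v => (S.nGDualLin_eq y v).symm
      rw [h]
      exact LinearEquiv.bijective _),
    fun v w => by
      simp only [LinearEquiv.ofBijective_apply, ← nGDualLin_eq]
      exact (S.J2W * S.nG (-y) * S.J2W⁻¹ : S.HJ1).2.1 v w,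
    fun v => by
      simp only [LinearEquiv.ofBijective_apply, ← nGDualLin_eq]
      exact (S.J2W * S.nG (-y) * S.J2W⁻¹ : S.HJ1).2.2 v⟩

/-- The element `η(z)` of `H_J¹`, acting by `(a, b, c, d) ↦ (z³ a, z b, z⁻¹ c, z⁻³ d)`. -/
def eta (z : Kˣ) : S.HJ1 :=
  ⟨{ toFun := fun v => ((z : K) ^ 3 * v.1, (z : K) • v.2.1, (z : K)⁻¹ • v.2.2.1,
        (z : K)⁻¹ ^ 3 * v.2.2.2)
     map_add' := fun v w => by
       ext <;> simp only [Prod.fst_add, Prod.snd_add] <;> first | ring1 | module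
     map_smul' := fun a v => by
       ext <;> simp only [Prod.smul_fst, Prod.smul_snd, smul_eq_mul, RingHom.id_apply] <;>
         first | ring1 | module
     invFun := fun v => ((z : K)⁻¹ ^ 3 * v.1, (z : K)⁻¹ • v.2.1, (z : K) • v.2.2.1,
        (z : K) ^ 3 * v.2.2.2)
     left_inv := fun v => by
       have hz : (z : K) ≠ 0 := z.ne_zero
       ext <;> simp [smul_smul, hz]
     right_inv := fun v => by
       have hz : (z : K) ≠ 0 := z.ne_zero
       ext <;> simp [smul_smul, hz] },
   fun v w => by
     have hz : (z : K) ≠ 0 := z.ne_zero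
     simp only [omega, LinearEquiv.coe_mk, LinearMap.coe_mk, AddHom.coe_mk, map_smul,
       LinearMap.smul_apply, smul_eq_mul]
     field_simp,
   fun v => by
     have hz : (z : K) ≠ 0 := z.ne_zero
     simp only [quartic, LinearEquiv.coe_mk, LinearMap.coe_mk, AddHom.coe_mk, map_smul,
       LinearMap.smul_apply, smul_eq_mul, S.sharp_smul, S.norm_eq]
     field_simp⟩

/-! ### The Lie algebra `m(J)` -/

/-- The Lie algebra `m(J)`: the pairs `(φ, μ)` of an endomorphism of `J` and a scalar such that `φ`
infinitesimally preserves the cubic form up to the multiplier `μ = t(φ)`. -/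
def mJ : Submodule K (Module.End K J × K) where
  carrier := {φ | ∀ x y z,
    S.tri (φ.1 x) y z + S.tri x (φ.1 y) z + S.tri x y (φ.1 z) = φ.2 * S.tri x y z}
  add_mem' := by
    intro φ ψ h1 h2 x y z
    simp only [Prod.fst_add, Prod.snd_add, LinearMap.add_apply, map_add]
    linear_combination h1 x y z + h2 x y z
  zero_mem' := by intro x y z; simp
  smul_mem' := by
    intro a φ h x y z
    simp only [Prod.smul_fst, Prod.smul_snd, LinearMap.smul_apply, map_smul, smul_eq_mul]
    linear_combination a * h x y z

/-- The subalgebra `m(J)⁰` of `m(J)` of elements with multiplier zero. -/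
def mJ0 : Submodule K (Module.End K J) := S.mJ.comap (LinearMap.inl K (Module.End K J) K)

theorem mem_mJ0 {φ : Module.End K J} : φ ∈ S.mJ0 ↔ (φ, (0 : K)) ∈ S.mJ := Iff.rfl

/-- Polarization of a cubic expression that is symmetric in its last two arguments. -/
theorem polarize_aux {F : J → J → J → K}
    (h1 : ∀ x x' y z, F (x + x') y z = F x y z + F x' y z)
    (h2 : ∀ x y y' z, F x (y + y') z = F x y z + F x y' z)
    (h3 : ∀ x y z, F x y z = F x z y) (h : ∀ x, F x x x = 0) (x y z : J) :
    F x y z + F y x z + F z x y = 0 := by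
  have h4 : ∀ x y z z', F x y (z + z') = F x y z + F x y z' := fun x y z z' => by
    rw [h3, h2, h3 x z, h3 x z']
  have key : ∀ u v, 2 * F u u v + F v u u = 0 := fun u v => by
    have e1 := h (u + v)
    have e2 := h (u + -v)
    have e0 : ∀ a b, F 0 a b = 0 := fun a b => by simpa using h1 0 0 a b
    have f0 : ∀ a b, F a 0 b = 0 := fun a b => by simpa using h2 a 0 0 b
    have g1 : ∀ c a b, F (-c) a b = -F c a b := fun c a b => by
      have := h1 c (-c) a b
      rw [add_neg_cancel, e0] at this
      linear_combination -this
    have g2 : ∀ c a b, F a (-c) b = -F a c b := fun c a b => by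
      have := h2 a c (-c) b
      rw [add_neg_cancel, f0] at this
      linear_combination -this
    have g3 : ∀ c a b, F a b (-c) = -F a b c := fun c a b => by rw [h3, g2, h3]
    simp only [h1, h2, h4, g1, g2, g3, h, h3 u v u, h3 v v u] at e1 e2
    linear_combination (1 / 2) * (e1 - e2)
  have k := key (x + y) z
  simp only [h1, h2, h4, h3 x y x, h3 y y x] at k
  have h5 := h3 x y z
  have h6 := h3 z y x
  linear_combination (1 / 2) * k - (1 / 2) * key x z - (1 / 2) * key y z - (1 / 2) * h6

theorem mem_mJ_iff {φ : Module.End K J} {t : K} :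
    (φ, t) ∈ S.mJ ↔ ∀ x, S.pairing (φ x) (S.sharp x) = t * S.norm x := by
  constructor
  · intro h x
    have h1 := h x x x
    simp only at h1
    rw [S.tri_swap_right x x (φ x), S.tri_swap_left x (φ x) x, S.tri_self] at h1
    rw [S.pairing_symm, S.sharp_pairing, S.tri_cycle, S.tri_cycle]
    linear_combination (1 / 6) * h1
  · intro h x y z
    have k := polarize_aux (F := fun x y z => S.tri (φ x) y z - t / 3 * S.tri x y z)
      (fun x x' y z => by simp only [map_add, LinearMap.add_apply]; ring)
      (fun x y y' z => by simp only [map_add, LinearMap.add_apply]; ring)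
      (fun x y z => by rw [S.tri_swap_right, S.tri_swap_right x])
      (fun x => by
        have h1 := h x
        rw [S.pairing_symm, S.sharp_pairing, S.tri_cycle, S.tri_cycle, S.norm_eq] at h1
        linear_combination 2 * h1) x y z
    have a4 := S.tri_swap_left x (φ y) z
    have a5 : S.tri x y (φ z) = S.tri (φ z) x y := (S.tri_cycle _ _ _).symm
    have b2 := S.tri_swap_left y x z
    have b4 : S.tri z x y = S.tri x y z := S.tri_cycle _ _ _
    simp only [b2, b4] at k
    rw [a4, a5]
    linear_combination k

theorem pairing_nondegenerate : LinearMap.BilinForm.Nondegenerate (S.pairing) :=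
  ⟨fun x h => S.pairing_nondeg x h, fun x h => S.pairing_nondeg x fun y => by
    rw [S.pairing_symm]; exact h y⟩

/-- The endomorphism `Φ_{γ,x}` of `J`. -/
def phiJ (γ x : J) : Module.End K J where
  toFun z := -S.cross γ (S.cross x z) + S.pairing γ z • x + S.pairing γ x • z
  map_add' z w := by simp only [map_add]; module
  map_smul' a z := by simp only [map_smul, smul_eq_mul, RingHom.id_apply]; module

theorem phiJ_apply (γ x z : J) : S.phiJ γ x z =
    -S.cross γ (S.cross x z) + S.pairing γ z • x + S.pairing γ x • z := rfl

theorem phiJ_mem (γ x : J) : (S.phiJ γ x, 2 * S.pairing γ x) ∈ S.mJ := by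
  rw [mem_mJ_iff]
  intro z
  have h := S.sharp_cross_cross z x
  have h2 : S.pairing (S.cross γ (S.cross x z)) (S.sharp z)
      = S.norm z * S.pairing γ x + S.pairing (S.sharp z) x * S.pairing γ z := by
    rw [← S.tri_eq, S.tri_cycle, S.tri_swap_left, S.tri_eq, S.cross_comm x z, h]
    simp only [map_add, map_smul, LinearMap.add_apply, LinearMap.smul_apply, smul_eq_mul,
      S.pairing_symm x γ, S.pairing_symm z γ]
  have h3 : S.pairing z (S.sharp z) = 3 * S.norm z := by
    rw [S.pairing_symm, S.pairing_sharp_self]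
  simp only [phiJ_apply, map_add, map_neg, map_smul, LinearMap.add_apply, LinearMap.neg_apply,
    LinearMap.smul_apply, smul_eq_mul, h2, h3, S.pairing_symm x (S.sharp z)]
  ring

theorem id_mem_mJ : ((1 : Module.End K J), (3 : K)) ∈ S.mJ := by
  intro x y z
  simp only [Module.End.one_apply]
  ring

section Dual

variable [FiniteDimensional K J]

/-- The action of an endomorphism of `J` on the dual `J^∨ = J`: it is characterized by
`(φ x, y) + (x, φ~ y) = 0`. -/
def dual (φ : Module.End K J) : Module.End K J :=
  -LinearMap.BilinForm.leftAdjointOfNondegenerate S.pairing S.pairing_nondegenerate φ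

theorem pairing_dual (φ : Module.End K J) (x y : J) :
    S.pairing (S.dual φ x) y = -S.pairing x (φ y) := by
  rw [dual, LinearMap.neg_apply, map_neg, LinearMap.neg_apply]
  exact congrArg Neg.neg
    (LinearMap.BilinForm.isAdjointPairLeftAdjointOfNondegenerate S.pairing _ φ x y)

theorem pairing_dual_right (φ : Module.End K J) (x y : J) :
    S.pairing x (S.dual φ y) = -S.pairing (φ x) y := by
  rw [S.pairing_symm, pairing_dual, S.pairing_symm]

theorem dual_dual (φ : Module.End K J) : S.dual (S.dual φ) = φ := by
  ext x
  apply S.ext_pairing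
  intro z
  rw [pairing_dual, pairing_dual_right, neg_neg]

theorem dual_add (φ ψ : Module.End K J) : S.dual (φ + ψ) = S.dual φ + S.dual ψ := by
  ext x
  apply S.ext_pairing
  intro z
  simp only [pairing_dual, LinearMap.add_apply, map_add]
  ring

theorem dual_smul (a : K) (φ : Module.End K J) : S.dual (a • φ) = a • S.dual φ := by
  ext x
  apply S.ext_pairing
  intro z
  simp only [pairing_dual, LinearMap.smul_apply, map_smul, smul_eq_mul]
  ring

theorem dual_one : S.dual (1 : Module.End K J) = -1 := by
  ext x
  apply S.ext_pairing
  intro z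
  simp [pairing_dual]

theorem mJ_cross {φ : Module.End K J} {t : K} (h : (φ, t) ∈ S.mJ) (x : J) :
    S.cross (φ x) x = t • S.sharp x + S.dual φ (S.sharp x) := by
  apply S.ext_pairing
  intro z
  have h1 := h x x z
  simp only at h1
  simp only [map_add, map_smul, LinearMap.add_apply, LinearMap.smul_apply, smul_eq_mul,
    pairing_dual, S.sharp_pairing, ← S.tri_eq]
  rw [S.tri_swap_left x (φ x)] at h1
  linear_combination (1 / 2) * h1

theorem dual_mem {φ : Module.End K J} {t : K} (h : (φ, t) ∈ S.mJ) : (S.dual φ, -t) ∈ S.mJ := by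
  rw [mem_mJ_iff]
  -- `D` vanishes wherever the norm does not
  have key : ∀ y, S.norm y * (S.pairing y (φ (S.sharp y)) - t * S.norm y) = 0 := by
    intro y
    have h1 := congrArg (fun w => S.pairing w (S.sharp y)) (S.mJ_cross h (S.sharp y))
    simp only [map_add, map_smul, LinearMap.add_apply, LinearMap.smul_apply, smul_eq_mul,
      pairing_dual, S.sharp_sharp, S.pairing_sharp_self] at h1
    rw [← S.tri_eq, S.tri_cycle, S.tri_eq, S.cross_self, S.sharp_sharp] at h1
    simp only [map_smul, LinearMap.smul_apply, smul_eq_mul, S.pairing_symm y (S.sharp y),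
      S.pairing_sharp_self] at h1
    linear_combination (1 / 3) * h1
  intro y
  rw [pairing_dual]
  suffices hD : S.pairing y (φ (S.sharp y)) - t * S.norm y = 0 by linear_combination -hD
  let P : Polynomial K := Polynomial.X ^ 3 + Polynomial.C (S.pairing y S.one) * Polynomial.X ^ 2
    + Polynomial.C (S.pairing (S.sharp y) S.one) * Polynomial.X + Polynomial.C (S.norm y)
  let Q : Polynomial K := Polynomial.C (S.pairing S.one (φ S.one) - t) * Polynomial.X ^ 3
    + Polynomial.C (S.pairing y (φ S.one) + S.pairing S.one (φ (S.cross y S.one))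
      - t * S.pairing y S.one) * Polynomial.X ^ 2
    + Polynomial.C (S.pairing y (φ (S.cross y S.one)) + S.pairing S.one (φ (S.sharp y))
      - t * S.pairing (S.sharp y) S.one) * Polynomial.X
    + Polynomial.C (S.pairing y (φ (S.sharp y)) - t * S.norm y)
  have hPQ : P * Q = 0 := by
    refine Polynomial.funext fun s => ?_
    have h1 := key (y + s • S.one)
    have h2 : S.norm (s • S.one) = s ^ 3 := by
      have h3 := S.norm_one
      rw [S.norm_eq] at h3 ⊢
      simp only [map_smul, LinearMap.smul_apply, smul_eq_mul]
      linear_combination s ^ 3 * h3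
    simp only [S.norm_add, S.sharp_add, S.sharp_smul, S.sharp_one, h2, map_add, map_smul,
      LinearMap.add_apply, LinearMap.smul_apply, smul_eq_mul] at h1
    simp only [P, Q, Polynomial.eval_mul, Polynomial.eval_add, Polynomial.eval_pow,
      Polynomial.eval_C, Polynomial.eval_X, Polynomial.eval_zero]
    linear_combination h1
  have hP : P ≠ 0 := by
    intro h0
    have h1 : P.coeff 3 = 1 := by
      simp [P, Polynomial.coeff_X, Polynomial.coeff_C]
    rw [h0, Polynomial.coeff_zero] at h1
    exact zero_ne_one h1
  have hQ := (mul_eq_zero.mp hPQ).resolve_left hP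
  have h0 := congrArg (Polynomial.eval 0) hQ
  simpa [Q] using h0

end Dual

/-! ### Elements of `h(J)⁰` -/

theorem four_cube (w v : Freud K J) : S.four w v v v = S.omega w (S.preTriple v v v) := by
  rw [four, triple_self]

/-- The endomorphism `n_L(x)` of `W_J`. -/
def nLLin (x : J) : Module.End K (Freud K J) where
  toFun v := (0, v.1 • x, S.cross v.2.1 x, S.pairing v.2.2.1 x)
  map_add' v w := by
    ext <;> simp only [Prod.fst_add, Prod.snd_add, map_add, LinearMap.add_apply] <;>
      first | ring1 | module
  map_smul' a v := by
    ext <;> simp only [Prod.smul_fst, Prod.smul_snd, map_smul, LinearMap.smul_apply, smul_eq_mul,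
      RingHom.id_apply] <;> first | ring1 | module

theorem nLLin_apply (x : J) (a : K) (b c : J) (d : K) :
    S.nLLin x (a, b, c, d) = (0, a • x, S.cross b x, S.pairing c x) := rfl

/-- The endomorphism `n_L^∨(γ)` of `W_J`. -/
def nLDualLin (γ : J) : Module.End K (Freud K J) where
  toFun v := (S.pairing v.2.1 γ, S.cross γ v.2.2.1, v.2.2.2 • γ, 0)
  map_add' v w := by
    ext <;> simp only [Prod.fst_add, Prod.snd_add, map_add, LinearMap.add_apply] <;>
      first | ring1 | module
  map_smul' a v := by
    ext <;> simp only [Prod.smul_fst, Prod.smul_snd, map_smul, LinearMap.smul_apply, smul_eq_mul,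
      RingHom.id_apply] <;> first | ring1 | module

theorem nLDualLin_apply (γ : J) (a : K) (b c : J) (d : K) :
    S.nLDualLin γ (a, b, c, d) = (S.pairing b γ, S.cross γ c, d • γ, 0) := rfl

theorem nLLin_mem (x : J) : S.nLLin x ∈ S.hJ := by
  refine ⟨?_, ?_⟩
  · rintro ⟨a, b, c, d⟩ ⟨a', b', c', d'⟩
    have h3 : S.pairing b (S.cross b' x) = S.pairing b' (S.cross b x) := by
      rw [S.pairing_cross, S.pairing_cross, S.tri_swap_left]
    have h2 := S.pairing_symm (S.cross b x) b'
    have h4 := S.pairing_symm x c'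
    have h5 := S.pairing_symm x c
    simp only [omega, nLLin_apply, map_smul, LinearMap.smul_apply, smul_eq_mul,
      h2, h3, h4, h5]
    ring
  · rintro ⟨a, b, c, d⟩
    have h1 : S.pairing (S.cross b x) (S.cross c (S.cross b b))
        = (1 / 3) * S.tri b b b * S.pairing c x + S.tri b b x * S.pairing c b := by
      have h := S.sharp_cross_cross b x
      rw [S.pairing_cross, S.tri_swap_left, ← S.pairing_cross, S.cross_comm (S.cross b x),
        S.cross_self, map_smul, LinearMap.smul_apply, h, S.norm_eq, S.sharp_pairing]
      simp only [map_add, map_smul, smul_eq_mul]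
      ring
    have h2 : S.pairing (S.cross b x) b = S.tri b b x := by rw [← S.tri_eq, S.tri_swap_right]
    have h3 : S.pairing x (S.cross b b) = S.tri b b x := by
      rw [S.pairing_cross, S.tri_cycle]
    have h4 : S.pairing (S.cross b x) (S.cross c c) = S.pairing x (S.cross b (S.cross c c)) := by
      rw [S.pairing_cross_cross, S.cross_comm]
    simp only [four_cube, omega, preTriple, nLLin_apply, map_add, map_sub, map_neg, map_smul,
      LinearMap.smul_apply, smul_eq_mul, h1, h2, h3, h4, S.pairing_symm x c, S.pairing_symm c b]
    ring

theorem nLDualLin_eq (γ : J) : S.nLDualLin γ = S.J2W.1.conj (S.nLLin (-γ)) := by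
  refine LinearMap.ext fun v => ?_
  obtain ⟨v, rfl⟩ := S.J2W.1.surjective v
  obtain ⟨a, b, c, d⟩ := v
  rw [LinearEquiv.conj_apply_apply, LinearEquiv.symm_apply_apply]
  simp only [J2W_apply, nLLin_apply, nLDualLin_apply, map_neg, neg_neg, smul_neg, neg_smul,
    S.cross_comm γ, neg_zero]
  simp [S.pairing_symm]

theorem nLDualLin_mem (γ : J) : S.nLDualLin γ ∈ S.hJ := by
  rw [nLDualLin_eq]
  exact S.conj_mem_hJ S.J2W.2 (S.nLLin_mem _)

/-- The element `n_L(x)` of `h(J)⁰`. -/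
def nL (x : J) : S.hJ := ⟨S.nLLin x, S.nLLin_mem x⟩

/-- The element `n_L^∨(γ)` of `h(J)⁰`. -/
def nLDual (γ : J) : S.hJ := ⟨S.nLDualLin γ, S.nLDualLin_mem γ⟩

section FiniteDim

variable [FiniteDimensional K J]

/-- The action on `W_J` of an endomorphism `φ` of `J` together with a multiplier `t`. -/
def MLin (φ : Module.End K J) (t : K) : Module.End K (Freud K J) where
  toFun v := (-(t / 2) * v.1, -(t / 2) • v.2.1 + φ v.2.1, (t / 2) • v.2.2.1 + S.dual φ v.2.2.1,
    t / 2 * v.2.2.2)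
  map_add' v w := by
    ext <;> simp only [Prod.fst_add, Prod.snd_add, map_add] <;>
      first | ring1 | module
  map_smul' a v := by
    ext <;> simp only [Prod.smul_fst, Prod.smul_snd, map_smul, smul_eq_mul,
      RingHom.id_apply] <;> first | ring1 | module

theorem MLin_apply (φ : Module.End K J) (t : K) (a : K) (b c : J) (d : K) :
    S.MLin φ t (a, b, c, d) = (-(t / 2) * a, -(t / 2) • b + φ b, (t / 2) • c + S.dual φ c,
      t / 2 * d) := rfl

theorem MLin_mem {φ : Module.End K J} {t : K} (h : (φ, t) ∈ S.mJ) : S.MLin φ t ∈ S.hJ := by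
  refine ⟨?_, ?_⟩
  · rintro ⟨a, b, c, d⟩ ⟨a', b', c', d'⟩
    simp only [omega, MLin_apply, map_add, map_smul, LinearMap.add_apply, LinearMap.smul_apply,
      smul_eq_mul, pairing_dual, pairing_dual_right]
    ring
  · rintro ⟨a, b, c, d⟩
    have h1 := S.mem_mJ_iff.1 h b
    have h2 := S.mem_mJ_iff.1 (S.dual_mem h) c
    have h3 := congrArg (fun w => S.pairing w (S.sharp c)) (S.mJ_cross h b)
    have h4 := congrArg (fun w => S.pairing w (S.sharp b)) (S.mJ_cross (S.dual_mem h) c)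
    have h5 : S.pairing (φ b) (S.cross b (S.sharp c)) = S.pairing (S.cross (φ b) b) (S.sharp c) := by
      rw [S.pairing_cross, S.tri_eq]
    have h6 : S.pairing (S.dual φ c) (S.cross c (S.sharp b))
        = S.pairing (S.cross (S.dual φ c) c) (S.sharp b) := by
      rw [S.pairing_cross, S.tri_eq]
    have h7 : S.pairing b (S.cross b (S.sharp c)) = 2 * S.pairing (S.sharp b) (S.sharp c) := by
      rw [S.pairing_cross, S.tri_eq, S.cross_self, map_smul, LinearMap.smul_apply, smul_eq_mul]
    have h8 : S.pairing c (S.cross c (S.sharp b)) = 2 * S.pairing (S.sharp b) (S.sharp c) := by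
      rw [S.pairing_cross, S.tri_eq, S.cross_self, map_smul, LinearMap.smul_apply, smul_eq_mul,
        S.pairing_symm]
    have h9 : S.pairing b (S.sharp b) = 3 * S.norm b := by
      rw [S.pairing_symm, S.pairing_sharp_self]
    have h10 : S.pairing c (S.sharp c) = 3 * S.norm c := by
      rw [S.pairing_symm, S.pairing_sharp_self]
    simp only [map_add, map_smul, LinearMap.add_apply, LinearMap.smul_apply, smul_eq_mul,
      pairing_dual, dual_dual] at h3 h4
    rw [S.pairing_symm (φ (S.sharp c))] at h4
    have h11 : S.pairing (S.sharp c) (S.sharp b) = S.pairing (S.sharp b) (S.sharp c) :=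
      S.pairing_symm _ _
    have h12 := S.pairing_symm c b
    have h13 : S.pairing c (φ b) = S.pairing (φ b) c := S.pairing_symm _ _
    simp only [four_cube, omega, preTriple, MLin_apply, map_add, map_sub, map_neg, map_smul,
      LinearMap.add_apply, LinearMap.smul_apply, smul_eq_mul, S.cross_self, S.tri_self, h5, h6, h7,
      h8, h9, h10, h11, h12, h1, h2, h3, h4, pairing_dual, h13]
    ring

/-- The element `M(φ)` of `h(J)⁰` attached to an element `φ` of `m(J)`. -/
def M (φ : S.mJ) : S.hJ := ⟨S.MLin φ.1.1 φ.1.2, S.MLin_mem φ.2⟩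

end FiniteDim

/-- The endomorphism `Φ_{w,w'}` of `W_J`. -/
def PhiLin (w w' : Freud K J) : Module.End K (Freud K J) where
  toFun x := (6 : K) • S.triple w w' x + S.omega w' x • w + S.omega w x • w'
  map_add' x y := by simp only [triple_add, omega_add_right]; module
  map_smul' a x := by simp only [triple_smul, omega_smul_right, RingHom.id_apply]; module

theorem PhiLin_apply (w w' x : Freud K J) : S.PhiLin w w' x =
    (6 : K) • S.triple w w' x + S.omega w' x • w + S.omega w x • w' := rfl

theorem PhiLin_polar (w w' : Freud K J) : S.PhiLin w w' = (1 / 2 : K) •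
    (S.PhiLin (w + w') (w + w') - S.PhiLin w w - S.PhiLin w' w') := by
  refine LinearMap.ext fun x => ?_
  have h : S.triple (w + w') (w + w') x = S.triple w w x + (2 : K) • S.triple w w' x
      + S.triple w' w' x := by
    have h1 : ∀ a b, S.triple (w + w') a b = S.triple w a b + S.triple w' a b := fun a b => by
      rw [S.triple_swap_left, S.triple_swap_right, triple_add, S.triple_swap_right a b,
        S.triple_swap_right a b, S.triple_swap_left a, S.triple_swap_left a]
    rw [h1, S.triple_swap_left w, S.triple_swap_left w', h1, h1, S.triple_swap_left w' w]
    module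
  simp only [PhiLin_apply, LinearMap.smul_apply, LinearMap.sub_apply, h, omega_add_left]
  module

section FiniteDim

variable [FiniteDimensional K J]

theorem dual_phiJ (γ x : J) : S.dual (S.phiJ γ x) = -S.phiJ x γ := by
  refine LinearMap.ext fun z => S.ext_pairing fun y => ?_
  have h : S.pairing z (S.cross γ (S.cross x y)) = S.pairing (S.cross x (S.cross γ z)) y := by
    rw [S.pairing_cross_cross, S.pairing_cross, S.tri_swap_left, S.tri_eq, S.cross_comm z γ]
  simp only [pairing_dual, LinearMap.neg_apply, phiJ_apply, map_add, map_neg, map_smul,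
    LinearMap.add_apply, LinearMap.neg_apply, LinearMap.smul_apply, smul_eq_mul, h,
    S.pairing_symm z x, S.pairing_symm z γ, S.pairing_symm x γ]
  ring

theorem PhiLin_self (a : K) (b c : J) (d : K) : S.PhiLin (a, b, c, d) (a, b, c, d) = (4 : K) •
    (S.nLLin (S.sharp c - d • b) + S.nLDualLin (a • c - S.sharp b)
      + S.MLin (S.phiJ c b + (a * d - S.pairing b c) • 1)
        (2 * S.pairing c b + 3 * (a * d - S.pairing b c))) := by
  refine LinearMap.ext fun x => ?_
  obtain ⟨α, β, γ, δ⟩ := x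
  have c1 := S.cross_comm β c
  have c2 := S.cross_comm β b
  have c3 := S.cross_comm γ c
  have c4 := S.cross_comm γ b
  have p1 := S.pairing_symm c b
  have p2 := S.pairing_symm β b
  have p3 := S.pairing_symm β c
  have p4 := S.pairing_symm γ b
  have p5 := S.pairing_symm γ c
  have p6 := S.pairing_symm β γ
  have t1 := S.tri_swap_right b β b
  have t2 := S.tri_swap_left β b b
  have t3 := S.tri_swap_right c γ c
  have t4 := S.tri_swap_left γ c c
  have q1 : S.pairing β (S.cross b b) = S.tri b b β := by rw [S.pairing_cross, S.tri_cycle]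
  have q2 : S.pairing γ (S.cross c c) = S.tri c c γ := by rw [S.pairing_cross, S.tri_cycle]
  simp only [PhiLin_apply, triple, preTriple, omega, LinearMap.smul_apply, LinearMap.add_apply,
    nLLin_apply, nLDualLin_apply, MLin_apply, dual_add, dual_smul, dual_phiJ, dual_one,
    LinearMap.neg_apply, phiJ_apply, S.sharp_eq, map_add, map_sub, map_smul, map_neg,
    LinearMap.sub_apply, Module.End.one_apply, Prod.smul_mk, Prod.mk_add_mk, smul_eq_mul]
  simp only [c1, c2, c3, c4, p1, p2, p3, p4, p5, p6, t1, t2, t3, t4, q1, q2, S.cross_comm c b, S.cross_comm γ (S.cross b b),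
    S.cross_comm β (S.cross c c)]
  refine Prod.ext ?_ (Prod.ext ?_ (Prod.ext ?_ ?_))
  · ring1
  · module
  · module
  · ring1

theorem PhiLin_mem (w w' : Freud K J) : S.PhiLin w w' ∈ S.hJ := by
  have h : ∀ v, S.PhiLin v v ∈ S.hJ := by
    rintro ⟨a, b, c, d⟩
    rw [PhiLin_self]
    refine S.hJ.smul_mem _ (S.hJ.add_mem (S.hJ.add_mem (S.nLLin_mem _) (S.nLDualLin_mem _))
      (S.MLin_mem ?_))
    have h1 := S.mJ.add_mem (S.phiJ_mem c b) (S.mJ.smul_mem (a * d - S.pairing b c) S.id_mem_mJ)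
    simpa [mul_comm] using h1
  rw [PhiLin_polar]
  exact S.hJ.smul_mem _ (S.hJ.sub_mem (S.hJ.sub_mem (h _) (h _)) (h _))

/-- The element `Φ_{w,w'}` of `h(J)⁰`. -/
def Phi (w w' : Freud K J) : S.hJ := ⟨S.PhiLin w w', S.PhiLin_mem w w'⟩

/-- The decomposition `h(J)⁰ = J^∨ ⊕ m(J) ⊕ J`. -/
theorem exists_decomp {ψ : Module.End K (Freud K J)} (hψ : ψ ∈ S.hJ) :
    ∃ (γ : J) (φ : Module.End K J) (t : K) (x : J), (φ, t) ∈ S.mJ ∧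
      ψ = S.nLDualLin γ + S.MLin φ t + S.nLLin x := by
  obtain ⟨h1, h2⟩ := hψ
  simp only [four_cube] at h2
  have n1 := S.norm_one
  have ndiff : ∀ b : J, S.norm (b + (3 : K) • S.one) - 3 * S.norm (b + (2 : K) • S.one)
      + 3 * S.norm (b + S.one) - S.norm b = 6 := by
    intro b
    have h := S.tri_self S.one
    rw [n1] at h
    have e1 := S.tri_swap_right b S.one b
    have e2 := S.tri_swap_left S.one b b
    have e3 := S.tri_swap_left S.one b S.one
    have e4 := S.tri_swap_right S.one S.one b
    simp only [norm_eq, map_add, map_smul, LinearMap.add_apply, LinearMap.smul_apply, smul_eq_mul,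
      e1, e2, e3, e4, h]
    ring
  -- the blocks of `ψ`
  let ib : J →ₗ[K] Freud K J := LinearMap.inr K K (J × J × K) ∘ₗ LinearMap.inl K J (J × K)
  let B : Module.End K J := LinearMap.fst K J (J × K) ∘ₗ LinearMap.snd K K (J × J × K) ∘ₗ ψ ∘ₗ ib
  have hsplit : ∀ (a : K) (b c : J) (d : K), ψ (a, b, c, d) =
      a • ψ (1, 0, 0, 0) + ψ (0, b, 0, 0) + ψ (0, 0, c, 0) + d • ψ (0, 0, 0, 1) := by
    intro a b c d
    rw [← map_smul, ← map_smul, ← map_add, ← map_add, ← map_add]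
    simp
  have hbadd : ∀ b b' : J, ψ (0, b + b', 0, 0) = ψ (0, b, 0, 0) + ψ (0, b', 0, 0) := by
    intro b b'
    rw [← map_add]; simp
  have hcadd : ∀ b b' : J, ψ (0, 0, b + b', 0) = ψ (0, 0, b, 0) + ψ (0, 0, b', 0) := by
    intro b b'
    rw [← map_add]; simp
  have hB : ∀ b, B b = (ψ (0, b, 0, 0)).2.1 := fun b => rfl
  have hbsmul : ∀ (s : K) (b : J), ψ (0, s • b, 0, 0) = s • ψ (0, b, 0, 0) := by
    intro s b
    rw [← map_smul]; simp
  have hcsmul : ∀ (s : K) (b : J), ψ (0, 0, s • b, 0) = s • ψ (0, 0, b, 0) := by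
    intro s b
    rw [← map_smul]; simp
  generalize he0 : ψ (1, 0, 0, 0) = e0 at hsplit
  generalize he3 : ψ (0, 0, 0, 1) = e3 at hsplit
  obtain ⟨α, β, γ₀, δ₀⟩ := e0
  obtain ⟨α', β', γ, δ'⟩ := e3
  have f4 : ∀ (a : K) (b : J), (a * δ₀ + (ψ (0, b, 0, 0)).2.2.2) * S.norm b = 0 := by
    intro a b
    have h := h2 (a, b, 0, 0)
    have z : ψ (0, 0, 0, 0) = 0 := map_zero ψ
    rw [hsplit] at h
    simp [omega, preTriple, z, S.norm_eq] at h ⊢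
    grind
  have g1 : ∀ (c : J) (d : K), ((ψ (0, 0, c, 0)).1 + d * α') * S.norm c = 0 := by
    intro c d
    have h := h2 (0, 0, c, d)
    have z : ψ (0, 0, 0, 0) = 0 := map_zero ψ
    rw [hsplit] at h
    simp [omega, preTriple, z, S.norm_eq] at h ⊢
    grind
  have hf1 : (ψ (0, S.one, 0, 0)).2.2.2 = 0 := by
    have h := f4 0 S.one
    rw [n1] at h
    linear_combination h
  have hδ₀ : δ₀ = 0 := by
    have h := f4 1 S.one
    rw [n1, hf1] at h
    linear_combination h
  have hf4 : ∀ b, (ψ (0, b, 0, 0)).2.2.2 = 0 := by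
    intro b
    have k0 := f4 0 b
    have k1 := f4 0 (b + S.one)
    have k2 := f4 0 (b + (2 : K) • S.one)
    have k3 := f4 0 (b + (3 : K) • S.one)
    simp only [hbadd, hbsmul, Prod.snd_add, Prod.smul_snd, hf1, smul_zero, add_zero] at k0 k1 k2 k3
    have nd := ndiff b
    linear_combination (1 / 6) * k3 - (1 / 2) * k2 + (1 / 2) * k1 - (1 / 6) * k0
      - (1 / 6) * (ψ (0, b, 0, 0)).2.2.2 * nd
  have hg0 : (ψ (0, 0, S.one, 0)).1 = 0 := by
    have h := g1 S.one 0
    rw [n1] at h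
    linear_combination h
  have hα' : α' = 0 := by
    have h := g1 S.one 1
    rw [n1, hg0] at h
    linear_combination h
  have hg1 : ∀ b, (ψ (0, 0, b, 0)).1 = 0 := by
    intro b
    have k0 := g1 b 0
    have k1 := g1 (b + S.one) 0
    have k2 := g1 (b + (2 : K) • S.one) 0
    have k3 := g1 (b + (3 : K) • S.one) 0
    simp only [hcadd, hcsmul, Prod.fst_add, Prod.smul_fst, hg0, smul_zero, add_zero] at k0 k1 k2 k3
    have nd := ndiff b
    linear_combination (1 / 6) * k3 - (1 / 2) * k2 + (1 / 2) * k1 - (1 / 6) * k0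
      - (1 / 6) * (ψ (0, 0, b, 0)).1 * nd
  have hγ₀ : γ₀ = 0 := by
    apply S.pairing_nondeg
    intro b
    have h := h1 (1, 0, 0, 0) (0, b, 0, 0)
    simpa [omega, he0, hf4] using h
  have hβ' : β' = 0 := by
    apply S.pairing_nondeg
    intro b
    have h := h1 (0, 0, 0, 1) (0, 0, b, 0)
    simpa [omega, he3, hg1] using h
  have hδ' : δ' = -α := by
    have h := h1 (1, 0, 0, 0) (0, 0, 0, 1)
    simp [omega, he0, he3] at h
    linear_combination h
  have hg4 : ∀ c, (ψ (0, 0, c, 0)).2.2.2 = S.pairing β c := by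
    intro c
    have h := h1 (1, 0, 0, 0) (0, 0, c, 0)
    simp [omega, he0] at h
    linear_combination h
  have hf1' : ∀ b, (ψ (0, b, 0, 0)).1 = S.pairing γ b := by
    intro b
    have h := h1 (0, 0, 0, 1) (0, b, 0, 0)
    simp [omega, he3] at h
    linear_combination -h
  have hR : ∀ c, (ψ (0, 0, c, 0)).2.2.1 = S.dual B c := by
    intro c
    apply S.ext_pairing
    intro b
    have h := h1 (0, b, 0, 0) (0, 0, c, 0)
    simp [omega] at h
    rw [pairing_dual, hB, S.pairing_symm c, S.pairing_symm _ b]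
    linear_combination -h
  have hP1 : ∀ (c : J) (d : K), 2 * α * S.norm c - d * S.pairing (ψ (0, 0, c, 0)).2.1 c
      + 2 * S.pairing (S.dual B c) (S.sharp c) + 2 * d * S.pairing γ (S.sharp c) = 0 := by
    intro c d
    have h := h2 (1, 0, c, d)
    have z : ψ (0, 0, 0, 0) = 0 := map_zero ψ
    rw [hsplit] at h
    simp [omega, preTriple, z, hδ₀, hα', hγ₀, hβ', hδ', hg1, hg4, hR, S.cross_self,
      S.tri_self] at h
    linear_combination h
  have hQ1 : ∀ (b : J) (a : K), 2 * a * S.pairing β (S.sharp b)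
      - a * S.pairing (ψ (0, b, 0, 0)).2.2.1 b
      + 2 * S.pairing (B b) (S.sharp b) - 2 * α * S.norm b = 0 := by
    intro b a
    have h := h2 (a, b, 0, 1)
    have z : ψ (0, 0, 0, 0) = 0 := map_zero ψ
    rw [hsplit] at h
    simp [omega, preTriple, z, hδ₀, hα', hγ₀, hβ', hδ', hf4, hf1', S.cross_self,
      S.tri_self, ← hB] at h
    linear_combination h
  have hP : ∀ c, (ψ (0, 0, c, 0)).2.1 = S.cross γ c := by
    intro c
    have hd : ∀ c, S.pairing (ψ (0, 0, c, 0)).2.1 c = S.tri c c γ := by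
      intro c
      have k0 := hP1 c 0
      have k1 := hP1 c 1
      rw [S.pairing_symm γ, S.sharp_pairing] at k0 k1
      linear_combination k0 - k1
    apply S.ext_pairing
    intro c'
    have k1 := hd c
    have k2 := hd c'
    have k3 := hd (c + c')
    have k4 := h1 (0, 0, c, 0) (0, 0, c', 0)
    simp [omega] at k4
    simp only [hcadd, Prod.fst_add, Prod.snd_add, map_add, LinearMap.add_apply] at k3
    rw [S.pairing_symm c] at k4
    rw [← S.tri_eq, S.tri_cycle]
    have k5 := S.tri_swap_left c' c γ
    linear_combination (1 / 2) * (k3 - k1 - k2) - (1 / 2) * k4 + (1 / 2) * k5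
  have hQ : ∀ b, (ψ (0, b, 0, 0)).2.2.1 = S.cross b β := by
    intro c
    have hd : ∀ c, S.pairing (ψ (0, c, 0, 0)).2.2.1 c = S.tri c c β := by
      intro c
      have k0 := hQ1 c 0
      have k1 := hQ1 c 1
      rw [S.pairing_symm β, S.sharp_pairing] at k0 k1
      linear_combination k0 - k1
    apply S.ext_pairing
    intro c'
    have k1 := hd c
    have k2 := hd c'
    have k3 := hd (c + c')
    have k4 := h1 (0, c, 0, 0) (0, c', 0, 0)
    simp [omega] at k4
    simp only [hbadd, Prod.fst_add, Prod.snd_add, map_add, LinearMap.add_apply] at k3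
    rw [S.pairing_symm c] at k4
    rw [← S.tri_eq, S.tri_swap_right]
    have k5 := S.tri_swap_left c' c β
    linear_combination (1 / 2) * (k3 - k1 - k2) + (1 / 2) * k4 + (1 / 2) * k5
  refine ⟨γ, B - α • 1, -2 * α, β, ?_, ?_⟩
  · rw [mem_mJ_iff]
    intro b
    have k0 := hQ1 b 0
    have k1 : S.pairing b (S.sharp b) = 3 * S.norm b := by
      rw [S.pairing_symm, S.pairing_sharp_self]
    simp only [LinearMap.sub_apply, LinearMap.smul_apply, Module.End.one_apply, map_sub, map_smul,
      smul_eq_mul, k1]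
    linear_combination (1 / 2) * k0
  · refine LinearMap.ext fun v => ?_
    obtain ⟨a, b, c, d⟩ := v
    have hb : ψ (0, b, 0, 0) = (S.pairing γ b, B b, S.cross b β, 0) :=
      Prod.ext (hf1' b) (Prod.ext rfl (Prod.ext (hQ b) (hf4 b)))
    have hc : ψ (0, 0, c, 0) = (0, S.cross γ c, S.dual B c, S.pairing β c) :=
      Prod.ext (hg1 c) (Prod.ext (hP c) (Prod.ext (hR c) (hg4 c)))
    have hdual : S.dual (B - α • 1) = S.dual B + α • 1 := by
      rw [sub_eq_add_neg, ← neg_smul, dual_add, dual_smul, dual_one]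
      module
    rw [hsplit, hb, hc, hδ₀, hα', hγ₀, hβ', hδ']
    simp only [LinearMap.add_apply, nLDualLin_apply, MLin_apply, nLLin_apply, hdual,
      LinearMap.sub_apply, LinearMap.smul_apply, Module.End.one_apply, Prod.smul_mk,
      Prod.mk_add_mk, smul_eq_mul, S.pairing_symm b γ, S.pairing_symm c β]
    refine Prod.ext ?_ (Prod.ext ?_ (Prod.ext ?_ ?_))
    · ring1
    · module
    · module
    · ring1

end FiniteDim

end General

/-! ### Complexification of a real cubic norm structure -/

section Complexify

variable {J : Type*} [AddCommGroup J] [Module ℝ J] (S : CubicNormStructure ℝ J)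

/-- The trace pairing on `J ⊗ ℂ`. -/
def pairingC : (ℂ ⊗[ℝ] J) →ₗ[ℂ] (ℂ ⊗[ℝ] J) →ₗ[ℂ] ℂ := LinearMap.BilinForm.baseChange ℂ S.pairing

/-- The linearized adjoint on `J ⊗ ℂ`. -/
def crossC : (ℂ ⊗[ℝ] J) →ₗ[ℂ] (ℂ ⊗[ℝ] J) →ₗ[ℂ] (ℂ ⊗[ℝ] J) :=
  LinearMap.BilinMap.baseChange ℂ S.cross

theorem pairingC_tmul (a b : ℂ) (x y : J) :
    S.pairingC (a ⊗ₜ x) (b ⊗ₜ y) = (S.pairing x y : ℂ) * (a * b) := by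
  rw [pairingC, LinearMap.BilinForm.baseChange_tmul, Complex.real_smul]

theorem crossC_tmul (a b : ℂ) (x y : J) :
    S.crossC (a ⊗ₜ x) (b ⊗ₜ y) = (a * b) ⊗ₜ S.cross x y := rfl

/-- The symmetric trilinear form on `J ⊗ ℂ`. -/
def triC : (ℂ ⊗[ℝ] J) →ₗ[ℂ] (ℂ ⊗[ℝ] J) →ₗ[ℂ] (ℂ ⊗[ℝ] J) →ₗ[ℂ] ℂ :=
  LinearMap.compr₂ S.crossC S.pairingC

theorem triC_apply (x y z : ℂ ⊗[ℝ] J) : S.triC x y z = S.pairingC (S.crossC x y) z := rfl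

theorem triC_tmul (a b c : ℂ) (x y z : J) :
    S.triC (a ⊗ₜ x) (b ⊗ₜ y) (c ⊗ₜ z) = (S.tri x y z : ℂ) * (a * b * c) := by
  rw [triC_apply, crossC_tmul, pairingC_tmul, S.tri_eq]

theorem smul_tmul_real (a : ℂ) (r : ℝ) (x : J) : a ⊗ₜ[ℝ] (r • x) = ((r : ℂ) * a) ⊗ₜ[ℝ] x := by
  rw [← TensorProduct.smul_tmul, Complex.real_smul]

theorem crossC_comm (x y : ℂ ⊗[ℝ] J) : S.crossC x y = S.crossC y x :=
  LinearMap.BilinMap.baseChange_isSymm (fun x y => S.cross_comm x y) x y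

theorem pairingC_symm (x y : ℂ ⊗[ℝ] J) : S.pairingC x y = S.pairingC y x := by
  induction x using TensorProduct.induction_on with
  | zero => simp
  | add x x' hx hx' => simp only [map_add, LinearMap.add_apply, hx, hx']
  | tmul a x =>
    induction y using TensorProduct.induction_on with
    | zero => simp
    | add y y' hy hy' => simp only [map_add, LinearMap.add_apply, hy, hy']
    | tmul b y => rw [pairingC_tmul, pairingC_tmul, S.pairing_symm, mul_comm a]

theorem triC_swap_right (x y z : ℂ ⊗[ℝ] J) : S.triC x y z = S.triC x z y := by
  induction x using TensorProduct.induction_on with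
  | zero => simp
  | add x x' hx hx' => simp only [map_add, LinearMap.add_apply, hx, hx']
  | tmul a x =>
    induction y using TensorProduct.induction_on with
    | zero => simp
    | add y y' hy hy' => simp only [map_add, LinearMap.add_apply, hy, hy']
    | tmul b y =>
      induction z using TensorProduct.induction_on with
      | zero => simp
      | add z z' hz hz' => simp only [map_add, LinearMap.add_apply, hz, hz']
      | tmul c z => rw [triC_tmul, triC_tmul, S.tri_swap_right]; ring

theorem adjoint_identityC (x y z w : ℂ ⊗[ℝ] J) :
    S.crossC (S.crossC x y) (S.crossC z w) + S.crossC (S.crossC x z) (S.crossC y w)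
      + S.crossC (S.crossC x w) (S.crossC y z)
    = S.triC x y z • w + S.triC x y w • z + S.triC x z w • y + S.triC y z w • x := by
  induction x using TensorProduct.induction_on with
  | zero => simp
  | add x x' hx hx' =>
    simp only [map_add, LinearMap.add_apply] at hx hx' ⊢
    linear_combination (norm := module) hx + hx'
  | tmul a x =>
    induction y using TensorProduct.induction_on with
    | zero => simp
    | add x x' hx hx' =>
      simp only [map_add, LinearMap.add_apply] at hx hx' ⊢
      linear_combination (norm := module) hx + hx'
    | tmul b y =>
      induction z using TensorProduct.induction_on with
      | zero => simp
      | add x x' hx hx' =>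
        simp only [map_add, LinearMap.add_apply] at hx hx' ⊢
        linear_combination (norm := module) hx + hx'
      | tmul c z =>
        induction w using TensorProduct.induction_on with
        | zero => simp
        | add x x' hx hx' =>
          simp only [map_add, LinearMap.add_apply] at hx hx' ⊢
          linear_combination (norm := module) hx + hx'
        | tmul d w =>
          have h := congrArg (fun u => (a * b * c * d) ⊗ₜ[ℝ] u) (S.adjoint_identity x y z w)
          simp only [TensorProduct.tmul_add, smul_tmul_real] at h
          simp only [crossC_tmul, triC_tmul, TensorProduct.smul_tmul', smul_eq_mul]
          rw [show a * b * (c * d) = a * b * c * d by ring,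
            show a * c * (b * d) = a * b * c * d by ring,
            show a * d * (b * c) = a * b * c * d by ring,
            show (S.tri x y z : ℂ) * (a * b * c) * d = S.tri x y z * (a * b * c * d) by ring,
            show (S.tri x y w : ℂ) * (a * b * d) * c = S.tri x y w * (a * b * c * d) by ring,
            show (S.tri x z w : ℂ) * (a * c * d) * b = S.tri x z w * (a * b * c * d) by ring,
            show (S.tri y z w : ℂ) * (b * c * d) * a = S.tri y z w * (a * b * c * d) by ring]
          exact h

theorem exists_re_im (x : ℂ ⊗[ℝ] J) : ∃ a b : J, x = (1 : ℂ) ⊗ₜ a + Complex.I ⊗ₜ b := by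
  induction x using TensorProduct.induction_on with
  | zero => exact ⟨0, 0, by simp⟩
  | tmul z y =>
    refine ⟨z.re • y, z.im • y, ?_⟩
    rw [smul_tmul_real, smul_tmul_real, ← TensorProduct.add_tmul, mul_one, Complex.re_add_im]
  | add x y hx hy =>
    obtain ⟨a, b, rfl⟩ := hx
    obtain ⟨a', b', rfl⟩ := hy
    exact ⟨a + a', b + b', by simp only [TensorProduct.tmul_add]; abel⟩

/-- The cubic norm structure `J ⊗ ℂ` over `ℂ`. -/
def complexify : CubicNormStructure ℂ (ℂ ⊗[ℝ] J) where
  norm x := (1 / 6) * S.triC x x x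
  sharp x := (1 / 2 : ℂ) • S.crossC x x
  one := 1 ⊗ₜ S.one
  pairing := S.pairingC
  cross := S.crossC
  tri := S.triC
  sharp_smul a x := by
    simp only [map_smul, LinearMap.smul_apply]; module
  cross_eq x y := by
    simp only [map_add, LinearMap.add_apply, S.crossC_comm y x]; module
  tri_swap_left x y z := by rw [triC_apply, S.crossC_comm, ← triC_apply]
  tri_swap_right := S.triC_swap_right
  tri_self x := by ring
  pairing_symm := S.pairingC_symm
  pairing_nondeg x h := by
    obtain ⟨a, b, rfl⟩ := exists_re_im x
    have h1 : ∀ y, S.pairing a y = 0 ∧ S.pairing b y = 0 := fun y => by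
      have h2 := h ((1 : ℂ) ⊗ₜ y)
      simp only [map_add, LinearMap.add_apply, pairingC_tmul] at h2
      have h3 := congrArg Complex.re h2
      have h4 := congrArg Complex.im h2
      simp at h3 h4
      exact ⟨h3, h4⟩
    rw [S.pairing_nondeg a fun y => (h1 y).1, S.pairing_nondeg b fun y => (h1 y).2]
    simp
  norm_one := by
    rw [triC_tmul, S.tri_self, S.norm_one]; norm_num
  sharp_one := by
    rw [crossC_tmul, S.cross_self, S.sharp_one, smul_tmul_real, TensorProduct.smul_tmul']
    norm_num
  one_cross x := by
    induction x using TensorProduct.induction_on with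
    | zero => simp
    | add x y hx hy =>
      simp only [map_add] at hx hy ⊢
      linear_combination (norm := module) hx + hy
    | tmul a x =>
      rw [crossC_tmul, pairingC_tmul, S.one_cross, TensorProduct.tmul_sub, smul_tmul_real,
        TensorProduct.smul_tmul', smul_eq_mul]
      simp
  sharp_sharp x := by
    have h := S.adjoint_identityC x x x x
    simp only [map_smul, LinearMap.smul_apply]
    linear_combination (norm := module) (1 / 24 : ℂ) • h
  pairing_eq x y := by
    induction x using TensorProduct.induction_on with
    | zero => simp
    | add x x' hx hx' =>
      simp only [map_add, LinearMap.add_apply] at hx hx' ⊢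
      linear_combination hx + hx'
    | tmul a x =>
      induction y using TensorProduct.induction_on with
      | zero => simp
      | add x x' hx hx' =>
        simp only [map_add] at hx hx' ⊢
        linear_combination hx + hx'
      | tmul b y =>
        simp only [triC_tmul, pairingC_tmul]
        rw [S.pairing_eq x y]
        push_cast
        ring
  norm_add x y := by
    have e1 := S.triC_swap_right x y x
    have e2 := S.triC_swap_right y y x
    have e3 : ∀ z, S.triC y x z = S.triC x y z := fun z => by
      rw [triC_apply, S.crossC_comm, ← triC_apply]
    have e4 := S.triC_swap_right x y y
    have e5 : S.pairingC x (S.crossC y y) = S.triC x y y := by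
      rw [S.pairingC_symm, ← triC_apply, e2, e3]
    simp only [map_add, map_smul, LinearMap.add_apply, LinearMap.smul_apply, smul_eq_mul,
      ← triC_apply, e5, e3, e1, e2]
    ring

theorem complexify_norm (x : J) : S.complexify.norm (1 ⊗ₜ x) = (S.norm x : ℂ) := by
  change (1 / 6) * S.triC _ _ _ = _
  rw [triC_tmul, S.tri_self]
  push_cast
  ring

theorem complexify_sharp (x : J) : S.complexify.sharp (1 ⊗ₜ x) = 1 ⊗ₜ S.sharp x := by
  change (1 / 2 : ℂ) • S.crossC _ _ = _
  rw [crossC_tmul, S.cross_self, smul_tmul_real, TensorProduct.smul_tmul']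
  norm_num

end Complexify

/-! ### The Lie algebra `g(J)`: the `ℤ/2`-model and the `ℤ/3`-model -/

section Model

variable {K J : Type*} [Field K] [CharZero K] [AddCommGroup J] [Module K J]
variable (S : CubicNormStructure K J)

instance {n : Type*} [Fintype n] [DecidableEq n] :
    AddCommGroup (LieAlgebra.SpecialLinear.sl n K) := inferInstance

instance {n : Type*} [Fintype n] [DecidableEq n] :
    Module K (LieAlgebra.SpecialLinear.sl n K) := inferInstance

theorem mem_slSub {n : Type*} [Fintype n] [DecidableEq n] {A : Matrix n n K} :
    A ∈ LieAlgebra.SpecialLinear.sl n K ↔ A.trace = 0 := Iff.rfl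

/-- The standard symplectic pairing on `V₂ = K²`. -/
def pair2 (v w : Fin 2 → K) : K := v 0 * w 1 - v 1 * w 0

/-- The element `v · v'` of `Sym² V₂ = sl₂`, acting on `V₂` by
`x ↦ ⟨v', x⟩ v + ⟨v, x⟩ v'`. -/
def symTwo (v v' : Fin 2 → K) : LieAlgebra.SpecialLinear.sl (Fin 2) K :=
  ⟨Matrix.of fun k l => pair2 v' (Pi.single l 1) * v k + pair2 v (Pi.single l 1) * v' k, by
    rw [mem_slSub]
    simp [Matrix.trace, pair2, Fin.sum_univ_two]
    ring⟩

theorem symTwo_mulVec (v v' x : Fin 2 → K) :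
    (symTwo v v').1.mulVec x = pair2 v' x • v + pair2 v x • v' := by
  ext k
  fin_cases k <;>
    simp [symTwo, Matrix.mulVec, dotProduct, Fin.sum_univ_two, pair2] <;> ring

/-- The underlying space `sl₂ ⊕ h(J)⁰ ⊕ V₂ ⊗ W_J` of `g(J)`. The pair `(w₀, w₁)` in
`Fin 2 → W_J` stands for the tensor `e ⊗ w₀ + f ⊗ w₁`, where `e, f` is the standard basis of
`V₂`. -/
abbrev Z2 : Type _ := LieAlgebra.SpecialLinear.sl (Fin 2) K × S.hJ × (Fin 2 → Freud K J)

instance : AddCommGroup S.Z2 := inferInstance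

instance : AddCommMonoid S.Z2 := inferInstance

instance : Module K S.Z2 := inferInstance

instance : SMul K S.Z2 := inferInstance

/-- The inclusion of `sl₂` in `g(J)`. -/
def ofSl : LieAlgebra.SpecialLinear.sl (Fin 2) K →ₗ[K] S.Z2 := LinearMap.inl K _ _

/-- The inclusion of `h(J)⁰` in `g(J)`. -/
def ofH : S.hJ →ₗ[K] S.Z2 := (LinearMap.inr K _ _) ∘ₗ (LinearMap.inl K _ _)

/-- The element `v ⊗ w` of `V₂ ⊗ W_J ⊆ g(J)`. -/
def tens (v : Fin 2 → K) (w : Freud K J) : S.Z2 := (0, 0, fun k => v k • w)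

/-- The graded piece `g(J)₀ = sl₂ ⊕ h(J)⁰`. -/
def g0 : Submodule K S.Z2 where
  carrier := {x | x.2.2 = 0}
  add_mem' {x y} hx hy := by
    change x.2.2 + y.2.2 = 0
    rw [show x.2.2 = 0 from hx, show y.2.2 = 0 from hy, add_zero]
  zero_mem' := rfl
  smul_mem' a x hx := by
    change a • x.2.2 = 0
    rw [show x.2.2 = 0 from hx, smul_zero]

/-- The graded piece `g(J)₁ = V₂ ⊗ W_J`. -/
def g1 : Submodule K S.Z2 where
  carrier := {x | x.1 = 0 ∧ x.2.1 = 0}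
  add_mem' {x y} hx hy :=
    ⟨(congrArg₂ (· + ·) hx.1 hy.1).trans (add_zero _),
      (congrArg₂ (· + ·) hx.2 hy.2).trans (add_zero _)⟩
  zero_mem' := ⟨rfl, rfl⟩
  smul_mem' a x hx :=
    ⟨(congrArg (a • ·) hx.1).trans (smul_zero a), (congrArg (a • ·) hx.2).trans (smul_zero a)⟩

/-- The action of `g ∈ H_J¹` on `h(J)⁰` by conjugation. -/
def conjH (g : S.HJ1) : S.hJ ≃ₗ[K] S.hJ where
  toFun φ := ⟨g.1.conj φ.1, S.conj_mem_hJ g.2 φ.2⟩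
  map_add' φ ψ := Subtype.ext (map_add _ _ _)
  map_smul' a φ := Subtype.ext (map_smul _ _ _)
  invFun φ := ⟨g.1.symm.conj φ.1, S.conj_mem_hJ (g := g.1.symm) (S.HJ1.inv_mem g.2) φ.2⟩
  left_inv φ := Subtype.ext (by
    ext v <;> simp [LinearEquiv.conj_apply_apply])
  right_inv φ := Subtype.ext (by
    ext v <;> simp [LinearEquiv.conj_apply_apply])

/-- The adjoint action of `SL_n` on `sl_n`. -/
def conjSl {n : Type*} [Fintype n] [DecidableEq n] (A : Matrix.SpecialLinearGroup n K) :
    LieAlgebra.SpecialLinear.sl n K ≃ₗ[K] LieAlgebra.SpecialLinear.sl n K where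
  toFun B := ⟨A.1 * B.1 * A⁻¹.1, by
    rw [mem_slSub, Matrix.trace_mul_comm, ← mul_assoc,
      ← Matrix.SpecialLinearGroup.coe_mul]
    simpa using mem_slSub.1 B.2⟩
  map_add' B C := Subtype.ext (by simp [mul_add, add_mul])
  map_smul' a B := Subtype.ext (by simp)
  invFun B := ⟨A⁻¹.1 * B.1 * A.1, by
    rw [mem_slSub, Matrix.trace_mul_comm, ← mul_assoc,
      ← Matrix.SpecialLinearGroup.coe_mul]
    simpa using mem_slSub.1 B.2⟩
  left_inv B := Subtype.ext (by
    have h : A⁻¹.1 * A.1 = 1 := by rw [← Matrix.SpecialLinearGroup.coe_mul]; simp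
    change A⁻¹.1 * (A.1 * B.1 * A⁻¹.1) * A.1 = B.1
    rw [← mul_assoc, ← mul_assoc, h, mul_assoc, h, one_mul, mul_one])
  right_inv B := Subtype.ext (by
    have h : A.1 * A⁻¹.1 = 1 := by rw [← Matrix.SpecialLinearGroup.coe_mul]; simp
    change A.1 * (A⁻¹.1 * B.1 * A.1) * A⁻¹.1 = B.1
    rw [← mul_assoc, ← mul_assoc, h, mul_assoc, h, one_mul, mul_one])

/-- The action of `SL_n` on `V_n ⊗ U`, written as `n → U`. -/
def tensAct {n : Type*} [Fintype n] [DecidableEq n] (U : Type*) [AddCommGroup U] [Module K U]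
    (A : Matrix.SpecialLinearGroup n K) : (n → U) ≃ₗ[K] (n → U) where
  toFun u := fun j => ∑ k, A.1 j k • u k
  map_add' u v := by ext j; simp [Finset.sum_add_distrib]
  map_smul' a u := by ext j; simp [Finset.smul_sum, smul_comm a]
  invFun u := fun j => ∑ k, A⁻¹.1 j k • u k
  left_inv u := by
    have h : A⁻¹.1 * A.1 = 1 := by rw [← Matrix.SpecialLinearGroup.coe_mul]; simp
    ext j
    simp only [Finset.smul_sum, smul_smul]
    rw [Finset.sum_comm]
    simp only [← Finset.sum_smul, ← Matrix.mul_apply, h, Matrix.one_apply]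
    simp
  right_inv u := by
    have h : A.1 * A⁻¹.1 = 1 := by rw [← Matrix.SpecialLinearGroup.coe_mul]; simp
    ext j
    simp only [Finset.smul_sum, smul_smul]
    rw [Finset.sum_comm]
    simp only [← Finset.sum_smul, ← Matrix.mul_apply, h, Matrix.one_apply]
    simp

/-- The automorphism `A ⊠ g` of `g(J)` defined by `A ∈ SL₂` and `g ∈ H_J¹`: it acts on
`sl₂ ⊕ h(J)⁰` by conjugation, and on `V₂ ⊗ W_J` by `v ⊗ w ↦ A v ⊗ g w`. -/
def act (A : Matrix.SpecialLinearGroup (Fin 2) K) (g : S.HJ1) : S.Z2 ≃ₗ[K] S.Z2 :=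
  (conjSl A).prodCongr ((S.conjH g).prodCongr
    ((LinearEquiv.piCongrRight fun _ => g.1).trans (tensAct (Freud K J) A)))

theorem act_tens (A : Matrix.SpecialLinearGroup (Fin 2) K) (g : S.HJ1) (v : Fin 2 → K)
    (w : Freud K J) : S.act A g (S.tens v w) = S.tens (A.1.mulVec v) (g.1 w) := by
  change ((conjSl A 0, S.conjH g 0, tensAct (Freud K J) A fun k => g.1 (v k • w)) : S.Z2) = _
  rw [map_zero, map_zero]
  refine congrArg (Prod.mk _) (congrArg (Prod.mk _) (funext fun j => ?_))
  change ∑ k, A.1 j k • g.1 (v k • w) = A.1.mulVec v j • g.1 w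
  simp only [map_smul, smul_smul, ← Finset.sum_smul]
  rfl

/-- The element `J₂` of `SL₂`. -/
def J2 : Matrix.SpecialLinearGroup (Fin 2) K := ⟨!![0, 1; -1, 0], by simp⟩

/-- The Cartan involution `Θ` of `g(J)`, extended to all ground fields by the same formula. -/
def Theta : S.Z2 ≃ₗ[K] S.Z2 := S.act J2 S.J2W

variable [FiniteDimensional K J]

/-- The bracket on `g(J)` (with the parameter `α = 1/2`):
`[φ + v ⊗ w, φ' + v' ⊗ w'] = [φ, φ'] + ½ ⟨w, w'⟩ (v · v') + ½ ⟨v, v'⟩ Φ_{w,w'}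
  + φ (v' ⊗ w') - φ' (v ⊗ w)`, extended bilinearly. -/
def lieZ2 (x y : S.Z2) : S.Z2 :=
  (⁅x.1, y.1⁆ + (1 / 2 : K) • ∑ i, ∑ j,
        S.omega (x.2.2 i) (y.2.2 j) • symTwo (Pi.single i 1) (Pi.single j 1),
      ⁅x.2.1, y.2.1⁆ + (1 / 2 : K) • ∑ i, ∑ j,
        pair2 (K := K) (Pi.single i 1) (Pi.single j 1) • S.Phi (x.2.2 i) (y.2.2 j),
      fun k => (∑ l, x.1.1 k l • y.2.2 l) + x.2.1.1 (y.2.2 k)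
        - (∑ l, y.1.1 k l • x.2.2 l) - y.2.1.1 (x.2.2 k))

/-- The underlying space `sl₃ ⊕ m(J)⁰ ⊕ V₃ ⊗ J ⊕ V₃^∨ ⊗ J^∨` of the `ℤ/3`-model of `g(J)`.
The families `(X₀, X₁, X₂)` and `(γ₀, γ₁, γ₂)` stand for `v₁ ⊗ X₀ + v₂ ⊗ X₁ + v₃ ⊗ X₂` and
`δ₁ ⊗ γ₀ + δ₂ ⊗ γ₁ + δ₃ ⊗ γ₂`. -/
abbrev Z3 : Type _ := LieAlgebra.SpecialLinear.sl (Fin 3) K × S.mJ0 × (Fin 3 → J) × (Fin 3 → J)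

instance : AddCommGroup S.Z3 := inferInstance

instance : AddCommMonoid S.Z3 := inferInstance

instance : Module K S.Z3 := inferInstance

/-- The `sl₂`-component of the comparison map: `E₁₃ ↦ e²/2`, `E₃₁ ↦ -f²/2`,
`E₁₁ - E₃₃ ↦ -ef`, while `E₁₁ - 2E₂₂ + E₃₃` is sent to `h(J)⁰`. -/
def z3z2Sl (A : LieAlgebra.SpecialLinear.sl (Fin 3) K) : LieAlgebra.SpecialLinear.sl (Fin 2) K :=
  ⟨!![(A.1 0 0 - A.1 2 2) / 2, A.1 0 2; A.1 2 0, -((A.1 0 0 - A.1 2 2) / 2)], by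
    rw [mem_slSub, Matrix.trace_fin_two_of]; ring⟩

/-- The element `φ + t Id_J` of `m(J)`, for `φ ∈ m(J)⁰`. -/
def mAdd (φ : S.mJ0) (t : K) : S.mJ :=
  ⟨(φ.1, 0) + t • ((1 : Module.End K J), (3 : K)), S.mJ.add_mem φ.2 (S.mJ.smul_mem t S.id_mem_mJ)⟩

/-- The `h(J)⁰`-component of the comparison map: `δ₂ ⊗ γ + φ + v₂ ⊗ X` is sent to
`n_L^∨(γ) + M(φ) + n_L(-X)`, and `E₁₁ - 2E₂₂ + E₃₃` is sent to `φ_s = -2 M(Id_J)`. -/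
def z3z2H (x : S.Z3) : S.hJ :=
  S.nLDual (x.2.2.2 1) + S.M (S.mAdd x.2.1 (x.1.1 1 1)) + S.nL (-x.2.2.1 1)

/-- The `V₂ ⊗ W_J`-component of the comparison map:
`a E₁₂ + v₁ ⊗ b + δ₃ ⊗ c + d E₂₃ ↦ e ⊗ (a, b, c, d)` and
`a E₃₂ + v₃ ⊗ b + (-δ₁) ⊗ c + d (-E₂₁) ↦ f ⊗ (a, b, c, d)`. -/
def z3z2W (x : S.Z3) : Fin 2 → Freud K J :=
  ![(x.1.1 0 1, x.2.2.1 0, x.2.2.2 2, x.1.1 1 2),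
    (x.1.1 2 1, x.2.2.1 2, -x.2.2.2 0, -x.1.1 1 0)]

theorem z3z2H_apply (x : S.Z3) (a : K) (b c : J) (d : K) : (S.z3z2H x).1 (a, b, c, d) =
    (-(3 / 2) * x.1.1 1 1 * a + S.pairing b (x.2.2.2 1),
      -(1 / 2 * x.1.1 1 1) • b + x.2.1.1 b + S.cross (x.2.2.2 1) c - a • x.2.2.1 1,
      (1 / 2 * x.1.1 1 1) • c + S.dual x.2.1.1 c + d • x.2.2.2 1 - S.cross b (x.2.2.1 1),
      3 / 2 * x.1.1 1 1 * d - S.pairing c (x.2.2.1 1)) := by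
  change S.nLDualLin (x.2.2.2 1) (a, b, c, d)
    + S.MLin (x.2.1.1 + x.1.1 1 1 • (1 : Module.End K J)) (0 + x.1.1 1 1 • 3) (a, b, c, d)
    + S.nLLin (-x.2.2.1 1) (a, b, c, d) = _
  simp only [nLDualLin_apply, nLLin_apply, MLin_apply, dual_add, dual_smul, dual_one, map_neg,
    LinearMap.add_apply, LinearMap.smul_apply, LinearMap.neg_apply, Module.End.one_apply,
    smul_eq_mul, Prod.mk_add_mk]
  refine Prod.ext ?_ (Prod.ext ?_ (Prod.ext ?_ ?_)) <;> dsimp only <;> first | ring1 | module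

/-- The comparison map from the `ℤ/3`-model to the `ℤ/2`-model of `g(J)`. -/
def z3z2Lin : S.Z3 →ₗ[K] S.Z2 where
  toFun x := (z3z2Sl x.1, S.z3z2H x, S.z3z2W x)
  map_add' x y := by
    refine Prod.ext (Subtype.ext ?_) (Prod.ext (Subtype.ext ?_) ?_)
    · change (z3z2Sl (x.1 + y.1)).1 = (z3z2Sl x.1).1 + (z3z2Sl y.1).1
      ext i j
      fin_cases i <;> fin_cases j <;> simp [z3z2Sl] <;> ring
    · refine LinearMap.ext fun v => ?_
      obtain ⟨a, b, c, d⟩ := v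
      change (S.z3z2H (x + y)).1 _ = (S.z3z2H x).1 _ + (S.z3z2H y).1 _
      simp only [z3z2H_apply]
      change (-(3 / 2) * (x.1.1 1 1 + y.1.1 1 1) * a + S.pairing b (x.2.2.2 1 + y.2.2.2 1),
        -(1 / 2 * (x.1.1 1 1 + y.1.1 1 1)) • b + (x.2.1.1 + y.2.1.1) b
          + S.cross (x.2.2.2 1 + y.2.2.2 1) c - a • (x.2.2.1 1 + y.2.2.1 1),
        (1 / 2 * (x.1.1 1 1 + y.1.1 1 1)) • c + S.dual (x.2.1.1 + y.2.1.1) c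
          + d • (x.2.2.2 1 + y.2.2.2 1) - S.cross b (x.2.2.1 1 + y.2.2.1 1),
        3 / 2 * (x.1.1 1 1 + y.1.1 1 1) * d - S.pairing c (x.2.2.1 1 + y.2.2.1 1)) = _
      simp only [map_add, dual_add, LinearMap.add_apply, Prod.mk_add_mk]
      refine Prod.ext ?_ (Prod.ext ?_ (Prod.ext ?_ ?_)) <;> dsimp only <;> first | ring1 | module
    · change ![(x.1.1 0 1 + y.1.1 0 1, x.2.2.1 0 + y.2.2.1 0, x.2.2.2 2 + y.2.2.2 2,
          x.1.1 1 2 + y.1.1 1 2),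
        (x.1.1 2 1 + y.1.1 2 1, x.2.2.1 2 + y.2.2.1 2, -(x.2.2.2 0 + y.2.2.2 0),
          -(x.1.1 1 0 + y.1.1 1 0))] = S.z3z2W x + S.z3z2W y
      ext k <;> fin_cases k <;> simp [z3z2W] <;> abel
  map_smul' r x := by
    refine Prod.ext (Subtype.ext ?_) (Prod.ext (Subtype.ext ?_) ?_)
    · change (z3z2Sl (r • x.1)).1 = r • (z3z2Sl x.1).1
      ext i j
      fin_cases i <;> fin_cases j <;> simp [z3z2Sl] <;> ring
    · refine LinearMap.ext fun v => ?_
      obtain ⟨a, b, c, d⟩ := v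
      change (S.z3z2H (r • x)).1 _ = r • (S.z3z2H x).1 _
      simp only [z3z2H_apply]
      change (-(3 / 2) * (r * x.1.1 1 1) * a + S.pairing b (r • x.2.2.2 1),
        -(1 / 2 * (r * x.1.1 1 1)) • b + (r • x.2.1.1) b
          + S.cross (r • x.2.2.2 1) c - a • (r • x.2.2.1 1),
        (1 / 2 * (r * x.1.1 1 1)) • c + S.dual (r • x.2.1.1) c
          + d • (r • x.2.2.2 1) - S.cross b (r • x.2.2.1 1),
        3 / 2 * (r * x.1.1 1 1) * d - S.pairing c (r • x.2.2.1 1)) = _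
      simp only [map_smul, dual_smul, LinearMap.smul_apply, Prod.smul_mk, smul_eq_mul]
      refine Prod.ext ?_ (Prod.ext ?_ (Prod.ext ?_ ?_)) <;> dsimp only <;> first | ring1 | module
    · change ![(r * x.1.1 0 1, r • x.2.2.1 0, r • x.2.2.2 2, r * x.1.1 1 2),
        (r * x.1.1 2 1, r • x.2.2.1 2, -(r • x.2.2.2 0), -(r * x.1.1 1 0))] = r • S.z3z2W x
      ext k <;> fin_cases k <;> simp [z3z2W]

theorem z3z2Lin_injective : Function.Injective S.z3z2Lin := by
  rw [injective_iff_map_eq_zero]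
  intro x hx
  have h1 : (z3z2Sl x.1).1 = 0 := congrArg (fun y : S.Z2 => y.1.1) hx
  have h2 : ∀ v, (S.z3z2H x).1 v = 0 := fun v =>
    congrArg (fun y : S.Z2 => y.2.1.1 v) hx
  have h3 : S.z3z2W x = 0 := congrArg (fun y : S.Z2 => y.2.2) hx
  have t := mem_slSub.1 x.1.2
  rw [Matrix.trace_fin_three] at t
  have a1 := congrFun (congrFun h1 0) 0
  have a2 := congrFun (congrFun h1 0) 1
  have a3 := congrFun (congrFun h1 1) 0
  have b1 := h2 (1, 0, 0, 0)
  have b2 := h2 (0, 0, 0, 1)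
  have b3 := fun b => h2 (0, b, 0, 0)
  have c1 := congrFun h3 0
  have c2 := congrFun h3 1
  simp only [z3z2H_apply] at b1 b2 b3
  simp [z3z2Sl] at a1 a2 a3
  simp [z3z2W, Prod.ext_iff] at c1 c2
  simp [Prod.ext_iff] at b1 b2 b3
  obtain ⟨c3, c4, c5, c6⟩ := c1
  obtain ⟨c7, c8, c9, c10⟩ := c2
  obtain ⟨b4, b5⟩ := b1
  obtain ⟨b6, b7⟩ := b2
  simp only [b4, zero_smul, neg_zero, zero_add, mul_zero, add_zero] at b3
  refine Prod.ext (Subtype.ext ?_) (Prod.ext (Subtype.ext ?_) (Prod.ext ?_ ?_))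
  · change x.1.1 = 0
    have d1 : x.1.1 0 0 = 0 := by linear_combination a1 / 2 + t / 2 - b4 / 2
    have d2 : x.1.1 2 2 = 0 := by linear_combination -a1 / 2 + t / 2 - b4 / 2
    ext i j
    fin_cases i <;> fin_cases j <;> simp [*]
  · change x.2.1.1 = 0
    refine LinearMap.ext fun b => ?_
    exact (b3 b).2.1
  · change x.2.2.1 = 0
    ext i
    fin_cases i <;> simp [*]
  · change x.2.2.2 = 0
    ext i
    fin_cases i <;> simp [*]

theorem z3z2Lin_surjective : Function.Surjective S.z3z2Lin := by
  rintro ⟨A, ψ, U⟩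
  obtain ⟨γ, φ, t, x, hφ, hψ⟩ := S.exists_decomp ψ.2
  have tA := mem_slSub.1 A.2
  rw [Matrix.trace_fin_two] at tA
  refine ⟨(⟨!![A.1 0 0 - t / 6, (U 0).1, A.1 0 1; -(U 1).2.2.2, t / 3, (U 0).2.2.2;
      A.1 1 0, (U 1).1, A.1 1 1 - t / 6], ?_⟩, ⟨φ - (t / 3) • 1, ?_⟩,
      ![(U 0).2.1, -x, (U 1).2.1], ![-(U 1).2.2.1, γ, (U 0).2.2.1]), ?_⟩
  · rw [mem_slSub, Matrix.trace_fin_three]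
    simp
    linear_combination tA
  · have h := S.mJ.sub_mem hφ (S.mJ.smul_mem (t / 3) S.id_mem_mJ)
    rw [mem_mJ0]
    convert h using 1
    refine Prod.ext rfl ?_
    simp
  · refine Prod.ext (Subtype.ext ?_) (Prod.ext (Subtype.ext ?_) ?_)
    · change (z3z2Sl _).1 = A.1
      ext i j
      fin_cases i <;> fin_cases j <;> simp [z3z2Sl]
      · linear_combination -tA / 2
      · linear_combination -tA / 2
    · change (S.z3z2H _).1 = ψ.1
      rw [hψ]
      refine LinearMap.ext fun v => ?_
      obtain ⟨a, b, c, d⟩ := v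
      refine (S.z3z2H_apply _ a b c d).trans ?_
      simp only [LinearMap.add_apply, nLDualLin_apply, nLLin_apply, MLin_apply, Prod.mk_add_mk]
      rw [sub_eq_add_neg φ, ← neg_smul, dual_add, dual_smul, dual_one]
      simp [Prod.ext_iff]
      refine ⟨by ring, ?_, ?_⟩ <;> module
    · change S.z3z2W _ = U
      ext k <;> fin_cases k <;> simp [z3z2W]

/-- The comparison isomorphism from the `ℤ/3`-model to the `ℤ/2`-model of `g(J)`. -/
def z3z2 : S.Z3 ≃ₗ[K] S.Z2 :=
  LinearEquiv.ofBijective S.z3z2Lin ⟨S.z3z2Lin_injective, S.z3z2Lin_surjective⟩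

/-- The adjoint action of `SL₃` on the `ℤ/3`-model of `g(J)`: conjugation on `sl₃`, the trivial
action on `m(J)⁰`, the standard action on `V₃ ⊗ J` and the dual action on `V₃^∨ ⊗ J^∨`. -/
def actSL3 (g : Matrix.SpecialLinearGroup (Fin 3) K) : S.Z3 ≃ₗ[K] S.Z3 :=
  (conjSl g).prodCongr ((LinearEquiv.refl K S.mJ0).prodCongr
    ((tensAct J g).prodCongr (tensAct J (g⁻¹).transpose)))

end Model

/-! ### The Cayley transform and the distinguished elements of `g(J) ⊗ ℂ`

For a real cubic norm structure `S` on `J`, the complex Lie algebra `g(J) ⊗ ℂ` is `g(J ⊗ ℂ)`, the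
space `S.complexify.Z2`. -/

section Cayley

variable {J : Type*} [AddCommGroup J] [Module ℝ J] [FiniteDimensional ℝ J]
variable (S : CubicNormStructure ℝ J)

/-- The matrix `C₂ = (1/√2) (i, -1; 1, -i)` in `SL₂(ℂ)`. -/
def C2 : Matrix.SpecialLinearGroup (Fin 2) ℂ :=
  ⟨((Real.sqrt 2 : ℝ) : ℂ)⁻¹ • !![Complex.I, -1; 1, -Complex.I], by
    have h : ((Real.sqrt 2 : ℝ) : ℂ) ^ 2 = 2 := by
      rw [← Complex.ofReal_pow, Real.sq_sqrt (by norm_num)]; norm_num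
    rw [Matrix.det_smul, Matrix.det_fin_two_of, Fintype.card_fin, inv_pow, h]
    simp
    norm_num⟩

/-- The scalar `2^{-1/2}`. -/
def invSqrtTwo : ℂˣ :=
  Units.mk0 ((Real.sqrt 2 : ℝ) : ℂ)⁻¹ (by simp)

/-- The element `C_h = n_G(-i) n_G^∨(-i/2) η(2^{-1/2})` of `H_J¹(ℂ)`. -/
def Ch : S.complexify.HJ1 :=
  S.complexify.nG (-Complex.I • S.complexify.one) *
    S.complexify.nGDual (-(Complex.I / 2) • S.complexify.one) * S.complexify.eta invSqrtTwo

/-- The element `w₂₃` of `SL₃`. -/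
def w23 : Matrix.SpecialLinearGroup (Fin 3) ℂ :=
  ⟨!![-1, 0, 0; 0, 0, -1; 0, -1, 0], by simp [Matrix.det_fin_three]⟩

/-- The action of `w₂₃` on `g(J) ⊗ ℂ`, transported from the `ℤ/3`-model. -/
def w23Act : S.complexify.Z2 ≃ₗ[ℂ] S.complexify.Z2 :=
  (S.complexify.z3z2.symm.trans (S.complexify.actSL3 w23)).trans S.complexify.z3z2

/-- The map `𝒞 = (C₂ ⊠ C_h) w₂₃`: first `w₂₃`, then `C₂ ⊠ C_h`. -/
def cayley : S.complexify.Z2 ≃ₗ[ℂ] S.complexify.Z2 :=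
  S.w23Act.trans (S.complexify.act C2 S.Ch)

/-- The space `𝔨 = 𝔨₀ ⊗ ℂ`, the `+1`-eigenspace of the complexified Cartan involution. -/
def kC : Submodule ℂ S.complexify.Z2 :=
  Module.End.eigenspace (S.complexify.Theta : Module.End ℂ S.complexify.Z2) 1

/-- The space `𝔭 = 𝔭₀ ⊗ ℂ`, the `-1`-eigenspace of the complexified Cartan involution. -/
def pC : Submodule ℂ S.complexify.Z2 :=
  Module.End.eigenspace (S.complexify.Theta : Module.End ℂ S.complexify.Z2) (-1)

/-- Complex conjugation on `J ⊗ ℂ`. -/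
def conjJ : (ℂ ⊗[ℝ] J) →ₗ[ℝ] (ℂ ⊗[ℝ] J) :=
  LinearMap.rTensor J (Complex.conjAe.toLinearMap : ℂ →ₗ[ℝ] ℂ)

theorem conjJ_tmul (a : ℂ) (x : J) :
    conjJ (a ⊗ₜ[ℝ] x) = (starRingEnd ℂ a) ⊗ₜ x := rfl

theorem conjJ_smul (a : ℂ) (x : ℂ ⊗[ℝ] J) : conjJ (a • x) = (starRingEnd ℂ a) • conjJ x := by
  induction x using TensorProduct.induction_on with
  | zero => simp
  | tmul b x => simp [TensorProduct.smul_tmul', conjJ_tmul]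
  | add x y hx hy => simp only [smul_add, map_add, hx, hy]

theorem conjJ_conjJ (x : ℂ ⊗[ℝ] J) : conjJ (conjJ x) = x := by
  induction x using TensorProduct.induction_on with
  | zero => simp
  | tmul b x => simp [conjJ_tmul]
  | add x y hx hy => simp only [map_add, hx, hy]

theorem pairing_conjJ (x y : ℂ ⊗[ℝ] J) : S.complexify.pairing (conjJ x) (conjJ y)
    = starRingEnd ℂ (S.complexify.pairing x y) := by
  change S.pairingC _ _ = starRingEnd ℂ (S.pairingC _ _)
  induction x using TensorProduct.induction_on with
  | zero => simp
  | add x x' hx hx' => simp only [map_add, LinearMap.add_apply, hx, hx']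
  | tmul a x =>
    induction y using TensorProduct.induction_on with
    | zero => simp
    | add y y' hy hy' => simp only [map_add, hy, hy']
    | tmul b y => simp only [conjJ_tmul, pairingC_tmul, map_mul, Complex.conj_ofReal]

theorem cross_conjJ (x y : ℂ ⊗[ℝ] J) : S.complexify.cross (conjJ x) (conjJ y)
    = conjJ (S.complexify.cross x y) := by
  change S.crossC _ _ = conjJ (S.crossC _ _)
  induction x using TensorProduct.induction_on with
  | zero => simp
  | add x x' hx hx' => simp only [map_add, LinearMap.add_apply, hx, hx']
  | tmul a x =>
    induction y using TensorProduct.induction_on with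
    | zero => simp
    | add y y' hy hy' => simp only [map_add, hy, hy']
    | tmul b y => simp only [conjJ_tmul, crossC_tmul, map_mul]

theorem tri_conjJ (x y z : ℂ ⊗[ℝ] J) : S.complexify.tri (conjJ x) (conjJ y) (conjJ z)
    = starRingEnd ℂ (S.complexify.tri x y z) := by
  rw [tri_eq, tri_eq, cross_conjJ, pairing_conjJ]

/-- Complex conjugation on `W_J ⊗ ℂ`. -/
def conjW (v : Freud ℂ (ℂ ⊗[ℝ] J)) : Freud ℂ (ℂ ⊗[ℝ] J) :=
  (starRingEnd ℂ v.1, conjJ v.2.1, conjJ v.2.2.1, starRingEnd ℂ v.2.2.2)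

theorem conjW_conjW (v : Freud ℂ (ℂ ⊗[ℝ] J)) : conjW (conjW v) = v := by
  simp [conjW, conjJ_conjJ]

theorem conjW_add (v w : Freud ℂ (ℂ ⊗[ℝ] J)) : conjW (v + w) = conjW v + conjW w := by
  simp [conjW]

theorem conjW_smul (a : ℂ) (v : Freud ℂ (ℂ ⊗[ℝ] J)) :
    conjW (a • v) = starRingEnd ℂ a • conjW v := by
  simp [conjW, conjJ_smul]

theorem omega_conjW (v w : Freud ℂ (ℂ ⊗[ℝ] J)) :
    S.complexify.omega (conjW v) (conjW w) = starRingEnd ℂ (S.complexify.omega v w) := by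
  simp only [omega, conjW, pairing_conjJ, map_add, map_sub, map_mul]

theorem preTriple_conjW (x y z : Freud ℂ (ℂ ⊗[ℝ] J)) :
    S.complexify.preTriple (conjW x) (conjW y) (conjW z)
      = conjW (S.complexify.preTriple x y z) := by
  simp only [preTriple, conjW, pairing_conjJ, cross_conjJ, tri_conjJ, map_add, map_sub, map_mul,
    map_neg, conjJ_smul, map_div₀, map_one, map_ofNat]

/-- The conjugate `φ̄` of an endomorphism `φ` of `W_J ⊗ ℂ`, that is `φ̄(v) = \overline{φ(v̄)}`. -/
def conjEnd (φ : Module.End ℂ (Freud ℂ (ℂ ⊗[ℝ] J))) : Module.End ℂ (Freud ℂ (ℂ ⊗[ℝ] J)) where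
  toFun v := conjW (φ (conjW v))
  map_add' v w := by simp only [conjW_add, map_add]
  map_smul' a v := by simp only [conjW_smul, map_smul, starRingEnd_self_apply, RingHom.id_apply]

theorem conjEnd_mem {φ : Module.End ℂ (Freud ℂ (ℂ ⊗[ℝ] J))} (h : φ ∈ S.complexify.hJ) :
    conjEnd φ ∈ S.complexify.hJ := by
  refine ⟨fun v w => ?_, fun v => ?_⟩
  · have h1 := congrArg (starRingEnd ℂ) (h.1 (conjW v) (conjW w))
    rw [map_add, map_zero, ← omega_conjW, ← omega_conjW, conjW_conjW, conjW_conjW] at h1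
    exact h1
  · have h1 := congrArg (starRingEnd ℂ) (h.2 (conjW v))
    rw [four_cube, map_zero, ← omega_conjW, ← preTriple_conjW, conjW_conjW] at h1
    rw [four_cube]
    exact h1

/-- Complex conjugation on `g(J) ⊗ ℂ` with respect to the real form `g(J)`. -/
def conjZ2 (x : S.complexify.Z2) : S.complexify.Z2 :=
  (⟨x.1.1.map (starRingEnd ℂ), by
      have h := mem_slSub.1 x.1.2
      rw [Matrix.trace_fin_two] at h
      rw [mem_slSub, Matrix.trace_fin_two, Matrix.map_apply, Matrix.map_apply, ← map_add, h,
        map_zero]⟩,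
    ⟨conjEnd x.2.1.1, S.conjEnd_mem x.2.1.2⟩, fun k => conjW (x.2.2 k))

/-- The image of `X ∈ J` in `J ⊗ ℂ`. -/
def toC (X : J) : ℂ ⊗[ℝ] J := 1 ⊗ₜ X

/-- The trace `tr(X) = (1_J, X)`. -/
def trC (X : ℂ ⊗[ℝ] J) : ℂ := S.complexify.pairing S.complexify.one X

/-- The vector `r₀(Z) = (1, -Z, Z^#, -N(Z))`. -/
def r0 (Z : ℂ ⊗[ℝ] J) : Freud ℂ (ℂ ⊗[ℝ] J) :=
  (1, -Z, S.complexify.sharp Z, -S.complexify.norm Z)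

/-- The vector `V(X) = ½ (tr X, -i tr X + 2i X, tr X - 2X, -i tr X)`. -/
def V (X : ℂ ⊗[ℝ] J) : Freud ℂ (ℂ ⊗[ℝ] J) :=
  (1 / 2 : ℂ) • (S.trC X, -(Complex.I * S.trC X) • S.complexify.one + (2 * Complex.I) • X,
    S.trC X • S.complexify.one - (2 : ℂ) • X, -(Complex.I * S.trC X))

/-- The vector `V(X)^* = ½ (tr X, i tr X - 2i X, tr X - 2X, i tr X)`. -/
def VStar (X : ℂ ⊗[ℝ] J) : Freud ℂ (ℂ ⊗[ℝ] J) :=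
  (1 / 2 : ℂ) • (S.trC X, (Complex.I * S.trC X) • S.complexify.one - (2 * Complex.I) • X,
    S.trC X • S.complexify.one - (2 : ℂ) • X, Complex.I * S.trC X)

/-- The standard basis vector `e` of `V₂`. -/
def e : Fin 2 → ℂ := ![1, 0]

/-- The standard basis vector `f` of `V₂`. -/
def f : Fin 2 → ℂ := ![0, 1]

/-- The element `e_ℓ = ¼ (ie + f) ⊗ r₀(i)` of `𝔨`. -/
def eEll : S.complexify.Z2 :=
  (1 / 4 : ℂ) • S.complexify.tens (Complex.I • e + f) (S.r0 (Complex.I • S.complexify.one))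

/-- The element `f_ℓ = ¼ (ie - f) ⊗ r₀(-i)` of `𝔨`. -/
def fEll : S.complexify.Z2 :=
  (1 / 4 : ℂ) • S.complexify.tens (Complex.I • e - f) (S.r0 (-Complex.I • S.complexify.one))

/-- The element `n_E(X) = ½ (ie + f) ⊗ V(X)^*` of `𝔨`. -/
def nE (X : J) : S.complexify.Z2 :=
  (1 / 2 : ℂ) • S.complexify.tens (Complex.I • e + f) (S.VStar (toC X))

/-- The element `n_F(X) = ½ (ie - f) ⊗ V(X)` of `𝔨`. -/
def nF (X : J) : S.complexify.Z2 :=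
  (1 / 2 : ℂ) • S.complexify.tens (Complex.I • e - f) (S.V (toC X))

/-- The element `h₃ = ½ (-1, i; i, 1)` of `𝔭`. -/
def h3 : S.complexify.Z2 :=
  S.complexify.ofSl ((1 / 2 : ℂ) •
    ⟨!![-1, Complex.I; Complex.I, 1], by rw [mem_slSub, Matrix.trace_fin_two_of]; ring⟩)

/-- The element `h₁(X) = ½ (ie + f) ⊗ V(X)` of `𝔭`. -/
def h1 (X : J) : S.complexify.Z2 :=
  (1 / 2 : ℂ) • S.complexify.tens (Complex.I • e + f) (S.V (toC X))

/-- The element `h₋₁(Z) = (i/2) (n_L(Z) + n_L^∨(Z)) + ½ M(Φ_{1,Z})` of `𝔭`. -/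
def hNeg1 (Z : J) : S.complexify.Z2 :=
  S.complexify.ofH ((Complex.I / 2) • (S.complexify.nL (toC Z) + S.complexify.nLDual (toC Z))
    + (1 / 2 : ℂ) • S.complexify.M
      ⟨(S.complexify.phiJ S.complexify.one (toC Z),
        2 * S.complexify.pairing S.complexify.one (toC Z)), S.complexify.phiJ_mem _ _⟩)

/-- The element `h₋₃ = ¼ (ie - f) ⊗ r₀(i)` of `𝔭`. -/
def hNeg3 : S.complexify.Z2 :=
  (1 / 4 : ℂ) • S.complexify.tens (Complex.I • e - f) (S.r0 (Complex.I • S.complexify.one))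

/-- The element `(0, 1; 0, 0)` of `sl₂`. -/
def e0 : S.complexify.Z2 :=
  S.complexify.ofSl ⟨!![0, 1; 0, 0], by rw [mem_slSub, Matrix.trace_fin_two_of]; ring⟩

/-- The element `(0, 0; 1, 0)` of `sl₂`. -/
def f0 : S.complexify.Z2 :=
  S.complexify.ofSl ⟨!![0, 0; 1, 0], by rw [mem_slSub, Matrix.trace_fin_two_of]; ring⟩

end Cayley

end CubicNormStructure

end CubicLie

end

noncomputable section

namespace CubicLie

namespace CubicNormStructure

/-! ### Coordinates on h(J)⁰ and the bracket of the ℤ/3-model. -/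

section Brackets

variable {K J : Type*} [Field K] [CharZero K] [AddCommGroup J] [Module K J]
variable [FiniteDimensional K J] (S : CubicNormStructure K J)

/-! The map 𝒞 is a composite of two maps, and each is an automorphism for its own reason.

The factor C₂ ⊠ C_h comes from SL₂ × H_J¹, and the bracket of the ℤ/2-model is built from
ingredients natural under this group: commutators, the product v · v', the pairing on V₂, the
symplectic form, and Φ. The only point that is not formal is that g ∈ H_J¹ respects the triple
product t inside Φ. Such a g preserves q and ⟨ , ⟩, so it commutes with v ↦ t(v, v, v) because ⟨ , ⟩
is nondegenerate, and then with t by polarization (`triple_HJ1`, `act_lieZ2`).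

The factor w₂₃ is transparent only in the ℤ/3-model, where it permutes indices up to sign. That
model therefore receives its own bracket `lieZ3`; w₂₃ respects it (`actSL3_w23_lieZ3`), and the
comparison isomorphism carries it to the bracket of the ℤ/2-model (`z3z2_lieZ3`). The latter is the
longest computation. It rests on the coordinates h(J)⁰ = J^∨ ⊕ m(J) ⊕ J, in which both the
commutator and Φ have closed formulas (`HLin_lie`, `PhiLin_eq`).

The statement on 𝔨 and 𝔭 compares three involutions. The ℤ/2-grading of g(J) is given by diag(−1, 1,
−1) in SL₃. Conjugation by w₂₃ turns this into diag(−1, −1, 1), which in the ℤ/2-model is diag(−i,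
i) ⊠ η(−i). Finally J₂ C₂ = C₂ diag(−i, i) in SL₂ and J₂ C_h = C_h η(−i) in H_J¹, so C₂ ⊠ C_h turns
that diagonal element into Θ. Thus Θ𝒞 equals 𝒞 on g(J)₀ and −𝒞 on g(J)₁ (`Theta_cayley_g0`,
`Theta_cayley_g1`), and bijectivity of 𝒞 upgrades the two inclusions to equalities.

The twelve identities are verified by applying 𝒞 to the right-hand sides. There w₂₃ produces a pure
tensor, an off-diagonal matrix, or some n_L or n_L^∨. The vectors r₀(±i), V(X), V(X)^* are, up to
scalars, the images under C_h of the four slots of W_J, and ie ± f are those of e and f under C₂.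
Only h₋₁ and its conjugate need more, namely the conjugates of n_L^∨ and n_L by C_h (`Ch_nLDualLin`,
`Ch_nLLin`). -/

theorem cross_add_cross_of_mem_mJ {φ : Module.End K J} {t : K} (h : (φ, t) ∈ S.mJ) (x y : J) :
    S.cross (φ x) y + S.cross x (φ y) = t • S.cross x y + S.dual φ (S.cross x y) := by
  apply S.ext_pairing
  intro z
  have h1 := h x y z
  simp only [map_add, map_smul, LinearMap.add_apply, LinearMap.smul_apply, smul_eq_mul,
    pairing_dual, ← S.tri_eq]
  linear_combination h1

theorem dual_neg (φ : Module.End K J) : S.dual (-φ) = -S.dual φ := by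
  rw [← neg_one_smul K φ, dual_smul, neg_one_smul]

theorem dual_sub (φ ψ : Module.End K J) : S.dual (φ - ψ) = S.dual φ - S.dual ψ := by
  rw [sub_eq_add_neg, dual_add, dual_neg, sub_eq_add_neg]

/-- Since `dual` is minus the adjoint, it reverses products up to a sign, and hence respects
commutators. -/
theorem dual_mul (φ ψ : Module.End K J) : S.dual (φ * ψ) = -(S.dual ψ * S.dual φ) := by
  ext x
  apply S.ext_pairing
  intro z
  simp only [pairing_dual, Module.End.mul_apply, LinearMap.neg_apply, map_neg, neg_neg]

/-- The endomorphism `n_L^∨(γ) + M(φ) + n_L(x)` of `W_J`, where `φ` has multiplier `t`. -/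
def HLin (γ : J) (φ : Module.End K J) (t : K) (x : J) : Module.End K (Freud K J) :=
  S.nLDualLin γ + S.MLin φ t + S.nLLin x

theorem HLin_apply (γ : J) (φ : Module.End K J) (t : K) (x : J) (a : K) (b c : J) (d : K) :
    S.HLin γ φ t x (a, b, c, d) =
      (S.pairing b γ - t / 2 * a, S.cross γ c - (t / 2) • b + φ b + a • x,
        d • γ + (t / 2) • c + S.dual φ c + S.cross b x, t / 2 * d + S.pairing c x) := by
  simp only [HLin, LinearMap.add_apply, nLDualLin_apply, MLin_apply, nLLin_apply, Prod.mk_add_mk]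
  refine Prod.ext ?_ (Prod.ext ?_ (Prod.ext ?_ ?_)) <;> dsimp only <;> first | ring1 | module

/-- In the decomposition J^∨ ⊕ m(J) ⊕ J of h(J)⁰, m(J) acts on the two ends through `dual φ` and φ,
the two ends bracket into m(J) through ∓Φ_{γ,x}, and each end is abelian. The multipliers t and t'
drop out: the gap t between the second and third slots of M(φ) is exactly the multiplier in the
derivation rule for the cross product. -/
theorem HLin_lie {γ γ' x x' : J} {φ φ' : Module.End K J} {t t' : K} (h : (φ, t) ∈ S.mJ)
    (h' : (φ', t') ∈ S.mJ) :
    ⁅S.HLin γ φ t x, S.HLin γ' φ' t' x'⁆ =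
      S.HLin (S.dual φ γ' - S.dual φ' γ)
        (φ * φ' - φ' * φ - S.phiJ γ x' + S.phiJ γ' x)
        (2 * S.pairing γ' x - 2 * S.pairing γ x') (φ x' - φ' x) := by
  refine LinearMap.ext fun v => ?_
  obtain ⟨a, b, c, d⟩ := v
  have e1 := S.cross_add_cross_of_mem_mJ h b x'
  have e2 := S.cross_add_cross_of_mem_mJ h' b x
  have e3 := S.cross_add_cross_of_mem_mJ (S.dual_mem h) γ' c
  have e4 := S.cross_add_cross_of_mem_mJ (S.dual_mem h') γ c
  have pairing_cross_left : ∀ u v w, S.pairing u (S.cross v w) = S.pairing v (S.cross u w) :=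
    fun u v w => by rw [S.pairing_cross, S.pairing_cross, S.tri_swap_left]
  -- Applied to `dual φ`, the derivation rule produces its double dual, which is φ again.
  rw [dual_dual] at e3 e4
  simp only [LieRing.of_associative_ring_bracket, LinearMap.sub_apply, Module.End.mul_apply,
    HLin_apply, map_add, map_sub, map_smul, LinearMap.add_apply, LinearMap.smul_apply, dual_add,
    dual_sub, dual_mul, dual_phiJ, LinearMap.neg_apply, phiJ_apply, smul_eq_mul, Prod.mk_sub_mk,
    pairing_dual, pairing_dual_right]
  refine Prod.ext ?_ (Prod.ext ?_ (Prod.ext ?_ ?_)) <;> dsimp only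
  -- The outer slots need the symmetry of the trilinear form, the middle slots the derivation rule.
  -- Normalization is postponed so that the commutativity lemmas can first sort the arguments of
  -- pairings and cross products on both sides.
  · linear_combination (norm := skip) pairing_cross_left γ γ' c
    simp only [S.pairing_symm, S.cross_comm]
    ring
  · linear_combination (norm := skip) e4 - e3
    simp only [S.cross_comm, S.pairing_symm]
    module
  · linear_combination (norm := skip) e2 - e1
    simp only [S.cross_comm, S.pairing_symm]
    module
  · linear_combination (norm := skip) pairing_cross_left x x' b
    simp only [S.pairing_symm, S.cross_comm]
    ring

/-- Polarization of `PhiLin_self`. It expresses Φ in the same coordinates as the commutator; the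
overall factor 2 cancels the ½ in front of Φ in the bracket. -/
theorem PhiLin_eq (a : K) (b c : J) (d a' : K) (b' c' : J) (d' : K) :
    S.PhiLin (a, b, c, d) (a', b', c', d') = (2 : K) •
      S.HLin (a • c' + a' • c - S.cross b b')
        (S.phiJ c b' + S.phiJ c' b + (a * d' + a' * d - S.pairing b c' - S.pairing b' c) • 1)
        (2 * S.pairing c b' + 2 * S.pairing c' b
          + 3 * (a * d' + a' * d - S.pairing b c' - S.pairing b' c))
        (S.cross c c' - d • b' - d' • b) := by
  rw [PhiLin_polar]
  simp only [Prod.mk_add_mk, PhiLin_self]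
  refine LinearMap.ext fun v => ?_
  obtain ⟨α, β, γ, δ⟩ := v
  simp only [HLin, LinearMap.smul_apply, LinearMap.add_apply, LinearMap.sub_apply,
    nLLin_apply, nLDualLin_apply, MLin_apply, dual_add, dual_smul, dual_phiJ, dual_one,
    LinearMap.neg_apply, phiJ_apply, S.sharp_add, map_add, map_sub, map_smul, map_neg,
    Module.End.one_apply, Prod.smul_mk, Prod.mk_add_mk, Prod.mk_sub_mk, smul_eq_mul]
  refine Prod.ext ?_ (Prod.ext ?_ (Prod.ext ?_ ?_)) <;> dsimp only <;> first | ring1 | module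

/-- The multiplier is a character of m(J): on a commutator it is t t' − t' t = 0. -/
theorem mJ_lie {φ φ' : Module.End K J} {t t' : K} (h : (φ, t) ∈ S.mJ) (h' : (φ', t') ∈ S.mJ) :
    φ * φ' - φ' * φ ∈ S.mJ0 := by
  intro x y z
  change S.tri ((φ * φ' - φ' * φ) x) y z + S.tri x ((φ * φ' - φ' * φ) y) z
    + S.tri x y ((φ * φ' - φ' * φ) z) = 0 * S.tri x y z
  simp only [LinearMap.sub_apply, Module.End.mul_apply, map_sub]
  have a1 := h (φ' x) y z
  have a2 := h x (φ' y) z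
  have a3 := h x y (φ' z)
  have b1 := h' (φ x) y z
  have b2 := h' x (φ y) z
  have b3 := h' x y (φ z)
  have c := h x y z
  have c' := h' x y z
  simp only at *
  linear_combination a1 + a2 + a3 - b1 - b2 - b3 + t * c' - t' * c

/-- The projection of `Φ_{γ,x}` to `m(J)⁰`. -/
def phiJ0 (γ x : J) : S.mJ0 :=
  ⟨S.phiJ γ x - (2 / 3 * S.pairing γ x) • 1, by
    have h := S.mJ.sub_mem (S.phiJ_mem γ x) (S.mJ.smul_mem (2 / 3 * S.pairing γ x) S.id_mem_mJ)
    rw [mem_mJ0]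
    convert h using 1
    refine Prod.ext rfl ?_
    simp
    ring⟩

/-- The bracket `[δ ⊗ γ, v ⊗ x]` in the `ℤ/3`-model has `sl₃`-component
`(γ, x) (v ⊗ δ - ⅓ δ(v))`; this is the sum of these components for families `γ` and `x`. -/
def slPart (γ x : Fin 3 → J) : LieAlgebra.SpecialLinear.sl (Fin 3) K :=
  ⟨(Matrix.of fun i j => S.pairing (γ j) (x i)) - ((1 / 3) * ∑ k, S.pairing (γ k) (x k)) • 1, by
    rw [mem_slSub]
    simp [Matrix.trace_fin_three, Fin.sum_univ_three]
    ring⟩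

/-- The product `v ⊗ x, v' ⊗ x' ↦ (v ∧ v') ⊗ (x × x')`. -/
def wedge (x y : Fin 3 → J) : Fin 3 → J :=
  ![S.cross (x 1) (y 2) - S.cross (x 2) (y 1), S.cross (x 2) (y 0) - S.cross (x 0) (y 2),
    S.cross (x 0) (y 1) - S.cross (x 1) (y 0)]

/-- The bracket of the `ℤ/3`-model of `g(J)`. -/
def lieZ3 (x y : S.Z3) : S.Z3 :=
  (⁅x.1, y.1⁆ + S.slPart x.2.2.2 y.2.2.1 - S.slPart y.2.2.2 x.2.2.1,
    ⟨x.2.1.1 * y.2.1.1 - y.2.1.1 * x.2.1.1, S.mJ_lie x.2.1.2 y.2.1.2⟩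
      + ∑ k, S.phiJ0 (x.2.2.2 k) (y.2.2.1 k) - ∑ k, S.phiJ0 (y.2.2.2 k) (x.2.2.1 k),
    (fun k => ∑ l, x.1.1 k l • y.2.2.1 l - ∑ l, y.1.1 k l • x.2.2.1 l
      + x.2.1.1 (y.2.2.1 k) - y.2.1.1 (x.2.2.1 k) + S.wedge x.2.2.2 y.2.2.2 k),
    (fun k => -∑ l, x.1.1 l k • y.2.2.2 l + ∑ l, y.1.1 l k • x.2.2.2 l
      + S.dual x.2.1.1 (y.2.2.2 k) - S.dual y.2.1.1 (x.2.2.2 k) + S.wedge x.2.2.1 y.2.2.1 k))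

end Brackets

/-! ### The comparison map intertwines the two brackets. -/

section Comparison

variable {K J : Type*} [Field K] [CharZero K] [AddCommGroup J] [Module K J]
variable [FiniteDimensional K J] (S : CubicNormStructure K J)

theorem z3z2_apply (x : S.Z3) : S.z3z2 x = (z3z2Sl x.1, S.z3z2H x, S.z3z2W x) := rfl

/-- The middle diagonal entry s of the sl₃-component enters as M(s Id), and Id has multiplier 3. -/
theorem coe_z3z2H (x : S.Z3) : (S.z3z2H x).1 =
    S.HLin (x.2.2.2 1) (x.2.1.1 + x.1.1 1 1 • 1) (3 * x.1.1 1 1) (-x.2.2.1 1) := by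
  change S.HLin (x.2.2.2 1) (x.2.1.1 + x.1.1 1 1 • 1) (0 + x.1.1 1 1 • 3) (-x.2.2.1 1) = _
  rw [zero_add, smul_eq_mul, mul_comm]

theorem HLin_add (γ γ' x x' : J) (φ φ' : Module.End K J) (t t' : K) :
    S.HLin γ φ t x + S.HLin γ' φ' t' x' = S.HLin (γ + γ') (φ + φ') (t + t') (x + x') := by
  refine LinearMap.ext fun ⟨a, b, c, d⟩ => ?_
  simp only [LinearMap.add_apply, HLin_apply, map_add, dual_add, Prod.mk_add_mk]
  refine Prod.ext ?_ (Prod.ext ?_ (Prod.ext ?_ ?_)) <;> dsimp only <;> first | ring1 | module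

theorem HLin_smul (s : K) (γ x : J) (φ : Module.End K J) (t : K) :
    s • S.HLin γ φ t x = S.HLin (s • γ) (s • φ) (s * t) (s • x) := by
  refine LinearMap.ext fun ⟨a, b, c, d⟩ => ?_
  simp only [LinearMap.smul_apply, HLin_apply, map_smul, dual_smul, Prod.smul_mk, smul_eq_mul]
  refine Prod.ext ?_ (Prod.ext ?_ (Prod.ext ?_ ?_)) <;> dsimp only <;> first | ring1 | module

/-- Only mixed terms survive, because ⟨e, e⟩ = ⟨f, f⟩ = 0 and ⟨e, f⟩ = 1. -/
theorem coe_lieZ2_h (x y : S.Z2) : (S.lieZ2 x y).2.1.1 = ⁅x.2.1.1, y.2.1.1⁆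
    + (1 / 2 : K) • (S.PhiLin (x.2.2 0) (y.2.2 1) - S.PhiLin (x.2.2 1) (y.2.2 0)) := by
  change ⁅x.2.1.1, y.2.1.1⁆ + (1 / 2 : K) • (∑ i, ∑ j,
        pair2 (K := K) (Pi.single i 1) (Pi.single j 1) • S.Phi (x.2.2 i) (y.2.2 j) : S.hJ).1 = _
  congr 2
  simp [Fin.sum_univ_two, pair2, Phi, sub_eq_add_neg]

/-- The entries come from the matrices of e · e, e · f and f · f, which are 2E₁₂, diag(−1, 1) and
−2E₂₁. -/
theorem coe_lieZ2_sl (x y : S.Z2) : (S.lieZ2 x y).1.1 = x.1.1 * y.1.1 - y.1.1 * x.1.1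
    + (1 / 2 : K) • !![-(S.omega (x.2.2 0) (y.2.2 1) + S.omega (x.2.2 1) (y.2.2 0)),
        2 * S.omega (x.2.2 0) (y.2.2 0);
      -(2 * S.omega (x.2.2 1) (y.2.2 1)),
        S.omega (x.2.2 0) (y.2.2 1) + S.omega (x.2.2 1) (y.2.2 0)] := by
  change x.1.1 * y.1.1 - y.1.1 * x.1.1 + (1 / 2 : K) • (∑ i, ∑ j,
        S.omega (x.2.2 i) (y.2.2 j) • symTwo (Pi.single i 1) (Pi.single j 1) :
          LieAlgebra.SpecialLinear.sl (Fin 2) K).1 = _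
  congr 2
  ext i j
  fin_cases i <;> fin_cases j <;> simp [Fin.sum_univ_two, symTwo, pair2] <;> ring

theorem lieZ2_w (x y : S.Z2) (k : Fin 2) : (S.lieZ2 x y).2.2 k =
    x.1.1 k 0 • y.2.2 0 + x.1.1 k 1 • y.2.2 1 + x.2.1.1 (y.2.2 k)
      - (y.1.1 k 0 • x.2.2 0 + y.1.1 k 1 • x.2.2 1) - y.2.1.1 (x.2.2 k) := by
  change (∑ l, x.1.1 k l • y.2.2 l) + x.2.1.1 (y.2.2 k)
    - (∑ l, y.1.1 k l • x.2.2 l) - y.2.1.1 (x.2.2 k) = _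
  rw [Fin.sum_univ_two, Fin.sum_univ_two]

theorem coe_lieZ3_sl (x y : S.Z3) (i j : Fin 3) : (S.lieZ3 x y).1.1 i j =
    (∑ k, x.1.1 i k * y.1.1 k j) - (∑ k, y.1.1 i k * x.1.1 k j)
    + (S.pairing (x.2.2.2 j) (y.2.2.1 i)
      - if i = j then 1 / 3 * ∑ k, S.pairing (x.2.2.2 k) (y.2.2.1 k) else 0)
    - (S.pairing (y.2.2.2 j) (x.2.2.1 i)
      - if i = j then 1 / 3 * ∑ k, S.pairing (y.2.2.2 k) (x.2.2.1 k) else 0) := by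
  change (x.1.1 * y.1.1 - y.1.1 * x.1.1 + (S.slPart x.2.2.2 y.2.2.1).1
    - (S.slPart y.2.2.2 x.2.2.1).1) i j = _
  simp only [Matrix.add_apply, Matrix.sub_apply, Matrix.mul_apply, slPart, Matrix.smul_apply,
    Matrix.of_apply, Matrix.one_apply, smul_eq_mul, mul_ite, mul_one, mul_zero]

theorem coe_lieZ3_m (x y : S.Z3) : (S.lieZ3 x y).2.1.1 =
    x.2.1.1 * y.2.1.1 - y.2.1.1 * x.2.1.1
      + ∑ k, (S.phiJ (x.2.2.2 k) (y.2.2.1 k) - (2 / 3 * S.pairing (x.2.2.2 k) (y.2.2.1 k)) • 1)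
      - ∑ k, (S.phiJ (y.2.2.2 k) (x.2.2.1 k)
        - (2 / 3 * S.pairing (y.2.2.2 k) (x.2.2.1 k)) • 1) := by
  change x.2.1.1 * y.2.1.1 - y.2.1.1 * x.2.1.1
    + S.mJ0.subtype (∑ k, S.phiJ0 (x.2.2.2 k) (y.2.2.1 k))
    - S.mJ0.subtype (∑ k, S.phiJ0 (y.2.2.2 k) (x.2.2.1 k)) = _
  rw [map_sum, map_sum]
  rfl

theorem lieZ3_v (x y : S.Z3) (k : Fin 3) : (S.lieZ3 x y).2.2.1 k =
    ∑ l, x.1.1 k l • y.2.2.1 l - ∑ l, y.1.1 k l • x.2.2.1 l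
      + x.2.1.1 (y.2.2.1 k) - y.2.1.1 (x.2.2.1 k) + S.wedge x.2.2.2 y.2.2.2 k := rfl

theorem lieZ3_d (x y : S.Z3) (k : Fin 3) : (S.lieZ3 x y).2.2.2 k =
    -∑ l, x.1.1 l k • y.2.2.2 l + ∑ l, y.1.1 l k • x.2.2.2 l
      + S.dual x.2.1.1 (y.2.2.2 k) - S.dual y.2.1.1 (x.2.2.2 k) + S.wedge x.2.2.1 y.2.2.1 k := rfl

theorem phiJ_neg_left (γ x : J) : S.phiJ (-γ) x = -S.phiJ γ x := by
  refine LinearMap.ext fun z => ?_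
  simp only [phiJ_apply, LinearMap.neg_apply, map_neg, neg_smul]
  module

theorem phiJ_neg_right (γ x : J) : S.phiJ γ (-x) = -S.phiJ γ x := by
  refine LinearMap.ext fun z => ?_
  simp only [phiJ_apply, LinearMap.neg_apply, map_neg, neg_smul]
  module

/-- The comparison map sees the diagonal of A only through (A₁₁ − A₃₃)/2 and A₂₂; the trace
condition is what recovers the separate entries. -/
theorem coe_sl_one_one (A : LieAlgebra.SpecialLinear.sl (Fin 3) K) :
    A.1 1 1 = -A.1 0 0 - A.1 2 2 := by
  have t := mem_slSub.1 A.2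
  rw [Matrix.trace_fin_three] at t
  linear_combination t

/-- In the corner entries of a 3×3 commutator, the terms passing through the middle index, together
with the pairings of the V₃ ⊗ J and V₃^∨ ⊗ J^∨ components, are the four terms of the symplectic
form. -/
theorem z3z2_lieZ3_sl (x y : S.Z3) :
    (S.z3z2 (S.lieZ3 x y)).1 = (S.lieZ2 (S.z3z2 x) (S.z3z2 y)).1 := by
  refine Subtype.ext ?_
  rw [coe_lieZ2_sl]
  simp only [z3z2_apply, z3z2Sl, coe_lieZ3_sl, z3z2W, omega, Fin.sum_univ_three]
  ext i j
  fin_cases i <;> fin_cases j <;>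
    simp [Matrix.mul_apply, Fin.sum_univ_two] <;> simp only [S.pairing_symm] <;> ring

theorem z3z2_lieZ3_h (x y : S.Z3) :
    (S.z3z2 (S.lieZ3 x y)).2.1 = (S.lieZ2 (S.z3z2 x) (S.z3z2 y)).2.1 := by
  refine Subtype.ext ?_
  have hx := (S.mAdd x.2.1 (x.1.1 1 1)).2
  have hy := (S.mAdd y.2.1 (y.1.1 1 1)).2
  have e : ∀ x : S.Z3, (S.mAdd x.2.1 (x.1.1 1 1)).1
      = (x.2.1.1 + x.1.1 1 1 • (1 : Module.End K J), 3 * x.1.1 1 1) := fun x => by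
    change (x.2.1.1 + x.1.1 1 1 • (1 : Module.End K J), 0 + x.1.1 1 1 • 3) = _
    rw [zero_add, smul_eq_mul, mul_comm]
  rw [e] at hx hy
  rw [coe_lieZ2_h]
  change (S.z3z2H (S.lieZ3 x y)).1 = ⁅(S.z3z2H x).1, (S.z3z2H y).1⁆ + (1 / 2 : K) •
    (S.PhiLin (S.z3z2W x 0) (S.z3z2W y 1) - S.PhiLin (S.z3z2W x 1) (S.z3z2W y 0))
  rw [coe_z3z2H, coe_z3z2H, coe_z3z2H, S.HLin_lie hx hy]
  simp only [z3z2W, Matrix.cons_val_zero, Matrix.cons_val_one, PhiLin_eq]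
  -- The ½ of the bracket cancels the 2 of `PhiLin_eq`. The difference is written with the scalar −1
  -- so that `HLin_smul` and `HLin_add` merge everything into a single `HLin`; it then suffices to
  -- compare its four parameters.
  have half : ∀ A B C : Module.End K (Freud K J),
      A + (1 / 2 : K) • ((2 : K) • B - (2 : K) • C) = A + (B + (-1 : K) • C) := by
    intro A B C
    module
  refine Eq.trans ?_ (half _ _ _).symm
  rw [HLin_smul, HLin_add, HLin_add]
  congr 1
  · simp only [lieZ3_d, wedge, Fin.sum_univ_three, dual_add, dual_smul, dual_one]
    simp
    module
  · simp only [coe_lieZ3_m, coe_lieZ3_sl, Fin.sum_univ_three, phiJ_neg_left, phiJ_neg_right]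
    refine LinearMap.ext fun z => ?_
    simp
    simp only [S.pairing_symm]
    module
  · simp only [coe_lieZ3_sl, Fin.sum_univ_three]
    simp
    simp only [S.pairing_symm]
    ring
  · simp only [lieZ3_v, wedge, Fin.sum_univ_three]
    simp
    module

theorem z3z2_lieZ3_w (x y : S.Z3) (k : Fin 2) :
    (S.z3z2 (S.lieZ3 x y)).2.2 k = (S.lieZ2 (S.z3z2 x) (S.z3z2 y)).2.2 k := by
  -- On V₂ ⊗ W_J the sl₂-part acts by (A₁₁ − A₃₃)/2 and the h(J)⁰-part by multiples of A₂₂; these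
  -- combine into the entries of the sl₃-action only for trace zero.
  have tx := coe_sl_one_one x.1
  have ty := coe_sl_one_one y.1
  rw [lieZ2_w]
  fin_cases k
  · simp [z3z2_apply, z3z2W, z3z2Sl, z3z2H_apply, coe_lieZ3_sl, lieZ3_v, lieZ3_d, wedge, Fin.sum_univ_three]
    refine ⟨?_, ?_, ?_, ?_⟩
    · rw [S.pairing_symm (y.2.2.1 _), S.pairing_symm (x.2.2.1 _), tx, ty]
      ring
    · rw [S.cross_comm (y.2.2.2 _), tx, ty]
      module
    · rw [S.cross_comm (y.2.2.1 _), tx, ty]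
      module
    · rw [tx, ty]
      ring
  · simp [z3z2_apply, z3z2W, z3z2Sl, z3z2H_apply, coe_lieZ3_sl, lieZ3_v, lieZ3_d, wedge, Fin.sum_univ_three]
    refine ⟨?_, ?_, ?_, ?_⟩
    · rw [S.pairing_symm (y.2.2.1 _), S.pairing_symm (x.2.2.1 _), tx, ty]
      ring
    · rw [S.cross_comm (y.2.2.2 _), tx, ty]
      module
    · rw [S.cross_comm (y.2.2.1 _), tx, ty]
      module
    · rw [tx, ty]
      ring

theorem z3z2_lieZ3 (x y : S.Z3) : S.z3z2 (S.lieZ3 x y) = S.lieZ2 (S.z3z2 x) (S.z3z2 y) :=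
  Prod.ext (S.z3z2_lieZ3_sl x y)
    (Prod.ext (S.z3z2_lieZ3_h x y) (funext fun k => S.z3z2_lieZ3_w x y k))

end Comparison

/-! ### The element w₂₃ preserves the bracket of the ℤ/3-model. -/

section Reflection

variable {J : Type*} [AddCommGroup J] [Module ℂ J] (S : CubicNormStructure ℂ J)

/-- An involution with symmetric matrix: the same matrix acts on V₃ and on its dual. -/
theorem w23_inv : (w23⁻¹).1 = w23.1 := by
  have h : w23 * w23 = 1 := by
    refine Subtype.ext ?_
    rw [Matrix.SpecialLinearGroup.coe_mul, Matrix.SpecialLinearGroup.coe_one]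
    ext i j
    fin_cases i <;> fin_cases j <;> simp [w23, Matrix.mul_apply, Fin.sum_univ_three]
  rw [inv_eq_of_mul_eq_one_left h]

/-- Here w₂₃ is minus the transposition of the last two indices. The sign, which makes the
determinant 1, cancels in conjugation but survives on V₃ and V₃^∨. -/
theorem actSL3_w23_sl (x : S.Z3) : (S.actSL3 w23 x).1.1 =
    !![x.1.1 0 0, x.1.1 0 2, x.1.1 0 1; x.1.1 2 0, x.1.1 2 2, x.1.1 2 1;
      x.1.1 1 0, x.1.1 1 2, x.1.1 1 1] := by
  change w23.1 * x.1.1 * (w23⁻¹).1 = _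
  rw [w23_inv]
  ext i j
  fin_cases i <;> fin_cases j <;>
    simp [w23, Matrix.mul_apply, Fin.sum_univ_three, Matrix.vecMul, dotProduct]

theorem actSL3_w23_m (x : S.Z3) : (S.actSL3 w23 x).2.1 = x.2.1 := rfl

theorem actSL3_w23_v (x : S.Z3) :
    (S.actSL3 w23 x).2.2.1 = ![-x.2.2.1 0, -x.2.2.1 2, -x.2.2.1 1] := by
  change (fun j => ∑ k, w23.1 j k • x.2.2.1 k) = _
  ext i
  fin_cases i <;> simp [w23, Fin.sum_univ_three]

theorem actSL3_w23_d (x : S.Z3) :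
    (S.actSL3 w23 x).2.2.2 = ![-x.2.2.2 0, -x.2.2.2 2, -x.2.2.2 1] := by
  change (fun j => ∑ k, (w23⁻¹).1 k j • x.2.2.2 k) = _
  rw [w23_inv]
  ext i
  fin_cases i <;> simp [w23, Fin.sum_univ_three]

theorem phiJ_neg_neg (γ x : J) : S.phiJ (-γ) (-x) = S.phiJ γ x := by
  refine LinearMap.ext fun z => ?_
  simp only [phiJ_apply, map_neg, LinearMap.neg_apply]
  module

variable [FiniteDimensional ℂ J]

/-- The delicate term is `wedge`: the transposition alone reverses its sign, and this agrees with
the sign by which w₂₃ acts on a single vector. -/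
theorem actSL3_w23_lieZ3_v (x y : S.Z3) : (S.actSL3 w23 (S.lieZ3 x y)).2.2.1
    = (S.lieZ3 (S.actSL3 w23 x) (S.actSL3 w23 y)).2.2.1 := by
  rw [actSL3_w23_v]
  ext k
  rw [S.lieZ3_v (S.actSL3 w23 x)]
  simp only [lieZ3_v, actSL3_w23_sl, actSL3_w23_m, actSL3_w23_v, actSL3_w23_d,
    Fin.sum_univ_three, wedge]
  fin_cases k <;> simp <;> module

theorem actSL3_w23_lieZ3_d (x y : S.Z3) : (S.actSL3 w23 (S.lieZ3 x y)).2.2.2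
    = (S.lieZ3 (S.actSL3 w23 x) (S.actSL3 w23 y)).2.2.2 := by
  rw [actSL3_w23_d]
  ext k
  rw [S.lieZ3_d (S.actSL3 w23 x)]
  simp only [lieZ3_d, actSL3_w23_sl, actSL3_w23_m, actSL3_w23_v, actSL3_w23_d,
    Fin.sum_univ_three, wedge]
  fin_cases k <;> simp <;> module

/-- In the two remaining components the V₃ and V₃^∨ parts enter bilinearly, so the signs cancel in
pairs and the sums over the index are merely reordered. -/
theorem actSL3_w23_lieZ3 (x y : S.Z3) :
    S.actSL3 w23 (S.lieZ3 x y) = S.lieZ3 (S.actSL3 w23 x) (S.actSL3 w23 y) := by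
  refine Prod.ext (Subtype.ext ?_) (Prod.ext (Subtype.ext ?_)
    (Prod.ext (S.actSL3_w23_lieZ3_v x y) (S.actSL3_w23_lieZ3_d x y)))
  · rw [actSL3_w23_sl]
    ext i j
    rw [S.coe_lieZ3_sl (S.actSL3 w23 x)]
    simp only [coe_lieZ3_sl, actSL3_w23_sl, actSL3_w23_v, actSL3_w23_d, Fin.sum_univ_three]
    fin_cases i <;> fin_cases j <;> simp <;> ring
  · rw [actSL3_w23_m, coe_lieZ3_m, coe_lieZ3_m]
    simp only [actSL3_w23_m, actSL3_w23_v, actSL3_w23_d, Fin.sum_univ_three]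
    simp [phiJ_neg_neg]
    module

end Reflection

/-! ### SL₂ × H_J¹ acts by Lie algebra automorphisms. -/

section Action

variable {K J : Type*} [Field K] [CharZero K] [AddCommGroup J] [Module K J]
variable (S : CubicNormStructure K J)

theorem conj_lie (g : Freud K J ≃ₗ[K] Freud K J) (φ ψ : Module.End K (Freud K J)) :
    g.conj ⁅φ, ψ⁆ = ⁅g.conj φ, g.conj ψ⁆ := by
  refine LinearMap.ext fun v => ?_
  simp only [LieRing.of_associative_ring_bracket, LinearEquiv.conj_apply_apply,
    LinearMap.sub_apply, Module.End.mul_apply, map_sub, LinearEquiv.symm_apply_apply]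

theorem eq_of_omega_eq {v w : Freud K J} (h : ∀ u, S.omega u v = S.omega u w) : v = w := by
  obtain ⟨a, b, c, d⟩ := v
  obtain ⟨a', b', c', d'⟩ := w
  have h0 := h (0, 0, 0, 1)
  have h3 := h (1, 0, 0, 0)
  have hb : b = b' := S.ext_pairing fun z => by
    have := h (0, 0, z, 0)
    simpa [omega, S.pairing_symm z] using this
  have hc : c = c' := S.ext_pairing fun z => by
    have := h (0, z, 0, 0)
    simpa [omega, S.pairing_symm z] using this
  simp [omega] at h0 h3
  rw [h0, hb, hc, h3]

theorem triple_add₁ (x x' y z : Freud K J) :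
    S.triple (x + x') y z = S.triple x y z + S.triple x' y z := by
  simp only [triple, preTriple_add_left, preTriple_add_mid, preTriple_add_right]; module

theorem triple_add₂ (x y y' z : Freud K J) :
    S.triple x (y + y') z = S.triple x y z + S.triple x y' z := by
  simp only [triple, preTriple_add_left, preTriple_add_mid, preTriple_add_right]; module

/-- Polarization: a symmetric trilinear map is determined by its values on the diagonal. -/
theorem triple_polar (x y z : Freud K J) : S.triple x y z = (1 / 6 : K) •
    (S.triple (x + y + z) (x + y + z) (x + y + z) - S.triple (x + y) (x + y) (x + y)
      - S.triple (x + z) (x + z) (x + z) - S.triple (y + z) (y + z) (y + z)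
      + S.triple x x x + S.triple y y y + S.triple z z z) := by
  have h1 := S.triple_swap_left
  have h2 := S.triple_swap_right
  simp only [triple_add, triple_add₁, triple_add₂, h1 y x, h1 z x, h1 z y, h2 x z y, h2 x y x,
    h2 x z x, h2 y z y, h2 y z x]
  module

/-- Invariance of q gives invariance of (u, v, v, v) = ⟨u, t(v, v, v)⟩. As g preserves ⟨ , ⟩ and is
surjective, nondegeneracy yields the claim on the diagonal, and polarization does the rest. -/
theorem triple_HJ1 (g : S.HJ1) (x y z : Freud K J) :
    S.triple (g.1 x) (g.1 y) (g.1 z) = g.1 (S.triple x y z) := by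
  have h : ∀ v, S.triple (g.1 v) (g.1 v) (g.1 v) = g.1 (S.triple v v v) := by
    refine fun v => S.eq_of_omega_eq fun u => ?_
    obtain ⟨u, rfl⟩ := g.1.surjective u
    rw [g.2.1]
    exact S.four_HJ1 g.2 v u
  rw [triple_polar, S.triple_polar x]
  simp only [← map_add, h, ← map_sub, ← map_smul]

variable [FiniteDimensional K J]

theorem PhiLin_HJ1 (g : S.HJ1) (w w' : Freud K J) :
    S.PhiLin (g.1 w) (g.1 w') = g.1.conj (S.PhiLin w w') := by
  refine LinearMap.ext fun v => ?_
  obtain ⟨v, rfl⟩ := g.1.surjective v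
  simp only [LinearEquiv.conj_apply_apply, LinearEquiv.symm_apply_apply, PhiLin_apply, triple_HJ1,
    g.2.1, map_add, map_smul]

/-- The h(J)⁰-part of the bracket is antisymmetrized over V₂, so a change of basis of V₂ multiplies
it by the determinant, which is 1 on SL₂. -/
theorem PhiLin_det (p q r s : K) (u v u' v' : Freud K J) :
    S.PhiLin (p • u + q • v) (r • u' + s • v') - S.PhiLin (r • u + s • v) (p • u' + q • v')
      = (p * s - q * r) • (S.PhiLin u v' - S.PhiLin v u') := by
  refine LinearMap.ext fun x => ?_
  have sm₁ : ∀ (a : K) (w w' : Freud K J), S.triple (a • w) w' x = a • S.triple w w' x :=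
    fun a w w' => by rw [S.triple_swap_left, S.triple_swap_right, triple_smul,
      S.triple_swap_right, S.triple_swap_left]
  have sm₂ : ∀ (a : K) (w w' : Freud K J), S.triple w (a • w') x = a • S.triple w w' x :=
    fun a w w' => by rw [S.triple_swap_left, sm₁, S.triple_swap_left]
  simp only [LinearMap.sub_apply, LinearMap.smul_apply, PhiLin_apply, triple_add₁, triple_add₂,
    sm₁, sm₂, omega_add_left, omega_smul_left]
  module

theorem act_sl (A : Matrix.SpecialLinearGroup (Fin 2) K) (g : S.HJ1) (x : S.Z2) :
    (S.act A g x).1.1 = A.1 * x.1.1 * A.1.adjugate := by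
  rw [← Matrix.SpecialLinearGroup.coe_inv]
  rfl

theorem act_h (A : Matrix.SpecialLinearGroup (Fin 2) K) (g : S.HJ1) (x : S.Z2) :
    (S.act A g x).2.1.1 = g.1.conj x.2.1.1 := rfl

theorem act_w (A : Matrix.SpecialLinearGroup (Fin 2) K) (g : S.HJ1) (x : S.Z2) (k : Fin 2) :
    (S.act A g x).2.2 k = A.1 k 0 • g.1 (x.2.2 0) + A.1 k 1 • g.1 (x.2.2 1) := by
  change ∑ l, A.1 k l • g.1 (x.2.2 l) = _
  rw [Fin.sum_univ_two]

theorem act_lieZ2 (A : Matrix.SpecialLinearGroup (Fin 2) K) (g : S.HJ1) (x y : S.Z2) :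
    S.act A g (S.lieZ2 x y) = S.lieZ2 (S.act A g x) (S.act A g y) := by
  have hA : A.1.adjugate * A.1 = 1 := by rw [Matrix.adjugate_mul, A.2, one_smul]
  have hdet := A.2
  rw [Matrix.det_fin_two] at hdet
  refine Prod.ext (Subtype.ext ?_) (Prod.ext (Subtype.ext ?_) (funext fun k => ?_))
  · rw [act_sl, coe_lieZ2_sl, coe_lieZ2_sl, act_sl, act_sl]
    simp only [act_w, omega_add_left, omega_add_right, omega_smul_left, omega_smul_right, g.2.1]
    -- Conjugation is multiplicative because the adjugate is the inverse, A having determinant 1.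
    have e : ∀ B C : Matrix (Fin 2) (Fin 2) K,
        A.1 * (B * C) * A.1.adjugate = A.1 * B * A.1.adjugate * (A.1 * C * A.1.adjugate) := by
      intro B C
      calc A.1 * (B * C) * A.1.adjugate = A.1 * B * 1 * C * A.1.adjugate := by
            simp only [mul_one, mul_assoc]
        _ = _ := by rw [← hA]; simp only [mul_assoc]
    rw [mul_add, add_mul, mul_sub, sub_mul, e, e]
    congr 1
    -- What remains is A (v · v') A⁻¹ = (A v) · (A v'), an identity between quadratic polynomials in
    -- the entries of A.
    rw [Matrix.adjugate_fin_two]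
    ext i j
    fin_cases i <;> fin_cases j <;> simp [Matrix.mul_apply, Fin.sum_univ_two] <;> ring
  · rw [act_h, coe_lieZ2_h, coe_lieZ2_h, act_h, act_h]
    simp only [act_w, PhiLin_det, PhiLin_HJ1, hdet]
    rw [map_add, conj_lie, map_smul, map_sub]
    module
  · rw [act_w, lieZ2_w, lieZ2_w, lieZ2_w]
    simp only [act_w, act_h, act_sl, LinearEquiv.conj_apply_apply, map_add, map_sub, map_smul,
      LinearEquiv.symm_apply_apply]
    -- The relation (A B A⁻¹) A = A B, read entry by entry: the conjugated matrix acts on the moved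
    -- vector as the moved action.
    have key : ∀ (B : Matrix (Fin 2) (Fin 2) K) (l : Fin 2),
        (A.1 * B * A.1.adjugate) k 0 * A.1 0 l + (A.1 * B * A.1.adjugate) k 1 * A.1 1 l
          = A.1 k 0 * B 0 l + A.1 k 1 * B 1 l := by
      intro B l
      have h : (A.1 * B * A.1.adjugate * A.1) k l = (A.1 * B) k l := by
        rw [Matrix.mul_assoc, hA, Matrix.mul_one]
      rwa [Matrix.mul_apply, Fin.sum_univ_two, Matrix.mul_apply (N := B), Fin.sum_univ_two] at h
    linear_combination (norm := module) -(key x.1.1 0) • g.1 (y.2.2 0)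
      - (key x.1.1 1) • g.1 (y.2.2 1) + (key y.1.1 0) • g.1 (x.2.2 0)
      + (key y.1.1 1) • g.1 (x.2.2 1)

end Action

/-! ### Identities at the base point 1_J. -/

section BasePoint

variable {K J : Type*} [Field K] [CharZero K] [AddCommGroup J] [Module K J]
variable (S : CubicNormStructure K J)

/-- The relation (x^#, x) = 3 N(x) at x = 1_J. -/
theorem pairing_one_one : S.pairing S.one S.one = 3 := by
  have h := S.pairing_sharp_self S.one
  rw [S.sharp_one, S.norm_one] at h
  linear_combination h

theorem norm_smul_one (a : K) : S.norm (a • S.one) = a ^ 3 := by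
  have h := S.norm_one
  rw [S.norm_eq] at h ⊢
  simp only [map_smul, LinearMap.smul_apply, smul_eq_mul]
  linear_combination a ^ 3 * h

theorem sharp_smul_one (a : K) : S.sharp (a • S.one) = a ^ 2 • S.one := by
  rw [S.sharp_smul, S.sharp_one]

theorem pairing_one_cross (x y : J) : S.pairing S.one (S.cross x y) =
    S.pairing S.one x * S.pairing S.one y - S.pairing x y := by
  rw [S.pairing_cross, S.tri_eq, S.one_cross, map_sub, map_smul, LinearMap.sub_apply,
    LinearMap.smul_apply, smul_eq_mul]

/-- Multiplication by 1_J is explicit, so the nested cross product in Φ_{1,x} collapses to a single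
one plus trace terms. -/
theorem phiJ_one_apply (x z : J) : S.phiJ S.one x z =
    S.cross x z + S.pairing S.one z • x + S.pairing S.one x • z
      + (S.pairing x z - S.pairing S.one x * S.pairing S.one z) • S.one := by
  rw [phiJ_apply, S.one_cross, pairing_one_cross]
  module

/-- Combined with `dual_phiJ` this makes Φ_{1,x} self-adjoint for the trace pairing, so both middle
slots of M(Φ_{1,x}) involve the same operator. -/
theorem phiJ_one_comm (x : J) : S.phiJ x S.one = S.phiJ S.one x := by
  refine LinearMap.ext fun z => ?_
  rw [phiJ_one_apply, phiJ_apply, S.one_cross, map_sub, map_smul, S.cross_comm x S.one,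
    S.one_cross, S.pairing_symm x S.one]
  module

end BasePoint

/-! ### Explicit formulas for C_h and w₂₃; 𝒞 is an automorphism. -/

section Cayley

variable {J : Type*} [AddCommGroup J] [Module ℝ J] [FiniteDimensional ℝ J]
variable (S : CubicNormStructure ℝ J)

theorem invSqrtTwo_sq : (invSqrtTwo : ℂ) ^ 2 = 1 / 2 := by
  change (((Real.sqrt 2 : ℝ) : ℂ)⁻¹) ^ 2 = 1 / 2
  rw [inv_pow, ← Complex.ofReal_pow, Real.sq_sqrt (by norm_num)]
  norm_num

theorem invSqrtTwo_inv : (invSqrtTwo : ℂ)⁻¹ = 2 * invSqrtTwo := by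
  have h := invSqrtTwo_sq
  have h0 : (invSqrtTwo : ℂ) ≠ 0 := invSqrtTwo.ne_zero
  field_simp
  linear_combination -2 * h

theorem C2_eq : (C2.1 : Matrix (Fin 2) (Fin 2) ℂ) =
    (invSqrtTwo : ℂ) • !![Complex.I, -1; 1, -Complex.I] := rfl

/-- Everything later about C_h is read off from this closed form, in which the only irrational
scalar is the common factor s = 2^{-1/2}. -/
theorem Ch_apply (a : ℂ) (b c : ℂ ⊗[ℝ] J) (d : ℂ) : S.Ch.1 (a, b, c, d) =
    (invSqrtTwo : ℂ) •
      (((1 / 2 : ℂ) * (a - Complex.I * S.trC b - S.trC c + Complex.I * d),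
        b + Complex.I • c - ((1 / 2 : ℂ) * (Complex.I * a + S.trC b + Complex.I * S.trC c + d))
          • S.complexify.one,
        Complex.I • b + c - ((1 / 2 : ℂ) * (a + Complex.I * S.trC b + S.trC c + Complex.I * d))
          • S.complexify.one,
        (1 / 2 : ℂ) * (Complex.I * a - S.trC b - Complex.I * S.trC c + d)) :
          Freud ℂ (ℂ ⊗[ℝ] J)) := by
  change S.complexify.nGLin (-Complex.I • S.complexify.one)
    (S.complexify.nGDualLin (-(Complex.I / 2) • S.complexify.one)
      ((invSqrtTwo : ℂ) ^ 3 * a, (invSqrtTwo : ℂ) • b, (invSqrtTwo : ℂ)⁻¹ • c,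
        (invSqrtTwo : ℂ)⁻¹ ^ 3 * d)) = _
  -- From s² = ½, the scalings s³, s, s⁻¹, s⁻³ of η(s) are s/2, s, 2s, 4s.
  have h3 : (invSqrtTwo : ℂ) ^ 3 = 1 / 2 * invSqrtTwo := by
    linear_combination (invSqrtTwo : ℂ) * invSqrtTwo_sq
  have hI : Complex.I ^ 2 = -1 := Complex.I_sq
  have hI3 : Complex.I ^ 3 = -Complex.I := by
    rw [pow_succ, hI, neg_one_mul]
  rw [invSqrtTwo_inv, mul_pow, h3]
  -- Every entry is now linear in s, so s may be taken as a free variable and only i² = −1 is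
  -- needed.
  generalize (invSqrtTwo : ℂ) = s
  have k1 : ∀ x, S.complexify.cross x S.complexify.one = S.trC x • S.complexify.one - x :=
    fun x => by rw [S.complexify.cross_comm, S.complexify.one_cross]; rfl
  have k2 : ∀ x, S.complexify.pairing x S.complexify.one = S.trC x :=
    fun x => S.complexify.pairing_symm _ _
  have k3 : S.trC S.complexify.one = 3 := S.complexify.pairing_one_one
  have k4 : ∀ x y, S.trC (x + y) = S.trC x + S.trC y := fun x y => map_add _ _ _
  have k5 : ∀ x y, S.trC (x - y) = S.trC x - S.trC y := fun x y => map_sub _ _ _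
  have k6 : ∀ (r : ℂ) x, S.trC (r • x) = r * S.trC x := fun r x => map_smul _ _ _
  simp only [nGLin_apply, nGDualLin_apply, sharp_smul_one, norm_smul_one, map_smul, map_add,
    map_sub, map_neg, LinearMap.smul_apply, LinearMap.add_apply, LinearMap.sub_apply, smul_eq_mul,
    k1, k2, k3, k4, k5, k6, Prod.smul_mk]
  refine Prod.ext ?_ (Prod.ext ?_ (Prod.ext ?_ ?_)) <;> dsimp only
  · grind
  · match_scalars <;> grind
  · match_scalars <;> grind
  · grind

theorem w23Act_z3z2 (x : S.complexify.Z3) :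
    S.w23Act (S.complexify.z3z2 x) = S.complexify.z3z2 (S.complexify.actSL3 w23 x) := by
  rw [w23Act, LinearEquiv.trans_apply, LinearEquiv.trans_apply, LinearEquiv.symm_apply_apply]

theorem cayley_apply (x : S.complexify.Z2) :
    S.cayley x = S.complexify.act C2 S.Ch (S.w23Act x) := rfl

theorem w23Act_lieZ2 (x y : S.complexify.Z2) :
    S.w23Act (S.complexify.lieZ2 x y) = S.complexify.lieZ2 (S.w23Act x) (S.w23Act y) := by
  obtain ⟨x, rfl⟩ := S.complexify.z3z2.surjective x
  obtain ⟨y, rfl⟩ := S.complexify.z3z2.surjective y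
  rw [← z3z2_lieZ3, w23Act_z3z2, w23Act_z3z2, w23Act_z3z2, ← z3z2_lieZ3, actSL3_w23_lieZ3]

theorem cayley_lieZ2 (x y : S.complexify.Z2) :
    S.cayley (S.complexify.lieZ2 x y) = S.complexify.lieZ2 (S.cayley x) (S.cayley y) := by
  rw [cayley_apply, w23Act_lieZ2, act_lieZ2]
  rfl

/-- The matrix with entry `a` in the upper right and `b` in the lower left corner. -/
def offDiag (a b : ℂ) : LieAlgebra.SpecialLinear.sl (Fin 2) ℂ :=
  ⟨!![0, a; b, 0], by rw [mem_slSub, Matrix.trace_fin_two_of, add_zero]⟩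

/-- Elements without diagonal sl₃-entries and without m(J)⁰-component. They include all of g(J)₁ and
every right-hand side of the twelve identities, so this one formula serves both. -/
theorem w23Act_eq (a d a' d' : ℂ) (b c b' c' x γ : ℂ ⊗[ℝ] J) (p q : ℂ) :
    S.w23Act (offDiag p q, S.complexify.nLDual γ + S.complexify.nL x,
      ![(a, b, c, d), (a', b', c', d')]) =
    (offDiag a (-d'), S.complexify.nLDual (-c) + S.complexify.nL b',
      ![(p, -b, -γ, a'), (d, x, -c', -q)]) := by
  have hM : S.complexify.M (S.complexify.mAdd 0 0) = 0 := by
    refine Subtype.ext (LinearMap.ext fun ⟨a, b, c, d⟩ => ?_)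
    change S.complexify.MLin (0 + (0 : ℂ) • 1) (0 + (0 : ℂ) • 3) (a, b, c, d) = 0
    have h0 : S.complexify.dual 0 = 0 := by
      simpa using S.complexify.dual_smul 0 0
    simp [MLin_apply, h0]
  -- With the preimage in the ℤ/3-model written out, w₂₃ only permutes entries and changes signs.
  have h : ∀ (a d a' d' : ℂ) (b c b' c' x γ : ℂ ⊗[ℝ] J) (p q : ℂ),
      ((offDiag p q, S.complexify.nLDual γ + S.complexify.nL x,
        ![(a, b, c, d), (a', b', c', d')]) : S.complexify.Z2) =
      S.complexify.z3z2 (⟨!![0, a, p; -d', 0, d; q, a', 0], by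
        rw [mem_slSub, Matrix.trace_fin_three]; simp⟩, 0, ![b, -x, b'], ![-c', γ, c]) := by
    intro a d a' d' b c b' c' x γ p q
    refine Prod.ext (Subtype.ext ?_) (Prod.ext ?_ ?_)
    · change !![0, p; q, 0] = (z3z2Sl _).1
      simp [z3z2Sl]
    · change _ = S.complexify.nLDual γ + S.complexify.M (S.complexify.mAdd 0 0)
        + S.complexify.nL (- -x)
      rw [hM, neg_neg, add_zero]
    · change _ = S.complexify.z3z2W _
      simp [z3z2W]
  rw [h, h, w23Act_z3z2]
  refine congrArg _ (Prod.ext (Subtype.ext ?_) (Prod.ext rfl (Prod.ext ?_ ?_)))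
  · rw [actSL3_w23_sl]
    simp
  · rw [actSL3_w23_v]
    simp
  · rw [actSL3_w23_d]
    simp

end Cayley

/-! ### 𝒞 matches the ℤ/2-grading with the Cartan decomposition. -/

section Grading

variable {J : Type*} [AddCommGroup J] [Module ℝ J] [FiniteDimensional ℝ J]
variable (S : CubicNormStructure ℝ J)

theorem act_act {K J : Type*} [Field K] [CharZero K] [AddCommGroup J] [Module K J]
    [FiniteDimensional K J] (S : CubicNormStructure K J) (A B : Matrix.SpecialLinearGroup (Fin 2) K) (g h : S.HJ1)
    (x : S.Z2) : S.act A g (S.act B h x) = S.act (A * B) (g * h) x := by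
  refine Prod.ext (Subtype.ext ?_) (Prod.ext (Subtype.ext ?_) (funext fun k => ?_))
  · rw [act_sl, act_sl, act_sl, Matrix.SpecialLinearGroup.coe_mul, Matrix.adjugate_mul_distrib]
    simp only [Matrix.mul_assoc]
  · rfl
  · simp only [act_w, Matrix.SpecialLinearGroup.coe_mul, Matrix.mul_apply, Fin.sum_univ_two,
      Subgroup.coe_mul, LinearEquiv.mul_apply, map_add, map_smul]
    module

/-- The diagonal matrix with entries `-i` and `i`, the conjugate of `J₂` by `C₂`. -/
def diagI : Matrix.SpecialLinearGroup (Fin 2) ℂ :=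
  ⟨!![-Complex.I, 0; 0, Complex.I], by simp [Matrix.det_fin_two_of]⟩

/-- The columns of C₂ are eigenvectors of J₂ with eigenvalues −i and i. -/
theorem J2_mul_C2 : J2 * C2 = C2 * diagI := by
  refine Subtype.ext ?_
  rw [Matrix.SpecialLinearGroup.coe_mul, Matrix.SpecialLinearGroup.coe_mul, C2_eq]
  ext i j
  fin_cases i <;> fin_cases j <;> simp [J2, diagI, mul_assoc]

/-- Likewise C_h diagonalizes J₂ on W_J: the four slots become eigenspaces with eigenvalues i, −i,
i, −i, the scalars of η(−i). -/
theorem J2W_mul_Ch : S.complexify.J2W * S.Ch =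
    S.Ch * S.complexify.eta (Units.mk0 (-Complex.I) (neg_ne_zero.2 Complex.I_ne_zero)) := by
  refine Subtype.ext (LinearEquiv.ext fun ⟨a, b, c, d⟩ => ?_)
  change S.complexify.J2W.1 (S.Ch.1 (a, b, c, d)) = S.Ch.1 ((-Complex.I) ^ 3 * a,
    (-Complex.I) • b, (-Complex.I)⁻¹ • c, (-Complex.I)⁻¹ ^ 3 * d)
  have hI : Complex.I ^ 2 = -1 := Complex.I_sq
  have h3 : (-Complex.I) ^ 3 = Complex.I := by rw [pow_succ, neg_sq, hI]; ring
  have h4 : (-Complex.I)⁻¹ = Complex.I := by rw [inv_neg, Complex.inv_I, neg_neg]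
  have h5 : Complex.I ^ 3 = -Complex.I := by rw [pow_succ, hI, neg_one_mul]
  have k6 : ∀ (r : ℂ) x, S.trC (r • x) = r * S.trC x := fun r x => map_smul _ _ _
  rw [h3, h4, h5, Ch_apply, Ch_apply, map_smul, J2W_apply, k6, k6]
  congr 1
  refine Prod.ext ?_ (Prod.ext ?_ (Prod.ext ?_ ?_)) <;> dsimp only
  · grind
  · match_scalars <;> grind
  · match_scalars <;> grind
  · grind

/-- Moving Θ past C₂ ⊠ C_h makes it diagonal, so that its signs can be read off from the coordinates
of the image under w₂₃. -/
theorem Theta_cayley (x : S.complexify.Z2) : S.complexify.Theta (S.cayley x) =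
    S.complexify.act C2 S.Ch (S.complexify.act diagI
      (S.complexify.eta (Units.mk0 (-Complex.I) (neg_ne_zero.2 Complex.I_ne_zero)))
        (S.w23Act x)) := by
  rw [cayley_apply, Theta, act_act, act_act, J2_mul_C2, J2W_mul_Ch]

theorem act_diagI_sl (g : S.complexify.HJ1) (x : S.complexify.Z2) :
    (S.complexify.act diagI g x).1.1 = !![x.1.1 0 0, -x.1.1 0 1; -x.1.1 1 0, x.1.1 1 1] := by
  rw [act_sl, Matrix.adjugate_fin_two]
  ext i j
  have hI := Complex.I_mul_I
  fin_cases i <;> fin_cases j <;> simp [diagI, Matrix.mul_apply, Fin.sum_univ_two, Matrix.vecMul, dotProduct] <;> grind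

theorem eta_negI_apply (a : ℂ) (b c : ℂ ⊗[ℝ] J) (d : ℂ) :
    (S.complexify.eta (Units.mk0 (-Complex.I) (neg_ne_zero.2 Complex.I_ne_zero))).1 (a, b, c, d) =
      Complex.I • ((a, -b, c, -d) : Freud ℂ (ℂ ⊗[ℝ] J)) := by
  change ((-Complex.I) ^ 3 * a, (-Complex.I) • b, (-Complex.I)⁻¹ • c,
    (-Complex.I)⁻¹ ^ 3 * d) = _
  have hI : Complex.I ^ 2 = -1 := Complex.I_sq
  have h3 : (-Complex.I) ^ 3 = Complex.I := by rw [pow_succ, neg_sq, hI]; ring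
  have h4 : (-Complex.I)⁻¹ = Complex.I := by rw [inv_neg, Complex.inv_I, neg_neg]
  have h5 : Complex.I ^ 3 = -Complex.I := by rw [pow_succ, hI, neg_one_mul]
  rw [h3, h4, h5]
  simp

/-- On e the matrix acts by −i, which turns the eigenvalues i, −i, i, −i into the signs +, −, +, −.
On f it acts by i, and the signs are opposite. -/
theorem act_diagI_w_zero (x : S.complexify.Z2) :
    (S.complexify.act diagI (S.complexify.eta
      (Units.mk0 (-Complex.I) (neg_ne_zero.2 Complex.I_ne_zero))) x).2.2 0 =
    ((x.2.2 0).1, -(x.2.2 0).2.1, (x.2.2 0).2.2.1, -(x.2.2 0).2.2.2) := by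
  rw [act_w, ← Prod.mk.eta (p := x.2.2 0)]
  obtain ⟨a, b, c, d⟩ := x.2.2 0
  rw [eta_negI_apply, smul_smul]
  simp [diagI]

theorem act_diagI_w_one (x : S.complexify.Z2) :
    (S.complexify.act diagI (S.complexify.eta
      (Units.mk0 (-Complex.I) (neg_ne_zero.2 Complex.I_ne_zero))) x).2.2 1 =
    (-(x.2.2 1).1, (x.2.2 1).2.1, -(x.2.2 1).2.2.1, (x.2.2 1).2.2.2) := by
  rw [act_w]
  obtain ⟨a, b, c, d⟩ := x.2.2 1
  have h : diagI.1 1 0 = 0 := rfl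
  have h' : diagI.1 1 1 = Complex.I := rfl
  rw [h, h', zero_smul, zero_add, eta_negI_apply, smul_smul]
  simp

/-- Consecutive slots of W_J have eigenvalues of ratio −1 under η(−i). Operators that shift by one
slot, as n_L and n_L^∨ do, change sign under conjugation; M(φ) preserves the slots and is fixed. -/
theorem conj_eta_negI_nL (x : ℂ ⊗[ℝ] J) :
    (S.complexify.eta (Units.mk0 (-Complex.I) (neg_ne_zero.2 Complex.I_ne_zero))).1.conj
      (S.complexify.nLLin x) = -S.complexify.nLLin x := by
  refine LinearMap.ext fun v => ?_
  obtain ⟨⟨a, b, c, d⟩, rfl⟩ := (S.complexify.eta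
    (Units.mk0 (-Complex.I) (neg_ne_zero.2 Complex.I_ne_zero))).1.surjective v
  rw [LinearEquiv.conj_apply_apply, LinearEquiv.symm_apply_apply, nLLin_apply, eta_negI_apply,
    eta_negI_apply, map_smul, LinearMap.neg_apply, nLLin_apply]
  simp

theorem conj_eta_negI_nLDual (x : ℂ ⊗[ℝ] J) :
    (S.complexify.eta (Units.mk0 (-Complex.I) (neg_ne_zero.2 Complex.I_ne_zero))).1.conj
      (S.complexify.nLDualLin x) = -S.complexify.nLDualLin x := by
  refine LinearMap.ext fun v => ?_
  obtain ⟨⟨a, b, c, d⟩, rfl⟩ := (S.complexify.eta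
    (Units.mk0 (-Complex.I) (neg_ne_zero.2 Complex.I_ne_zero))).1.surjective v
  rw [LinearEquiv.conj_apply_apply, LinearEquiv.symm_apply_apply, nLDualLin_apply, eta_negI_apply,
    eta_negI_apply, map_smul, LinearMap.neg_apply, nLDualLin_apply]
  simp

theorem conj_eta_negI_M (φ : Module.End ℂ (ℂ ⊗[ℝ] J)) (t : ℂ) :
    (S.complexify.eta (Units.mk0 (-Complex.I) (neg_ne_zero.2 Complex.I_ne_zero))).1.conj
      (S.complexify.MLin φ t) = S.complexify.MLin φ t := by
  refine LinearMap.ext fun v => ?_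
  obtain ⟨⟨a, b, c, d⟩, rfl⟩ := (S.complexify.eta
    (Units.mk0 (-Complex.I) (neg_ne_zero.2 Complex.I_ne_zero))).1.surjective v
  rw [LinearEquiv.conj_apply_apply, LinearEquiv.symm_apply_apply, MLin_apply, eta_negI_apply,
    eta_negI_apply, map_smul, MLin_apply]
  simp [add_comm]

/-- After w₂₃ such an element has only coordinates of sign −1: off-diagonal entries of sl₂, the
parts n_L^∨ and n_L, slots two and four over e, slots one and three over f. -/
theorem Theta_cayley_g1 {x : S.complexify.Z2} (hx : x ∈ S.complexify.g1) :
    S.complexify.Theta (S.cayley x) = -S.cayley x := by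
  obtain ⟨A, φ, U⟩ := x
  obtain ⟨rfl, rfl⟩ : A = 0 ∧ φ = 0 := hx
  have h : ((0, 0, U) : S.complexify.Z2) = (offDiag 0 0, S.complexify.nLDual 0
      + S.complexify.nL 0, ![((U 0).1, (U 0).2.1, (U 0).2.2.1, (U 0).2.2.2),
        ((U 1).1, (U 1).2.1, (U 1).2.2.1, (U 1).2.2.2)]) := by
    refine Prod.ext (Subtype.ext ?_) (Prod.ext (Subtype.ext ?_) ?_)
    · ext i j
      fin_cases i <;> fin_cases j <;> simp [offDiag]
    · refine LinearMap.ext fun ⟨a, b, c, d⟩ => ?_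
      change 0 = S.complexify.nLDualLin 0 (a, b, c, d) + S.complexify.nLLin 0 (a, b, c, d)
      simp [nLDualLin_apply, nLLin_apply]
      rfl
    · ext k : 1
      fin_cases k <;> rfl
  rw [Theta_cayley, cayley_apply, ← map_neg, h, w23Act_eq]
  refine congrArg _ (Prod.ext (Subtype.ext ?_) (Prod.ext (Subtype.ext ?_) ?_))
  · rw [act_diagI_sl]
    ext i j
    fin_cases i <;> fin_cases j <;> simp [offDiag]
  · rw [act_h]
    change _ = -(S.complexify.nLDualLin _ + S.complexify.nLLin _)
    rw [neg_add, ← conj_eta_negI_nL, ← conj_eta_negI_nLDual, ← map_add]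
    rfl
  · ext k : 1
    fin_cases k
    · refine (S.act_diagI_w_zero _).trans ?_
      simp
    · refine (S.act_diagI_w_one _).trans ?_
      simp

/-- The complementary coordinates, all of sign +1: the diagonal of sl₂, the part M(φ), slots one and
three over e, slots two and four over f. -/
theorem Theta_cayley_g0 {x : S.complexify.Z2} (hx : x ∈ S.complexify.g0) :
    S.complexify.Theta (S.cayley x) = S.cayley x := by
  rw [Theta_cayley, cayley_apply]
  refine congrArg _ ?_
  obtain ⟨x, rfl⟩ := S.complexify.z3z2.surjective x
  have h : S.complexify.z3z2W x = 0 := hx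
  have h0 := congrFun h 0
  have h1 := congrFun h 1
  simp [z3z2W, Prod.ext_iff] at h0 h1
  rw [w23Act_z3z2]
  refine Prod.ext (Subtype.ext ?_) (Prod.ext (Subtype.ext ?_) ?_)
  · rw [act_diagI_sl]
    simp [z3z2_apply, z3z2Sl, actSL3_w23_sl, h0, h1]
  · rw [act_h]
    -- The J and J^∨ parts of this component come, after the swap, from v₃ and δ₃, whose
    -- coefficients vanish on g(J)₀; only the M-part is left.
    have e : (S.complexify.z3z2H (S.complexify.actSL3 w23 x)).1 = S.complexify.MLin
        (x.2.1.1 + x.1.1 2 2 • 1) (3 * x.1.1 2 2) := by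
      rw [coe_z3z2H, actSL3_w23_sl, actSL3_w23_v, actSL3_w23_d, actSL3_w23_m]
      refine LinearMap.ext fun ⟨a, b, c, d⟩ => ?_
      simp [HLin_apply, MLin_apply, h0, h1]
    change (S.complexify.eta _).1.conj (S.complexify.z3z2H _).1 = (S.complexify.z3z2H _).1
    rw [e, conj_eta_negI_M]
  · ext k : 1
    fin_cases k
    · refine (S.act_diagI_w_zero _).trans ?_
      simp [z3z2_apply, z3z2W, actSL3_w23_sl, actSL3_w23_v, actSL3_w23_d, h0, h1]
    · refine (S.act_diagI_w_one _).trans ?_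
      simp [z3z2_apply, z3z2W, actSL3_w23_sl, actSL3_w23_v, actSL3_w23_d, h0, h1]

theorem exists_g0_add_g1 {K J : Type*} [Field K] [CharZero K] [AddCommGroup J] [Module K J]
    (S : CubicNormStructure K J) (x : S.Z2) : ∃ y ∈ S.g0, ∃ z ∈ S.g1, y + z = x :=
  ⟨(x.1, x.2.1, 0), rfl, (0, 0, x.2.2), ⟨rfl, rfl⟩,
    Prod.ext (add_zero _) (Prod.ext (add_zero _) (zero_add _))⟩

theorem mem_kC {x : S.complexify.Z2} : x ∈ S.kC ↔ S.complexify.Theta x = x := by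
  rw [kC, Module.End.mem_eigenspace_iff, one_smul]
  rfl

theorem mem_pC {x : S.complexify.Z2} : x ∈ S.pC ↔ S.complexify.Theta x = -x := by
  rw [pC, Module.End.mem_eigenspace_iff, neg_one_smul]
  rfl

theorem eq_zero_of_eq_neg {x : S.complexify.Z2} (h : x = -x) : x = 0 := by
  have h2 : (2 : ℂ) • x = 0 := by
    rw [two_smul]
    nth_rewrite 2 [h]
    exact add_neg_cancel x
  exact (smul_eq_zero.1 h2).resolve_left two_ne_zero

/-- One inclusion is the eigenvalue computation. For the other, the g(J)₁-part of a preimage of a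
Θ-fixed vector has an image equal to its own negative, hence zero. -/
theorem map_cayley_g0 : S.complexify.g0.map S.cayley.toLinearMap = S.kC := by
  refine le_antisymm ?_ fun x hx => ?_
  · rintro _ ⟨x, hx, rfl⟩
    exact S.mem_kC.2 (S.Theta_cayley_g0 hx)
  · obtain ⟨x, rfl⟩ := S.cayley.surjective x
    obtain ⟨y, hy, z, hz, rfl⟩ := S.complexify.exists_g0_add_g1 x
    have h := S.mem_kC.1 hx
    rw [map_add, map_add, Theta_cayley_g0 S hy, Theta_cayley_g1 S hz] at h
    have h0 := S.eq_zero_of_eq_neg (add_left_cancel h).symm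
    rw [map_add, h0, add_zero]
    exact ⟨y, hy, rfl⟩

theorem map_cayley_g1 : S.complexify.g1.map S.cayley.toLinearMap = S.pC := by
  refine le_antisymm ?_ fun x hx => ?_
  · rintro _ ⟨x, hx, rfl⟩
    exact S.mem_pC.2 (S.Theta_cayley_g1 hx)
  · obtain ⟨x, rfl⟩ := S.cayley.surjective x
    obtain ⟨y, hy, z, hz, rfl⟩ := S.complexify.exists_g0_add_g1 x
    have h := S.mem_pC.1 hx
    rw [map_add, map_add, Theta_cayley_g0 S hy, Theta_cayley_g1 S hz, neg_add] at h
    have h0 := S.eq_zero_of_eq_neg (add_right_cancel h)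
    rw [map_add, h0, zero_add]
    exact ⟨z, hz, rfl⟩

end Grading

/-! ### Bilinearity of the tensor v ⊗ w. -/

section Transport

variable {K J : Type*} [Field K] [AddCommGroup J] [Module K J]
variable (S : CubicNormStructure K J)

theorem tens_smul_left [CharZero K] (r : K) (v : Fin 2 → K) (w : Freud K J) :
    S.tens (r • v) w = r • S.tens v w := by
  refine Prod.ext (smul_zero r).symm (Prod.ext (smul_zero r).symm (funext fun k => ?_))
  exact mul_smul r (v k) w

theorem tens_smul_right [CharZero K] (r : K) (v : Fin 2 → K) (w : Freud K J) :
    S.tens v (r • w) = r • S.tens v w := by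
  refine Prod.ext (smul_zero r).symm (Prod.ext (smul_zero r).symm (funext fun k => ?_))
  exact smul_comm (v k) r w

end Transport

/-! ### Images of the basic vectors under w₂₃, C₂ and C_h. -/

section Identities

variable {J : Type*} [AddCommGroup J] [Module ℝ J] [FiniteDimensional ℝ J]
variable (S : CubicNormStructure ℝ J)

/-- The element of `g(J) ⊗ ℂ` with off-diagonal `sl₂`-component and with `h(J)⁰`-component
`n_L^∨(γ) + n_L(x)`. -/
def offDiagZ2 (p q : ℂ) (γ x : ℂ ⊗[ℝ] J) (v w : Freud ℂ (ℂ ⊗[ℝ] J)) : S.complexify.Z2 :=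
  (offDiag p q, S.complexify.nLDual γ + S.complexify.nL x, ![v, w])

theorem offDiagZ2_ext {p q : ℂ} {γ x : ℂ ⊗[ℝ] J} {v w : Freud ℂ (ℂ ⊗[ℝ] J)}
    {y : S.complexify.Z2} (h₁ : y.1.1 = !![0, p; q, 0])
    (h₂ : ∀ a b c d, y.2.1.1 (a, b, c, d) =
      S.complexify.nLDualLin γ (a, b, c, d) + S.complexify.nLLin x (a, b, c, d))
    (h₃ : y.2.2 0 = v) (h₄ : y.2.2 1 = w) : y = S.offDiagZ2 p q γ x v w := by
  refine Prod.ext (Subtype.ext h₁) (Prod.ext (Subtype.ext (LinearMap.ext fun ⟨a, b, c, d⟩ =>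
    h₂ a b c d)) (funext fun k => ?_))
  fin_cases k
  · exact h₃
  · exact h₄

theorem tens_e_eq (v : Freud ℂ (ℂ ⊗[ℝ] J)) :
    S.complexify.tens e v = S.offDiagZ2 0 0 0 0 v 0 := by
  refine S.offDiagZ2_ext ?_ (fun a b c d => ?_) ?_ ?_
  · ext i j
    fin_cases i <;> fin_cases j <;> rfl
  · simp [nLDualLin_apply, nLLin_apply, tens]
    rfl
  · simp [tens, e]
  · simp [tens, e]

theorem tens_f_eq (v : Freud ℂ (ℂ ⊗[ℝ] J)) :
    S.complexify.tens f v = S.offDiagZ2 0 0 0 0 0 v := by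
  refine S.offDiagZ2_ext ?_ (fun a b c d => ?_) ?_ ?_
  · ext i j
    fin_cases i <;> fin_cases j <;> rfl
  · simp [nLDualLin_apply, nLLin_apply, tens]
    rfl
  · simp [tens, f]
  · simp [tens, f]

theorem ofSl_offDiag_eq (p q : ℂ) :
    S.complexify.ofSl (offDiag p q) = S.offDiagZ2 p q 0 0 0 0 := by
  refine S.offDiagZ2_ext rfl (fun a b c d => ?_) rfl rfl
  simp [nLDualLin_apply, nLLin_apply, ofSl]
  rfl

theorem ofH_eq (γ x : ℂ ⊗[ℝ] J) :
    S.complexify.ofH (S.complexify.nLDual γ + S.complexify.nL x)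
      = S.offDiagZ2 0 0 γ x 0 0 := by
  refine S.offDiagZ2_ext ?_ (fun a b c d => rfl) rfl rfl
  ext i j
  fin_cases i <;> fin_cases j <;> rfl

theorem nL_zero : S.complexify.nL 0 = 0 := by
  refine Subtype.ext (LinearMap.ext fun ⟨a, b, c, d⟩ => ?_)
  change S.complexify.nLLin 0 (a, b, c, d) = 0
  simp [nLLin_apply]

theorem nLDual_zero : S.complexify.nLDual 0 = 0 := by
  refine Subtype.ext (LinearMap.ext fun ⟨a, b, c, d⟩ => ?_)
  change S.complexify.nLDualLin 0 (a, b, c, d) = 0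
  simp [nLDualLin_apply]

/-- All vectors in the twelve identities are put into this normal form, so that each instance of w₂₃
below is a substitution. -/
theorem w23Act_offDiagZ2 (p q : ℂ) (γ x : ℂ ⊗[ℝ] J) (v w : Freud ℂ (ℂ ⊗[ℝ] J)) :
    S.w23Act (S.offDiagZ2 p q γ x v w) = S.offDiagZ2 v.1 (-w.2.2.2) (-v.2.2.1) w.2.1
      (p, -v.2.1, -γ, w.1) (v.2.2.2, x, -w.2.2.1, -q) :=
  S.w23Act_eq _ _ _ _ _ _ _ _ _ _ _ _

theorem ofH_nLDual_eq (γ : ℂ ⊗[ℝ] J) :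
    S.complexify.ofH (S.complexify.nLDual γ) = S.offDiagZ2 0 0 γ 0 0 0 := by
  rw [← ofH_eq, nL_zero, add_zero]

theorem ofH_nL_eq (x : ℂ ⊗[ℝ] J) :
    S.complexify.ofH (S.complexify.nL x) = S.offDiagZ2 0 0 0 x 0 0 := by
  rw [← ofH_eq, nLDual_zero, zero_add]

theorem w23Act_tens_e_fst :
    S.w23Act (S.complexify.tens e (1, 0, 0, 0)) = S.complexify.ofSl (offDiag 1 0) := by
  simp only [tens_e_eq, tens_f_eq, ofSl_offDiag_eq, ofH_nLDual_eq, ofH_nL_eq, w23Act_offDiagZ2]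
  simp [neg_zero, Prod.zero_eq_mk]

theorem w23Act_tens_e_snd (X : ℂ ⊗[ℝ] J) :
    S.w23Act (S.complexify.tens e (0, X, 0, 0)) = S.complexify.tens e (0, -X, 0, 0) := by
  simp only [tens_e_eq, tens_f_eq, ofSl_offDiag_eq, ofH_nLDual_eq, ofH_nL_eq, w23Act_offDiagZ2]
  simp [neg_zero, Prod.zero_eq_mk]

theorem w23Act_tens_e_trd (X : ℂ ⊗[ℝ] J) :
    S.w23Act (S.complexify.tens e (0, 0, X, 0)) = S.complexify.ofH (S.complexify.nLDual (-X)) := by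
  simp only [tens_e_eq, tens_f_eq, ofSl_offDiag_eq, ofH_nLDual_eq, ofH_nL_eq, w23Act_offDiagZ2]
  simp [neg_zero, Prod.zero_eq_mk]

theorem w23Act_tens_e_last :
    S.w23Act (S.complexify.tens e (0, 0, 0, 1)) = S.complexify.tens f (1, 0, 0, 0) := by
  simp only [tens_e_eq, tens_f_eq, ofSl_offDiag_eq, ofH_nLDual_eq, ofH_nL_eq, w23Act_offDiagZ2]
  simp [neg_zero, Prod.zero_eq_mk]

theorem w23Act_tens_f_fst :
    S.w23Act (S.complexify.tens f (1, 0, 0, 0)) = S.complexify.tens e (0, 0, 0, 1) := by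
  simp only [tens_e_eq, tens_f_eq, ofSl_offDiag_eq, ofH_nLDual_eq, ofH_nL_eq, w23Act_offDiagZ2]
  simp [neg_zero, Prod.zero_eq_mk]

theorem w23Act_tens_f_snd (X : ℂ ⊗[ℝ] J) :
    S.w23Act (S.complexify.tens f (0, X, 0, 0)) = S.complexify.ofH (S.complexify.nL X) := by
  simp only [tens_e_eq, tens_f_eq, ofSl_offDiag_eq, ofH_nLDual_eq, ofH_nL_eq, w23Act_offDiagZ2]
  simp [neg_zero, Prod.zero_eq_mk]

theorem w23Act_tens_f_trd (X : ℂ ⊗[ℝ] J) :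
    S.w23Act (S.complexify.tens f (0, 0, X, 0)) = S.complexify.tens f (0, 0, -X, 0) := by
  simp only [tens_e_eq, tens_f_eq, ofSl_offDiag_eq, ofH_nLDual_eq, ofH_nL_eq, w23Act_offDiagZ2]
  simp [neg_zero, Prod.zero_eq_mk]

theorem w23Act_tens_f_last :
    S.w23Act (S.complexify.tens f (0, 0, 0, 1)) = S.complexify.ofSl (offDiag 0 (-1)) := by
  simp only [tens_e_eq, tens_f_eq, ofSl_offDiag_eq, ofH_nLDual_eq, ofH_nL_eq, w23Act_offDiagZ2]
  simp [neg_zero, Prod.zero_eq_mk]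

theorem w23Act_ofH_nLDual (X : ℂ ⊗[ℝ] J) :
    S.w23Act (S.complexify.ofH (S.complexify.nLDual X)) = S.complexify.tens e (0, 0, -X, 0) := by
  simp only [tens_e_eq, tens_f_eq, ofSl_offDiag_eq, ofH_nLDual_eq, ofH_nL_eq, w23Act_offDiagZ2]
  simp [neg_zero, Prod.zero_eq_mk]

theorem w23Act_ofH_nL (X : ℂ ⊗[ℝ] J) :
    S.w23Act (S.complexify.ofH (S.complexify.nL X)) = S.complexify.tens f (0, X, 0, 0) := by
  simp only [tens_e_eq, tens_f_eq, ofSl_offDiag_eq, ofH_nLDual_eq, ofH_nL_eq, w23Act_offDiagZ2]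
  simp [neg_zero, Prod.zero_eq_mk]

theorem w23Act_ofSl_upper :
    S.w23Act (S.complexify.ofSl (offDiag 1 0)) = S.complexify.tens e (1, 0, 0, 0) := by
  simp only [tens_e_eq, tens_f_eq, ofSl_offDiag_eq, ofH_nLDual_eq, ofH_nL_eq, w23Act_offDiagZ2]
  simp [neg_zero, Prod.zero_eq_mk]

theorem w23Act_ofSl_lower :
    S.w23Act (S.complexify.ofSl (offDiag 0 1)) = S.complexify.tens f (0, 0, 0, -1) := by
  simp only [tens_e_eq, tens_f_eq, ofSl_offDiag_eq, ofH_nLDual_eq, ofH_nL_eq, w23Act_offDiagZ2]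
  simp [neg_zero, Prod.zero_eq_mk]

theorem C2_mulVec_e : C2.1.mulVec e = (invSqrtTwo : ℂ) • (Complex.I • e + f) := by
  rw [C2_eq]
  ext i
  fin_cases i <;> simp [Matrix.mulVec, dotProduct, e, f]

theorem C2_mulVec_f : C2.1.mulVec f = ((invSqrtTwo : ℂ) * Complex.I) • (Complex.I • e - f) := by
  rw [C2_eq]
  ext i
  fin_cases i <;> simp [Matrix.mulVec, dotProduct, e, f, mul_assoc]

/-- This and the next three lemmas explain the special vectors: r₀(i), r₀(−i), V(X) and V(X)^* span,
up to scalars, the images under C_h of the first, fourth, second and third slots. -/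
theorem Ch_fst : S.Ch.1 (1, 0, 0, 0) =
    ((invSqrtTwo : ℂ) / 2) • S.r0 (Complex.I • S.complexify.one) := by
  rw [Ch_apply, r0, sharp_smul_one, norm_smul_one]
  have hI : Complex.I ^ 2 = -1 := Complex.I_sq
  have k : S.trC 0 = 0 := map_zero _
  simp only [Prod.smul_mk, smul_eq_mul, k]
  refine Prod.ext ?_ (Prod.ext ?_ (Prod.ext ?_ ?_)) <;> dsimp only
  · grind
  · match_scalars <;> grind
  · match_scalars <;> grind
  · grind

theorem Ch_last : S.Ch.1 (0, 0, 0, 1) =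
    ((invSqrtTwo : ℂ) * (Complex.I / 2)) • S.r0 (-Complex.I • S.complexify.one) := by
  rw [Ch_apply, r0, sharp_smul_one, norm_smul_one]
  have hI : Complex.I ^ 2 = -1 := Complex.I_sq
  have k : S.trC 0 = 0 := map_zero _
  simp only [Prod.smul_mk, smul_eq_mul, k]
  refine Prod.ext ?_ (Prod.ext ?_ (Prod.ext ?_ ?_)) <;> dsimp only
  · grind
  · match_scalars <;> grind
  · match_scalars <;> grind
  · grind

theorem Ch_snd (X : ℂ ⊗[ℝ] J) : S.Ch.1 (0, X, 0, 0) =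
    ((invSqrtTwo : ℂ) * -Complex.I) • S.V X := by
  rw [Ch_apply, V]
  have hI : Complex.I ^ 2 = -1 := Complex.I_sq
  have k : S.trC 0 = 0 := map_zero _
  simp only [Prod.smul_mk, smul_eq_mul, k]
  refine Prod.ext ?_ (Prod.ext ?_ (Prod.ext ?_ ?_)) <;> dsimp only
  · grind
  · match_scalars <;> grind
  · match_scalars <;> grind
  · grind

theorem Ch_trd (X : ℂ ⊗[ℝ] J) : S.Ch.1 (0, 0, X, 0) =
    ((invSqrtTwo : ℂ) * -1) • S.VStar X := by
  rw [Ch_apply, VStar]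
  have hI : Complex.I ^ 2 = -1 := Complex.I_sq
  have k : S.trC 0 = 0 := map_zero _
  simp only [Prod.smul_mk, smul_eq_mul, k]
  refine Prod.ext ?_ (Prod.ext ?_ (Prod.ext ?_ ?_)) <;> dsimp only
  · grind
  · match_scalars <;> grind
  · match_scalars <;> grind
  · grind

theorem act_Cayley_ofSl (A : LieAlgebra.SpecialLinear.sl (Fin 2) ℂ) :
    S.complexify.act C2 S.Ch (S.complexify.ofSl A) = S.complexify.ofSl (conjSl C2 A) := by
  change ((_, S.complexify.conjH S.Ch 0, tensAct _ C2 fun k => S.Ch.1 0) : S.complexify.Z2) = _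
  rw [map_zero, map_zero]
  exact congrArg (Prod.mk _) (congrArg (Prod.mk _) (map_zero (tensAct _ C2)))

theorem act_Cayley_ofH (φ : S.complexify.hJ) :
    S.complexify.act C2 S.Ch (S.complexify.ofH φ)
      = S.complexify.ofH (S.complexify.conjH S.Ch φ) := by
  change ((conjSl C2 0, _, tensAct _ C2 fun k => S.Ch.1 0) : S.complexify.Z2) = _
  rw [map_zero, map_zero]
  exact congrArg (Prod.mk _) (congrArg (Prod.mk _) (map_zero (tensAct _ C2)))

theorem conjSl_C2_offDiag (p q : ℂ) : (conjSl C2 (offDiag p q)).1 = (1 / 2 : ℂ) •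
    !![-Complex.I * (p - q), -(p + q); -(p + q), Complex.I * (p - q)] := by
  change C2.1 * !![0, p; q, 0] * (C2⁻¹).1 = _
  have h := invSqrtTwo_sq
  have hI := Complex.I_sq
  rw [Matrix.SpecialLinearGroup.coe_inv, C2_eq, Matrix.adjugate_fin_two]
  ext i j
  fin_cases i <;> fin_cases j <;>
    simp [Matrix.mul_apply, Fin.sum_univ_two, Matrix.vecMul, dotProduct] <;> grind

theorem cayley_symm_eEll : S.cayley.symm S.eEll = S.e0 := by
  have h := invSqrtTwo_sq
  rw [LinearEquiv.symm_apply_eq, cayley_apply, show S.e0 = S.complexify.ofSl (offDiag 1 0) from rfl,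
    w23Act_ofSl_upper, act_tens, C2_mulVec_e, Ch_fst, tens_smul_left, tens_smul_right, eEll,
    smul_smul]
  -- The scalars agree: s · s/2 = ¼.
  congr 1
  grind

theorem cayley_symm_fEll : S.cayley.symm S.fEll = S.f0 := by
  have h := invSqrtTwo_sq
  have hI := Complex.I_sq
  rw [LinearEquiv.symm_apply_eq, cayley_apply, show S.f0 = S.complexify.ofSl (offDiag 0 1) from rfl,
    w23Act_ofSl_lower, show ((0, 0, 0, -1) : Freud ℂ (ℂ ⊗[ℝ] J)) = (-1 : ℂ) • (0, 0, 0, 1) by simp,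
    tens_smul_right, map_smul, act_tens, C2_mulVec_f, Ch_last, tens_smul_left, tens_smul_right,
    fEll, smul_smul, smul_smul]
  -- Here −1 · (s i) · (s i/2) = s²/2 = ¼; the first sign comes from w₂₃.
  congr 1
  grind

end Identities

/-! ### Conjugates of n_L and n_L^∨ by C_h, complex conjugation, and the identities for 𝔭, n_E and
n_F. -/

section Preimages

variable {J : Type*} [AddCommGroup J] [Module ℝ J] [FiniteDimensional ℝ J]
variable (S : CubicNormStructure ℝ J)

/-- The endomorphism `½ (n_L(Z) + n_L^∨(Z)) + r M(Φ_{1,Z})` of `W_J ⊗ ℂ`. -/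
def midLin (r : ℂ) (Z : ℂ ⊗[ℝ] J) : Module.End ℂ (Freud ℂ (ℂ ⊗[ℝ] J)) :=
  (1 / 2 : ℂ) • (S.complexify.nLLin Z + S.complexify.nLDualLin Z)
    + r • S.complexify.MLin (S.complexify.phiJ S.complexify.one Z)
      (2 * S.complexify.pairing S.complexify.one Z)

theorem midLin_apply (r : ℂ) (Z : ℂ ⊗[ℝ] J) (a : ℂ) (b c : ℂ ⊗[ℝ] J) (d : ℂ) :
    S.midLin r Z (a, b, c, d) =
      ((1 / 2 : ℂ) * S.complexify.pairing Z b - r * S.trC Z * a,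
        (1 / 2 : ℂ) • (a • Z + S.complexify.cross Z c) + r • (S.complexify.cross Z b
          + S.trC b • Z + (S.complexify.pairing Z b - S.trC Z * S.trC b) • S.complexify.one),
        (1 / 2 : ℂ) • (d • Z + S.complexify.cross Z b) - r • (S.complexify.cross Z c
          + S.trC c • Z + (S.complexify.pairing Z c - S.trC Z * S.trC c) • S.complexify.one),
        (1 / 2 : ℂ) * S.complexify.pairing Z c + r * S.trC Z * d) := by
  simp only [midLin, LinearMap.add_apply, LinearMap.smul_apply, nLLin_apply, nLDualLin_apply,
    MLin_apply, dual_phiJ, LinearMap.neg_apply, phiJ_one_comm, phiJ_one_apply, Prod.smul_mk,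
    Prod.mk_add_mk, smul_eq_mul, S.complexify.cross_comm b Z, S.complexify.pairing_symm b Z,
    S.complexify.pairing_symm c Z, trC]
  refine Prod.ext ?_ (Prod.ext ?_ (Prod.ext ?_ ?_)) <;> dsimp only
  · ring
  · module
  · module
  · ring

theorem trC_add (x y : ℂ ⊗[ℝ] J) : S.trC (x + y) = S.trC x + S.trC y := map_add _ _ _

theorem trC_sub (x y : ℂ ⊗[ℝ] J) : S.trC (x - y) = S.trC x - S.trC y := map_sub _ _ _

theorem trC_smul (r : ℂ) (x : ℂ ⊗[ℝ] J) : S.trC (r • x) = r * S.trC x := map_smul _ _ _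

theorem trC_one : S.trC S.complexify.one = 3 := S.complexify.pairing_one_one

theorem trC_cross (x y : ℂ ⊗[ℝ] J) : S.trC (S.complexify.cross x y) =
    S.trC x * S.trC y - S.complexify.pairing x y := S.complexify.pairing_one_cross x y

theorem cross_oneC (x : ℂ ⊗[ℝ] J) : S.complexify.cross x S.complexify.one =
    S.trC x • S.complexify.one - x := by
  rw [S.complexify.cross_comm, S.complexify.one_cross]
  rfl

theorem pairing_oneC (x : ℂ ⊗[ℝ] J) : S.complexify.pairing x S.complexify.one = S.trC x :=
  S.complexify.pairing_symm _ _

/-- The conjugate by C_h is found from an intertwining relation on a generic vector, so C_h⁻¹ never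
has to be computed. The companion statement for n_L differs only in the sign of i in the parameter.
-/
theorem Ch_nLDualLin (Z : ℂ ⊗[ℝ] J) (v : Freud ℂ (ℂ ⊗[ℝ] J)) :
    S.Ch.1 (S.complexify.nLDualLin Z v) = S.midLin (-(Complex.I / 2)) Z (S.Ch.1 v) := by
  obtain ⟨a, b, c, d⟩ := v
  rw [nLDualLin_apply, Ch_apply, Ch_apply, map_smul, midLin_apply]
  refine congrArg (_ • ·) ?_
  have hI : Complex.I ^ 2 = -1 := Complex.I_sq
  simp only [trC_add, trC_sub, trC_smul, trC_one, trC_cross, map_add, map_sub, map_smul,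
    cross_oneC, pairing_oneC, smul_eq_mul, S.complexify.pairing_symm b Z]
  refine Prod.ext ?_ (Prod.ext ?_ (Prod.ext ?_ ?_)) <;> dsimp only
  · grind
  · match_scalars <;> grind
  · match_scalars <;> grind
  · grind

theorem Ch_nLLin (Z : ℂ ⊗[ℝ] J) (v : Freud ℂ (ℂ ⊗[ℝ] J)) :
    S.Ch.1 (S.complexify.nLLin Z v) = S.midLin (Complex.I / 2) Z (S.Ch.1 v) := by
  obtain ⟨a, b, c, d⟩ := v
  rw [nLLin_apply, Ch_apply, Ch_apply, map_smul, midLin_apply]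
  refine congrArg (_ • ·) ?_
  have hI : Complex.I ^ 2 = -1 := Complex.I_sq
  simp only [trC_add, trC_sub, trC_smul, trC_one, trC_cross, map_add, map_sub, map_smul,
    cross_oneC, pairing_oneC, smul_eq_mul, S.complexify.pairing_symm c Z,
    S.complexify.pairing_symm b Z, S.complexify.cross_comm b Z]
  refine Prod.ext ?_ (Prod.ext ?_ (Prod.ext ?_ ?_)) <;> dsimp only
  · grind
  · match_scalars <;> grind
  · match_scalars <;> grind
  · grind

theorem conjH_Ch_nLDual (Z : ℂ ⊗[ℝ] J) :
    (S.complexify.conjH S.Ch (S.complexify.nLDual Z)).1 = S.midLin (-(Complex.I / 2)) Z := by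
  refine LinearMap.ext fun v => ?_
  obtain ⟨v, rfl⟩ := S.Ch.1.surjective v
  rw [← Ch_nLDualLin]
  exact congrArg (fun u => S.Ch.1 (S.complexify.nLDualLin Z u)) (S.Ch.1.symm_apply_apply v)

theorem conjH_Ch_nL (Z : ℂ ⊗[ℝ] J) :
    (S.complexify.conjH S.Ch (S.complexify.nL Z)).1 = S.midLin (Complex.I / 2) Z := by
  refine LinearMap.ext fun v => ?_
  obtain ⟨v, rfl⟩ := S.Ch.1.surjective v
  rw [← Ch_nLLin]
  exact congrArg (fun u => S.Ch.1 (S.complexify.nLLin Z u)) (S.Ch.1.symm_apply_apply v)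

/-- Since i · (−i/2) = ½, the element h₋₁(Z) is i times the conjugate of n_L^∨(Z) by C_h. -/
theorem hNeg1_eq (Z : J) :
    (S.hNeg1 Z).2.1.1 = Complex.I • S.midLin (-(Complex.I / 2)) (toC Z) := by
  have hI : Complex.I ^ 2 = -1 := Complex.I_sq
  change (Complex.I / 2) • (S.complexify.nLLin (toC Z) + S.complexify.nLDualLin (toC Z))
    + (1 / 2 : ℂ) • S.complexify.MLin (S.complexify.phiJ S.complexify.one (toC Z))
      (2 * S.complexify.pairing S.complexify.one (toC Z)) = _
  rw [midLin]
  match_scalars <;> grind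

theorem conjJ_toC (X : J) : conjJ (toC X) = toC X := by
  rw [toC, conjJ_tmul, map_one]

theorem conjJ_one : conjJ S.complexify.one = S.complexify.one := conjJ_toC S.one

theorem trC_conjJ (x : ℂ ⊗[ℝ] J) : S.trC (conjJ x) = starRingEnd ℂ (S.trC x) := by
  have h := S.pairing_conjJ S.complexify.one x
  rw [conjJ_one] at h
  exact h

/-- All ingredients attached to a real Z commute with complex conjugation, so only the parameter r
is conjugated. This exchanges the conjugates of n_L^∨(Z) and n_L(Z) by C_h. -/
theorem conjW_midLin (r : ℂ) (Z : J) (v : Freud ℂ (ℂ ⊗[ℝ] J)) :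
    conjW (S.midLin r (toC Z) (conjW v)) = S.midLin (starRingEnd ℂ r) (toC Z) v := by
  obtain ⟨a, b, c, d⟩ := v
  have hp : ∀ x, starRingEnd ℂ (S.complexify.pairing (toC Z) (conjJ x))
      = S.complexify.pairing (toC Z) x := fun x => by
    rw [← pairing_conjJ, conjJ_conjJ, conjJ_toC]
  have hc : ∀ x, conjJ (S.complexify.cross (toC Z) (conjJ x))
      = S.complexify.cross (toC Z) x := fun x => by
    rw [← cross_conjJ, conjJ_conjJ, conjJ_toC]
  have ht : starRingEnd ℂ (S.trC (toC Z)) = S.trC (toC Z) := by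
    rw [← trC_conjJ, conjJ_toC]
  simp only [conjW, midLin_apply, map_add, map_sub, map_mul, conjJ_smul, hp, hc, ht, conjJ_one,
    conjJ_toC, trC_conjJ, Complex.conj_conj, map_div₀, map_one, map_ofNat]

theorem conjZ2_smul_tens (r : ℂ) (v : Fin 2 → ℂ) (w : Freud ℂ (ℂ ⊗[ℝ] J)) :
    S.conjZ2 (r • S.complexify.tens v w) =
      starRingEnd ℂ r • S.complexify.tens (fun k => starRingEnd ℂ (v k)) (conjW w) := by
  refine Prod.ext (Subtype.ext ?_) (Prod.ext (Subtype.ext (LinearMap.ext fun u => ?_))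
    (funext fun k => ?_))
  · ext i j
    change starRingEnd ℂ (r * 0) = starRingEnd ℂ r * 0
    simp
  · change conjW (r • (0 : Freud ℂ (ℂ ⊗[ℝ] J))) = starRingEnd ℂ r • (0 : Freud ℂ (ℂ ⊗[ℝ] J))
    rw [smul_zero, smul_zero]
    simp [conjW]
  · change conjW (r • v k • w) = starRingEnd ℂ r • starRingEnd ℂ (v k) • conjW w
    rw [conjW_smul, conjW_smul]

/-- Conjugation exchanges the lines of ie + f and ie − f, the two eigenlines of J₂; this is why
barred elements have preimages over f when the unbarred ones have them over e. -/
theorem conj_I_e_add_f : (fun k => starRingEnd ℂ ((Complex.I • e + f) k))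
    = (-1 : ℂ) • (Complex.I • e - f) := by
  ext k
  fin_cases k <;> simp [e, f]

theorem conj_I_e_sub_f : (fun k => starRingEnd ℂ ((Complex.I • e - f) k))
    = (-1 : ℂ) • (Complex.I • e + f) := by
  ext k
  fin_cases k <;> simp [e, f]

theorem conjW_V (X : J) : conjW (S.V (toC X)) = S.VStar (toC X) := by
  have ht : starRingEnd ℂ (S.trC (toC X)) = S.trC (toC X) := by
    rw [← trC_conjJ, conjJ_toC]
  rw [V, VStar, conjW_smul]
  simp [conjW, conjJ_smul, conjJ_one, conjJ_toC, ht, sub_eq_add_neg, map_ofNat]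

theorem conjW_r0 : conjW (S.r0 (Complex.I • S.complexify.one))
    = S.r0 (-Complex.I • S.complexify.one) := by
  rw [r0, r0, sharp_smul_one, sharp_smul_one, norm_smul_one, norm_smul_one]
  simp [conjW, conjJ_smul, conjJ_one]
  linear_combination Complex.I * Complex.I_sq

theorem conjZ2_h1 (X : J) : S.conjZ2 (S.h1 X) =
    (-(1 / 2) : ℂ) • S.complexify.tens (Complex.I • e - f) (S.VStar (toC X)) := by
  rw [h1, conjZ2_smul_tens, conj_I_e_add_f, conjW_V, tens_smul_left, smul_smul]
  congr 1
  simp [map_ofNat]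

theorem conjZ2_hNeg3 : S.conjZ2 S.hNeg3 = (-(1 / 4) : ℂ) •
    S.complexify.tens (Complex.I • e + f) (S.r0 (-Complex.I • S.complexify.one)) := by
  rw [hNeg3, conjZ2_smul_tens, conj_I_e_sub_f, conjW_r0, tens_smul_left, smul_smul]
  congr 1
  simp [map_ofNat]

theorem cayley_symm_h3 : S.cayley.symm S.h3 =
    -Complex.I • S.complexify.tens e (1, 0, 0, 0) := by
  have hI := Complex.I_sq
  rw [LinearEquiv.symm_apply_eq, map_smul, cayley_apply, w23Act_tens_e_fst, act_Cayley_ofSl,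
    ← map_smul, h3]
  refine congrArg _ (Subtype.ext ?_)
  change _ = -Complex.I • (conjSl C2 (offDiag 1 0)).1
  rw [conjSl_C2_offDiag]
  change (1 / 2 : ℂ) • !![-1, Complex.I; Complex.I, 1] = _
  ext i j
  fin_cases i <;> fin_cases j <;> simp <;> grind

theorem cayley_symm_conj_h3 : S.cayley.symm (S.conjZ2 S.h3) =
    -Complex.I • S.complexify.tens f (0, 0, 0, 1) := by
  have hI := Complex.I_sq
  -- The conjugate matrix ½(−1, −i; −i, 1) is −i times the conjugate by C₂ of −E₂₁.
  have h : S.conjZ2 S.h3 = S.complexify.ofSl (-Complex.I • conjSl C2 (offDiag 0 (-1))) := by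
    refine Prod.ext (Subtype.ext ?_) (Prod.ext (Subtype.ext (LinearMap.ext fun v => ?_))
      (funext fun k => ?_))
    · change Matrix.map ((1 / 2 : ℂ) • !![-1, Complex.I; Complex.I, 1]) (starRingEnd ℂ)
        = -Complex.I • (conjSl C2 (offDiag 0 (-1))).1
      rw [conjSl_C2_offDiag]
      ext i j
      fin_cases i <;> fin_cases j <;> simp [map_ofNat] <;> grind
    · change conjW 0 = 0
      simp [conjW]
    · change conjW 0 = 0
      simp [conjW]
  rw [LinearEquiv.symm_apply_eq, map_smul, cayley_apply, w23Act_tens_f_last, act_Cayley_ofSl,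
    ← map_smul, h]

theorem cayley_symm_h1 (X : J) : S.cayley.symm (S.h1 X) =
    -Complex.I • S.complexify.tens e (0, toC X, 0, 0) := by
  have h := invSqrtTwo_sq
  have hI := Complex.I_sq
  rw [LinearEquiv.symm_apply_eq, map_smul, cayley_apply, w23Act_tens_e_snd,
    show ((0, -toC X, 0, 0) : Freud ℂ (ℂ ⊗[ℝ] J)) = (-1 : ℂ) • (0, toC X, 0, 0) by simp,
    tens_smul_right, map_smul, act_tens, C2_mulVec_e, Ch_snd, tens_smul_left, tens_smul_right,
    h1, smul_smul, smul_smul, smul_smul]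
  -- The scalars: (−i) · (−1) · s · (−i s) = s² = ½, where −1 comes from w₂₃.
  congr 1
  grind

theorem cayley_symm_conj_h1 (X : J) : S.cayley.symm (S.conjZ2 (S.h1 X)) =
    Complex.I • S.complexify.tens f (0, 0, toC X, 0) := by
  have h := invSqrtTwo_sq
  have hI := Complex.I_sq
  rw [LinearEquiv.symm_apply_eq, map_smul, cayley_apply, w23Act_tens_f_trd,
    show ((0, 0, -toC X, 0) : Freud ℂ (ℂ ⊗[ℝ] J)) = (-1 : ℂ) • (0, 0, toC X, 0) by simp,
    tens_smul_right, map_smul, act_tens, C2_mulVec_f, Ch_trd, tens_smul_left, tens_smul_right,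
    conjZ2_h1, smul_smul, smul_smul, smul_smul]
  congr 1
  -- The scalars: i · (−1) · (s i) · (−s) = −s² = −½.
  grind

theorem cayley_symm_hNeg1 (Z : J) : S.cayley.symm (S.hNeg1 Z) =
    -Complex.I • S.complexify.tens e (0, 0, toC Z, 0) := by
  rw [LinearEquiv.symm_apply_eq, map_smul, cayley_apply, w23Act_tens_e_trd, act_Cayley_ofH,
    ← map_smul]
  refine congrArg S.complexify.ofH (Subtype.ext ?_)
  refine (S.hNeg1_eq Z).trans ?_
  change _ = -Complex.I • (S.complexify.conjH S.Ch (S.complexify.nLDual (-toC Z))).1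
  have h : S.complexify.nLDual (-toC Z) = -S.complexify.nLDual (toC Z) := by
    refine Subtype.ext (LinearMap.ext fun ⟨a, b, c, d⟩ => ?_)
    change S.complexify.nLDualLin (-toC Z) (a, b, c, d)
      = -S.complexify.nLDualLin (toC Z) (a, b, c, d)
    simp [nLDualLin_apply]
  rw [h, map_neg]
  change _ = -Complex.I • -(S.complexify.conjH S.Ch (S.complexify.nLDual (toC Z))).1
  -- The sign that w₂₃ puts on δ₃ ⊗ Z turns the factor −i into the i of `hNeg1_eq`.
  rw [conjH_Ch_nLDual, smul_neg, neg_smul, neg_neg]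

theorem cayley_symm_conj_hNeg1 (Z : J) : S.cayley.symm (S.conjZ2 (S.hNeg1 Z)) =
    -Complex.I • S.complexify.tens f (0, toC Z, 0, 0) := by
  rw [LinearEquiv.symm_apply_eq, map_smul, cayley_apply, w23Act_tens_f_snd, act_Cayley_ofH,
    ← map_smul]
  refine Prod.ext (Subtype.ext ?_) (Prod.ext (Subtype.ext (LinearMap.ext fun v => ?_))
    (funext fun k => ?_))
  · change Matrix.map 0 (starRingEnd ℂ) = 0
    ext i j
    simp
  · change conjW ((S.hNeg1 Z).2.1.1 (conjW v))
      = -Complex.I • (S.complexify.conjH S.Ch (S.complexify.nL (toC Z))).1 v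
    -- The conjugate of i · `midLin` with parameter −i/2 is −i · `midLin` with parameter i/2, which
    -- is −i times the conjugate of n_L(Z) by C_h.
    rw [hNeg1_eq, conjH_Ch_nL, LinearMap.smul_apply, conjW_smul, conjW_midLin]
    simp [map_ofNat, neg_div]
  · change conjW 0 = 0
    simp [conjW]

theorem cayley_symm_hNeg3 : S.cayley.symm S.hNeg3 =
    -Complex.I • S.complexify.tens e (0, 0, 0, 1) := by
  have h := invSqrtTwo_sq
  have hI := Complex.I_sq
  rw [LinearEquiv.symm_apply_eq, map_smul, cayley_apply, w23Act_tens_e_last, act_tens,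
    C2_mulVec_f, Ch_fst, tens_smul_left, tens_smul_right, hNeg3, smul_smul, smul_smul]
  congr 1
  grind

theorem cayley_symm_conj_hNeg3 : S.cayley.symm (S.conjZ2 S.hNeg3) =
    Complex.I • S.complexify.tens f (1, 0, 0, 0) := by
  have h := invSqrtTwo_sq
  have hI := Complex.I_sq
  rw [LinearEquiv.symm_apply_eq, map_smul, cayley_apply, w23Act_tens_f_fst, act_tens,
    C2_mulVec_e, Ch_last, tens_smul_left, tens_smul_right, conjZ2_hNeg3, smul_smul, smul_smul]
  congr 1
  grind

theorem cayley_symm_nE (X : J) : S.cayley.symm (S.nE X) =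
    S.complexify.ofH (S.complexify.nLDual (toC X)) := by
  have h := invSqrtTwo_sq
  rw [LinearEquiv.symm_apply_eq, cayley_apply, w23Act_ofH_nLDual,
    show ((0, 0, -toC X, 0) : Freud ℂ (ℂ ⊗[ℝ] J)) = (-1 : ℂ) • (0, 0, toC X, 0) by simp,
    tens_smul_right, map_smul, act_tens, C2_mulVec_e, Ch_trd, tens_smul_left, tens_smul_right,
    nE, smul_smul, smul_smul]
  congr 1
  grind

theorem cayley_symm_nF (Y : J) : S.cayley.symm (S.nF Y) =
    S.complexify.ofH (S.complexify.nL (toC Y)) := by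
  have h := invSqrtTwo_sq
  have hI := Complex.I_sq
  rw [LinearEquiv.symm_apply_eq, cayley_apply, w23Act_ofH_nL, act_tens, C2_mulVec_f, Ch_snd,
    tens_smul_left, tens_smul_right, nF, smul_smul]
  congr 1
  grind

end Preimages

end CubicNormStructure

end CubicLie

end

theorem theorem5p1 {J : Type*} [AddCommGroup J] [Module ℝ J] [FiniteDimensional ℝ J]
    (S : CubicLie.CubicNormStructure ℝ J) (hpos : ∀ x : J, x ≠ 0 → 0 < S.pairing x x) :
    -- `𝒞` is an automorphism of the Lie algebra `g(J) ⊗ ℂ`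
    (∀ x y : S.complexify.Z2,
      S.cayley (S.complexify.lieZ2 x y) = S.complexify.lieZ2 (S.cayley x) (S.cayley y)) ∧
    -- it takes `g(J)₀ ⊗ ℂ` to `𝔨` and `g(J)₁ ⊗ ℂ` to `𝔭`
    S.complexify.g0.map S.cayley.toLinearMap = S.kC ∧
    S.complexify.g1.map S.cayley.toLinearMap = S.pC ∧
    -- the twelve identities
    S.cayley.symm S.h3 =
      -Complex.I • S.complexify.tens CubicLie.CubicNormStructure.e (1, 0, 0, 0) ∧
    (∀ X : J, S.cayley.symm (S.h1 X) = -Complex.I • S.complexify.tens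
      CubicLie.CubicNormStructure.e (0, CubicLie.CubicNormStructure.toC X, 0, 0)) ∧
    (∀ Z : J, S.cayley.symm (S.hNeg1 Z) = -Complex.I • S.complexify.tens
      CubicLie.CubicNormStructure.e (0, 0, CubicLie.CubicNormStructure.toC Z, 0)) ∧
    S.cayley.symm S.hNeg3 =
      -Complex.I • S.complexify.tens CubicLie.CubicNormStructure.e (0, 0, 0, 1) ∧
    (∀ X : J, S.cayley.symm (S.nE X) = S.complexify.ofH
      (S.complexify.nLDual (CubicLie.CubicNormStructure.toC X))) ∧
    (∀ Y : J, S.cayley.symm (S.nF Y) = S.complexify.ofH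
      (S.complexify.nL (CubicLie.CubicNormStructure.toC Y))) ∧
    S.cayley.symm S.eEll = S.e0 ∧
    S.cayley.symm S.fEll = S.f0 ∧
    S.cayley.symm (S.conjZ2 S.h3) =
      -Complex.I • S.complexify.tens CubicLie.CubicNormStructure.f (0, 0, 0, 1) ∧
    (∀ X : J, S.cayley.symm (S.conjZ2 (S.h1 X)) = Complex.I • S.complexify.tens
      CubicLie.CubicNormStructure.f (0, 0, CubicLie.CubicNormStructure.toC X, 0)) ∧
    (∀ Z : J, S.cayley.symm (S.conjZ2 (S.hNeg1 Z)) = -Complex.I • S.complexify.tens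
      CubicLie.CubicNormStructure.f (0, CubicLie.CubicNormStructure.toC Z, 0, 0)) ∧
    S.cayley.symm (S.conjZ2 S.hNeg3) =
      Complex.I • S.complexify.tens CubicLie.CubicNormStructure.f (1, 0, 0, 0) :=
  ⟨S.cayley_lieZ2, S.map_cayley_g0, S.map_cayley_g1, S.cayley_symm_h3, S.cayley_symm_h1,
    S.cayley_symm_hNeg1, S.cayley_symm_hNeg3, S.cayley_symm_nE, S.cayley_symm_nF,
    S.cayley_symm_eEll, S.cayley_symm_fEll, S.cayley_symm_conj_h3, S.cayley_symm_conj_h1,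
    S.cayley_symm_conj_hNeg1, S.cayley_symm_conj_hNeg3⟩
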